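/- Let $d\in\mathbb N$, $T>0$, $1<p<\infty$, $\mathbb T^d=\mathbb R^d/\mathbb Z^d$, and let $$u\in L^1(0,T;W^{1,p}(\mathbb T^d))^d\cap L^\infty((0,T)\times\mathbb T^d)^d,$$ with $\operatorname{div}(u)^-\in L^\infty((0,T)\times\mathbb T^d)$ if $p\le d$, and only $\operatorname{div}(u)^-\in L^1(0,T;L^\infty(\mathbb T^d))$ if $p>d$. Vector fields on $\mathbb T^d$ are identified with $\mathbb Z^d$-periodic fields on $\mathbb R^d$, and flows on $\mathbb T^d$ with their lifts to $\mathbb R^d$; $|\cdot|$ is the Euclidean norm and $L^p(\mathbb T^d)$ norms are taken over $[0,1)^d$. Let $\eta$ be a standard mollifier on $\mathbb R^d$ (smooth, nonnegative, supported in the closed unit ball, $\int\eta=1$), $\eta_\delta(x)=\delta^{-d}\eta(x/\delta)$, and $u_\delta(t,\cdot)=\eta_\delta*u(t,\cdot)$. For an integer $M\ge1$ put $\Delta t=T/M$ and $t_n=n\Delta t$. For a field $v$, the Euler approximation with time step $\Delta t$ is defined by $\Phi_E^v(0,x)=x$ and $$\Phi_E^v(t,x)=\Phi_E^v(t_n,x)+(t-t_n)\,\frac1{\Delta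 t}\int_{t_n}^{t_{n+1}}v(s,\Phi_E^v(t_n,x))\,ds,\qquad t\in[t_n,t_{n+1}].$$ (1) Let $\delta=\sqrt{\Delta t}$ and let $\Phi_\delta$ be the classical flow of $u_\delta$, i.e. for every $x$, $t\mapsto\Phi_\delta(t,x)$ is absolutely continuous on $[0,T]$, $\Phi_\delta(0,x)=x$ and $\partial_t\Phi_\delta(t,x)=u_\delta(t,\Phi_\delta(t,x))$ for a.e. $t$. There is a bounded function $t\mapsto C_t$ on $[0,T]$, independent of $\Delta t$, with $C_t\to0$ as $t\to0^+$, such that for every $\Delta t=T/M\neq1$ $$\|\Phi_\delta(t,\cdot)-\Phi_E^{u_\delta}(t,\cdot)\|_{L^p(\mathbb T^d)}\le C_t\,|\log\Delta t|^{-1}\qquad\text{for every }t\in[0,T].$$ (2) Suppose $p>d$, and choose the representative of $u$ for which $u(t,\cdot)$ is continuous for a.e. $t$. Let $\Phi$ be the regular Lagrangian flow of $u$: for a.e. $x$, $t\mapsto\Phi(t,x)$ is absolutely continuous on $[0,T]$, $\Phi(0,x)=x$ and $\partial_t\Phi(t,x)=u(t,\Phi(t,x))$ for a.e. $t$; and there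 is a constant $L$ with $\Phi(t,\cdot)_\#\mathscr L^d\le L\,\mathscr L^d$ for all $t\in[0,T]$. There is a bounded function $t\mapsto C_t$ on $[0,T]$, independent of $\Delta t$, with $C_t\to0$ as $t\to0^+$, such that for every $\Delta t=T/M\neq1$ $$\|\Phi(t,\cdot)-\Phi_E^{u}(t,\cdot)\|_{L^p(\mathbb T^d)}\le C_t\,|\log\Delta t|^{-1}\qquad\text{for every }t\in[0,T].$$ -/

import Mathlib

open MeasureTheory Filter Topology Set
open scoped ENNReal NNReal ContDiff Convolution

namespace EulerFlow

noncomputable section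

/-- Functions on the torus `𝕋ᵈ = ℝᵈ / ℤᵈ` are functions on `ℝᵈ` that are `ℤᵈ`-periodic. -/
def IsPeriodic {d : ℕ} {F : Type*} (f : EuclideanSpace ℝ (Fin d) → F) : Prop :=
  ∀ (k : Fin d → ℤ) (x : EuclideanSpace ℝ (Fin d)),
    f (x + WithLp.toLp 2 (fun i => (k i : ℝ))) = f x

/-- The fundamental cell `[0,1)ᵈ` of the torus. -/
def unitCell (d : ℕ) : Set (EuclideanSpace ℝ (Fin d)) :=
  {x | ∀ i, x i ∈ Ico (0 : ℝ) 1}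

/-- The Lebesgue measure of the torus, carried by the fundamental cell. -/
def torusMeasure (d : ℕ) : Measure (EuclideanSpace ℝ (Fin d)) :=
  volume.restrict (unitCell d)

/-- The Lebesgue measure of `(0,T) × 𝕋ᵈ`. -/
def spaceTimeMeasure (d : ℕ) (T : ℝ) : Measure (ℝ × EuclideanSpace ℝ (Fin d)) :=
  (volume.restrict (Ioo 0 T)).prod (torusMeasure d)

/-- `g` is the weak (distributional) derivative of the vector field `f`, by testing against
smooth compactly supported functions. -/
def HasWeakGradient {d : ℕ} (f : EuclideanSpace ℝ (Fin d) → EuclideanSpace ℝ (Fin d))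
    (g : EuclideanSpace ℝ (Fin d) → EuclideanSpace ℝ (Fin d) →L[ℝ] EuclideanSpace ℝ (Fin d)) :
    Prop :=
  LocallyIntegrable f ∧ LocallyIntegrable g ∧
    ∀ φ : EuclideanSpace ℝ (Fin d) → ℝ, ContDiff ℝ ∞ φ → HasCompactSupport φ →
      ∀ v : EuclideanSpace ℝ (Fin d), ∫ x, (fderiv ℝ φ x v) • f x = - ∫ x, φ x • g x v

/-- `u ∈ L¹(0,T; W^{1,p}(𝕋ᵈ))ᵈ`, with `Du` its weak derivative in space. -/
structure IsL1SobolevField {d : ℕ} (T p : ℝ)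
    (u : ℝ → EuclideanSpace ℝ (Fin d) → EuclideanSpace ℝ (Fin d))
    (Du : ℝ → EuclideanSpace ℝ (Fin d) →
      EuclideanSpace ℝ (Fin d) →L[ℝ] EuclideanSpace ℝ (Fin d)) : Prop where
  periodic : ∀ t, IsPeriodic (u t)
  periodic_grad : ∀ t, IsPeriodic (Du t)
  measurable : AEStronglyMeasurable (fun z : ℝ × EuclideanSpace ℝ (Fin d) => u z.1 z.2)
    (spaceTimeMeasure d T)
  measurable_grad : AEStronglyMeasurable (fun z : ℝ × EuclideanSpace ℝ (Fin d) => Du z.1 z.2)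
    (spaceTimeMeasure d T)
  weakGradient : ∀ᵐ t ∂(volume.restrict (Ioo 0 T)), HasWeakGradient (u t) (Du t)
  norm_lt_top : ∫⁻ t in Ioo 0 T, (eLpNorm (u t) (ENNReal.ofReal p) (torusMeasure d)
    + eLpNorm (Du t) (ENNReal.ofReal p) (torusMeasure d)) < ⊤

/-- The negative part `div(u)⁻ = max(-div u, 0)`, with `div u` the trace of the weak derivative. -/
def divNeg {d : ℕ}
    (Du : ℝ → EuclideanSpace ℝ (Fin d) →
      EuclideanSpace ℝ (Fin d) →L[ℝ] EuclideanSpace ℝ (Fin d))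
    (t : ℝ) (x : EuclideanSpace ℝ (Fin d)) : ℝ :=
  max (-(∑ i, (Du t x (EuclideanSpace.single i 1)) i)) 0

/-- A standard mollifier: smooth, nonnegative, supported in the closed unit ball, of integral 1. -/
structure IsMollifier {d : ℕ} (η : EuclideanSpace ℝ (Fin d) → ℝ) : Prop where
  smooth : ContDiff ℝ ∞ η
  nonneg : ∀ x, 0 ≤ η x
  support : Function.support η ⊆ Metric.closedBall 0 1
  integral : ∫ x, η x = 1

/-- The rescaled mollifier `η_δ(x) = δ^{-d} η(x/δ)`. -/
def rescale {d : ℕ} (η : EuclideanSpace ℝ (Fin d) → ℝ) (δ : ℝ)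
    (x : EuclideanSpace ℝ (Fin d)) : ℝ :=
  (δ ^ d)⁻¹ * η (δ⁻¹ • x)

/-- The regularised field `u_δ(t,·) = η_δ ∗ u(t,·)` (convolution in space only). -/
def mollify {d : ℕ} (η : EuclideanSpace ℝ (Fin d) → ℝ) (δ : ℝ)
    (u : ℝ → EuclideanSpace ℝ (Fin d) → EuclideanSpace ℝ (Fin d))
    (t : ℝ) : EuclideanSpace ℝ (Fin d) → EuclideanSpace ℝ (Fin d) :=
  rescale η δ ⋆[ContinuousLinearMap.lsmul ℝ ℝ, volume] u t

/-- `γ` is an absolutely continuous solution on `[0,T]` of `γ' = v(t, γ)`, `γ(0) = x`. -/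
def IsACSolution {d : ℕ} (T : ℝ)
    (v : ℝ → EuclideanSpace ℝ (Fin d) → EuclideanSpace ℝ (Fin d))
    (x : EuclideanSpace ℝ (Fin d)) (γ : ℝ → EuclideanSpace ℝ (Fin d)) : Prop :=
  AbsolutelyContinuousOnInterval γ 0 T ∧ γ 0 = x ∧
    ∀ᵐ t ∂(volume.restrict (Ioo 0 T)), HasDerivAt γ (v t (γ t)) t

/-- The classical flow of `v`: every trajectory solves the ODE. -/
def IsClassicalFlow {d : ℕ} (T : ℝ)
    (v Φ : ℝ → EuclideanSpace ℝ (Fin d) → EuclideanSpace ℝ (Fin d)) : Prop :=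
  ∀ x, IsACSolution T v x (fun t => Φ t x)

/-- A regular Lagrangian flow of the periodic field `v`, as a map of the torus lifted to `ℝᵈ`
(so it commutes with integer translations). For such a lift, the compressibility bound on `ℝᵈ`
and the one on the torus are the same condition. -/
structure IsRegularLagrangianFlow {d : ℕ} (T : ℝ)
    (v Φ : ℝ → EuclideanSpace ℝ (Fin d) → EuclideanSpace ℝ (Fin d)) : Prop where
  equivariant : ∀ t ∈ Icc 0 T, ∀ k : Fin d → ℤ, ∀ᵐ x : EuclideanSpace ℝ (Fin d),
    Φ t (x + WithLp.toLp 2 (fun i => (k i : ℝ))) = Φ t x + WithLp.toLp 2 (fun i => (k i : ℝ))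
  measurable : ∀ t ∈ Icc 0 T, AEMeasurable (Φ t)
  solution : ∀ᵐ x : EuclideanSpace ℝ (Fin d), IsACSolution T v x (fun t => Φ t x)
  compressibility : ∃ L : ℝ≥0, ∀ t ∈ Icc 0 T,
    Measure.map (Φ t) volume ≤ L • (volume : Measure (EuclideanSpace ℝ (Fin d)))

/-- The Euler approximation `x_n` at time `t_n = n h`, driven by the time averages of `v`. -/
def eulerNode {d : ℕ} (v : ℝ → EuclideanSpace ℝ (Fin d) → EuclideanSpace ℝ (Fin d)) (h : ℝ) :
    ℕ → EuclideanSpace ℝ (Fin d) → EuclideanSpace ℝ (Fin d)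
  | 0, x => x
  | n + 1, x => eulerNode v h n x +
      h • ⨍ s in (n * h)..((n + 1) * h), v s (eulerNode v h n x)

/-- The piecewise affine Euler approximation `Φ_E` with time step `h`:
for `t ∈ [t_n, t_{n+1})`, `Φ_E(t,x) = Φ_E(t_n,x) + (t - t_n) ⨍_{t_n}^{t_{n+1}} v(s, Φ_E(t_n,x)) ds`. -/
def eulerFlow {d : ℕ} (v : ℝ → EuclideanSpace ℝ (Fin d) → EuclideanSpace ℝ (Fin d)) (h : ℝ)
    (t : ℝ) (x : EuclideanSpace ℝ (Fin d)) : EuclideanSpace ℝ (Fin d) :=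
  eulerNode v h ⌊t / h⌋₊ x + (t - ⌊t / h⌋₊ * h) •
    ⨍ s in (⌊t / h⌋₊ * h)..((⌊t / h⌋₊ + 1) * h), v s (eulerNode v h ⌊t / h⌋₊ x)

/-- `C_t → 0` as `t → 0⁺`, and `C_t` is bounded on `[0,T]`. -/
def IsVanishingConstant (T : ℝ) (C : ℝ → ℝ) : Prop :=
  BddAbove (C '' Icc 0 T) ∧ Tendsto C (𝓝[>] 0) (𝓝 0)

end

end EulerFlow

set_option linter.unusedSectionVars false

/-! The argument is a discrete form of the logarithmic estimate of Crippa and De Lellis. Write h for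
the time step, K ≥ 1 for a bound on the field, γ for an exact trajectory, x_n for the Euler nodes
and r_n = |γ(nh) - x_n|. Throughout the n-th step |γ(s) - x_n| ≤ r_n + Kh. If the field satisfies
|v(s,a) - v(s,b)| ≤ |a - b| (G(s,a) + H(s,b)), then r_{n+1} ≤ r_n + (r_n + Kh) J_n, where J_n
integrates G along γ plus H at the node over the step. Hence log(1 + r_n/(Kh)) grows by at most
log(1 + J_n) ≤ J_n per step (`IsACSolution.ofReal_log_le`).

The error ρ at time t is at most 2Kt, and exceeds the error at the preceding node by at most 2Kh. If
ρ ≤ √h, then ρ|log h| is O(√t) because h^{1/4}|log h| is bounded for h < 1. If ρ > √h, then log(1 +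
r/(Kh)) is at least |log h|/2 up to a constant, so |log h| is controlled by J, the sum of the J_n.
In both cases ρ|log h| ≤ C√t + Ct(1 + J) along each path (`ofReal_mul_abs_log_le`), and the factors
√t and t make C_t vanish at 0. What remains is a bound on J in L^p, uniform in h.

G and H are local maximal functions of |Du|. Composition with a map of bounded compression costs a
constant, the maximal theorem bounds each time slice by the L^p norm of Du, and a Minkowski-type
inequality integrates in time (`exists_lintegral_maximalRpow_comp_le`); this is where u ∈
L¹(W^{1,p}) is used.

In part (1) the Lipschitz-type bound is two-sided (`exists_enorm_mollify_sub_le`), so both the flow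
and the Euler nodes must have bounded compression. One Euler step is id + B with |DB| ≤ ch/δ = c√h,
so its Jacobian is at least 1 - ∫m - c'h, with m(s) a bound for div(u)⁻ at time s and the integral
over the step. With δ = √h the second order terms sum to O(T)
(`FieldBounds.exists_map_eulerNode_le`). The flow of u_δ inherits the same constant as a limit of
Euler nodes with δ fixed and the step tending to 0.

In part (2) take max(1,d) < q < p. A Morrey estimate bounds the difference quotient by the order q
maximal function at one of the two points only (`exists_enorm_sub_le_of_finrank_lt`). That point is
put on the trajectory of Φ, whose compressibility is assumed, so nothing has to be known about the
compression of the Euler map of the unmollified field. -/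

namespace EulerFlow

/-! ### The local maximal function: weak and strong type bounds. -/

section Maximal

open Metric

variable {E : Type*} [NormedAddCommGroup E] [NormedSpace ℝ E] [FiniteDimensional ℝ E]
  [MeasurableSpace E] [BorelSpace E] (μ : Measure E) [μ.IsAddHaarMeasure]

/-- The local maximal function over the balls of radii `R / 2 ^ k`. -/
noncomputable def ballMaximal (R : ℝ) (h : E → ℝ≥0∞) (x : E) : ℝ≥0∞ :=
  ⨆ k : ℕ, (∫⁻ z in ball x (R / 2 ^ k), h z ∂μ) / μ (ball 0 (R / 2 ^ k))

theorem measurable_ballMaximal {α : Type*} [MeasurableSpace α] (R : ℝ) {h : α → E → ℝ≥0∞}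
    (hh : Measurable (Function.uncurry h)) :
    Measurable (fun z : α × E => ballMaximal μ R (h z.1) z.2) := by
  refine Measurable.iSup fun k => Measurable.div_const ?_ _
  have hm : Measurable ({w : (α × E) × E | dist w.2 w.1.2 < R / 2 ^ k}.indicator
      (fun w => Function.uncurry h (w.1.1, w.2))) := by
    refine Measurable.indicator (hh.comp ?_) (measurableSet_lt ?_ measurable_const)
    · exact (measurable_fst.comp measurable_fst).prodMk measurable_snd
    · exact measurable_snd.dist (measurable_snd.comp measurable_fst)
  convert! hm.lintegral_prod_right' (ν := μ) using 2 with z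
  rw [← lintegral_indicator measurableSet_ball]
  rfl

theorem measurable_ballMaximal_right (R : ℝ) {h : E → ℝ≥0∞} (hh : Measurable h) :
    Measurable (ballMaximal μ R h) := by
  have h1 : Measurable (Function.uncurry fun _ : Unit => h) := hh.comp measurable_snd
  have h2 := measurable_ballMaximal μ R h1
  exact Measurable.of_uncurry_left (f := fun (_ : Unit) x => ballMaximal μ R h x) h2 (x := ())

/-- Some radius R / 2 ^ k lies between ρ and 2ρ, so restricting the supremum to countably many
radii, which keeps it measurable, costs only 2 ^ dim. -/
theorem setLIntegral_ball_le_ballMaximal {R ρ : ℝ} (hρ : 0 < ρ) (hρR : ρ ≤ R) (h : E → ℝ≥0∞)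
    (x : E) :
    ∫⁻ z in ball x ρ, h z ∂μ ≤
      2 ^ Module.finrank ℝ E * ballMaximal μ R h x * μ (ball 0 ρ) := by
  obtain ⟨k, hk1, hk2⟩ : ∃ k : ℕ, ρ ≤ R / 2 ^ k ∧ R / 2 ^ k ≤ 2 * ρ := by
    obtain ⟨n, hn1, hn2⟩ := exists_nat_pow_near (x := R / ρ) (y := (2 : ℝ))
      (by rw [le_div_iff₀ hρ]; linarith) (by norm_num)
    refine ⟨n, ?_, ?_⟩
    · rw [le_div_iff₀ hρ] at hn1
      rw [le_div_iff₀ (by positivity)]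
      linarith
    · rw [div_lt_iff₀ hρ] at hn2
      rw [div_le_iff₀ (by positivity)]
      rw [pow_succ] at hn2
      nlinarith
  have hpos : 0 < R / 2 ^ k := hρ.trans_le hk1
  have h0 : μ (ball 0 (R / 2 ^ k)) ≠ 0 := (measure_ball_pos μ _ hpos).ne'
  have ht : μ (ball (0 : E) (R / 2 ^ k)) ≠ ⊤ := measure_ball_lt_top.ne
  calc ∫⁻ z in ball x ρ, h z ∂μ ≤ ∫⁻ z in ball x (R / 2 ^ k), h z ∂μ :=
        lintegral_mono_set (ball_subset_ball hk1)
    _ = (∫⁻ z in ball x (R / 2 ^ k), h z ∂μ) / μ (ball 0 (R / 2 ^ k)) *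
          μ (ball 0 (R / 2 ^ k)) := (ENNReal.div_mul_cancel h0 ht).symm
    _ ≤ ballMaximal μ R h x * μ (ball 0 (2 * ρ)) := by
        gcongr
        exact le_iSup (fun k : ℕ => (∫⁻ z in ball x (R / 2 ^ k), h z ∂μ) /
          μ (ball 0 (R / 2 ^ k))) k
    _ = _ := by
        rw [Measure.addHaar_ball_mul_of_pos μ 0 (by norm_num : (0 : ℝ) < 2),
          ENNReal.ofReal_pow (by norm_num)]
        simp
        ring

/-- Vitali covering: among the balls on which the average of `h` exceeds `l`, a disjoint subfamily
has 4-fold enlargements covering the superlevel set (any factor above 3 would do). Nothing is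
assumed measurable, since `h` is only integrated over a countable disjoint union of balls. -/
theorem ballMaximal_weak_type (R : ℝ) {h : E → ℝ≥0∞} {l : ℝ≥0∞} :
    l * μ {x | l < ballMaximal μ R h x} ≤ 4 ^ Module.finrank ℝ E * ∫⁻ x, h x ∂μ := by
  classical
  rcases le_or_gt R 0 with hR | hR
  · have : {x | l < ballMaximal μ R h x} = ∅ := by
      ext x
      simp only [mem_ofPred_eq, mem_empty_iff_false, iff_false, not_lt]
      refine iSup_le fun k => ?_
      rw [ball_eq_empty.2 (div_nonpos_of_nonpos_of_nonneg hR (by positivity))]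
      simp
    rw [this]
    simp
  set t : Set (E × ℕ) := {a | l * μ (ball 0 (R / 2 ^ a.2)) <
    ∫⁻ z in ball a.1 (R / 2 ^ a.2), h z ∂μ} with ht
  obtain ⟨u, hut, hdisj, hcov⟩ := Vitali.exists_disjoint_subfamily_covering_enlargement_ball
    t (fun a => a.1) (fun a => R / 2 ^ a.2) R
    (fun a _ => div_le_self hR.le (one_le_pow₀ (by norm_num))) 4 (by norm_num)
  have hpos : ∀ k : ℕ, 0 < R / 2 ^ k := fun k => by positivity
  have hcount : u.Countable :=
    hdisj.countable_of_isOpen (fun a _ => isOpen_ball) (fun a _ => nonempty_ball.2 (hpos _))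
  have hsub : {x | l < ballMaximal μ R h x} ⊆ ⋃ a ∈ u, ball a.1 (4 * (R / 2 ^ a.2)) := by
    intro x hx
    rw [mem_ofPred_eq, ballMaximal, lt_iSup_iff] at hx
    obtain ⟨k, hk⟩ := hx
    have hxt : (x, k) ∈ t := by
      rw [ENNReal.lt_div_iff_mul_lt (Or.inl (measure_ball_pos μ _ (hpos k)).ne')
        (Or.inl measure_ball_lt_top.ne)] at hk
      exact hk
    obtain ⟨b, hb, hbs⟩ := hcov _ hxt
    exact mem_biUnion hb (hbs (mem_ball_self (hpos k)))
  calc l * μ {x | l < ballMaximal μ R h x}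
      ≤ l * ∑' a : u, μ (ball a.1.1 (4 * (R / 2 ^ a.1.2))) := by
        gcongr
        exact (measure_mono hsub).trans (measure_biUnion_le μ hcount _)
    _ = 4 ^ Module.finrank ℝ E * ∑' a : u, l * μ (ball 0 (R / 2 ^ a.1.2)) := by
        rw [← ENNReal.tsum_mul_left, ← ENNReal.tsum_mul_left]
        congr 1
        ext a
        rw [Measure.addHaar_ball_mul_of_pos μ _ (by norm_num : (0 : ℝ) < 4),
          ENNReal.ofReal_pow (by norm_num)]
        simp
        ring
    _ ≤ 4 ^ Module.finrank ℝ E * ∑' a : u, ∫⁻ z in ball a.1.1 (R / 2 ^ a.1.2), h z ∂μ := by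
        gcongr with a
        exact (hut a.2).le
    _ = 4 ^ Module.finrank ℝ E * ∫⁻ z in ⋃ a ∈ u, ball a.1 (R / 2 ^ a.2), h z ∂μ := by
        rw [lintegral_biUnion hcount (fun a _ => measurableSet_ball) hdisj]
    _ ≤ _ := by
        gcongr
        exact Measure.restrict_le_self

theorem ballMaximal_add_const_le (R : ℝ) {h h' : E → ℝ≥0∞} (c : ℝ≥0∞) 
    (hle : ∀ x, h x ≤ h' x + c) (x : E) :
    ballMaximal μ R h x ≤ ballMaximal μ R h' x + c := by
  refine iSup_le fun k => ?_
  have h1 : (∫⁻ z in ball x (R / 2 ^ k), h z ∂μ) ≤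
      (∫⁻ z in ball x (R / 2 ^ k), h' z ∂μ) + c * μ (ball 0 (R / 2 ^ k)) := by
    refine (lintegral_mono hle).trans ?_
    rw [lintegral_add_right _ measurable_const]
    simp [Measure.addHaar_ball_center]
  calc _ ≤ ((∫⁻ z in ball x (R / 2 ^ k), h' z ∂μ) + c * μ (ball 0 (R / 2 ^ k))) /
        μ (ball 0 (R / 2 ^ k)) := by gcongr
    _ = (∫⁻ z in ball x (R / 2 ^ k), h' z ∂μ) / μ (ball 0 (R / 2 ^ k)) +
        c * μ (ball 0 (R / 2 ^ k)) / μ (ball 0 (R / 2 ^ k)) := ENNReal.add_div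
    _ ≤ _ := by
      gcongr
      · exact le_iSup (fun k : ℕ => (∫⁻ z in ball x (R / 2 ^ k), h' z ∂μ) /
          μ (ball 0 (R / 2 ^ k))) k
      · exact ENNReal.div_le_of_le_mul le_rfl

/-- Layer-cake form of the power. The value ⊤ is included because the maximal function may be
infinite. -/
theorem rpow_eq_lintegral_Ioi {P : ℝ} (hP : 0 < P) (a : ℝ≥0∞) :
    a ^ P = ∫⁻ t in Ioi (0 : ℝ), if ENNReal.ofReal t < a then ENNReal.ofReal (P * t ^ (P - 1))
      else 0 := by
  have key : ∀ b : ℝ, 0 ≤ b → ∫⁻ t in Ioo 0 b, ENNReal.ofReal (P * t ^ (P - 1)) =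
      ENNReal.ofReal b ^ P := by
    intro b hb
    have hi : IntervalIntegrable (fun t : ℝ => P * t ^ (P - 1)) volume 0 b :=
      (intervalIntegral.intervalIntegrable_rpow' (by linarith)).const_mul P
    rw [restrict_Ioo_eq_restrict_Ioc, ← ofReal_integral_eq_lintegral_ofReal
      ((intervalIntegrable_iff_integrableOn_Ioc_of_le hb).1 hi),
      ← intervalIntegral.integral_of_le hb, intervalIntegral.integral_const_mul,
      integral_rpow (Or.inl (by linarith)), ENNReal.ofReal_rpow_of_nonneg hb hP.le]
    · congr 1
      rw [sub_add_cancel, Real.zero_rpow hP.ne']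
      field_simp
      ring
    · refine (ae_restrict_mem measurableSet_Ioc).mono fun t ht => ?_
      have := ht.1
      positivity
  have key2 : ∀ b : ℝ, 0 ≤ b → ENNReal.ofReal b ≤ a → ENNReal.ofReal b ^ P ≤
      ∫⁻ t in Ioi (0 : ℝ), if ENNReal.ofReal t < a then ENNReal.ofReal (P * t ^ (P - 1))
        else 0 := by
    intro b hb hba
    rw [← key b hb]
    calc _ = ∫⁻ t in Ioo 0 b, if ENNReal.ofReal t < a then ENNReal.ofReal (P * t ^ (P - 1))
          else 0 := by
          refine setLIntegral_congr_fun measurableSet_Ioo fun t ht => ?_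
          rw [if_pos (((ENNReal.ofReal_lt_ofReal_iff (ht.1.trans ht.2)).2 ht.2).trans_le hba)]
      _ ≤ _ := lintegral_mono_set fun t ht => ht.1
  refine le_antisymm ?_ ?_
  · rcases eq_or_ne a ⊤ with rfl | ha
    · rw [ENNReal.top_rpow_of_pos hP]
      have : Tendsto (fun n : ℕ => ((n : ℝ≥0∞)) ^ P) atTop (𝓝 ⊤) := by
        have := (ENNReal.continuous_rpow_const (y := P)).tendsto ⊤
        rw [ENNReal.top_rpow_of_pos hP] at this
        exact this.comp ENNReal.tendsto_nat_nhds_top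
      refine le_of_tendsto' this fun n => ?_
      have := key2 n (by positivity) le_top
      simpa using this
    · have := key2 a.toReal ENNReal.toReal_nonneg (ENNReal.ofReal_toReal ha).le
      rwa [ENNReal.ofReal_toReal ha] at this
  · rcases eq_or_ne a ⊤ with rfl | ha
    · rw [ENNReal.top_rpow_of_pos hP]
      exact le_top
    · have := key a.toReal ENNReal.toReal_nonneg
      rw [ENNReal.ofReal_toReal ha] at this
      rw [← this, ← lintegral_indicator measurableSet_Ioi, ← lintegral_indicator measurableSet_Ioo]
      refine lintegral_mono fun t => ?_
      by_cases ht : t ∈ Ioi (0 : ℝ)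
      · rw [indicator_of_mem ht]
        split_ifs with h
        · have ht' : t ∈ Ioo 0 a.toReal := ⟨ht, (ENNReal.ofReal_lt_iff_lt_toReal (le_of_lt ht) ha).1 h⟩
          rw [indicator_of_mem ht']
        · exact zero_le
      · rw [indicator_of_notMem ht]
        exact zero_le

/-- Marcinkiewicz interpolation between the weak type (1,1) bound and the trivial bound on
constants. The constant is independent of the radius `R`. -/
theorem exists_lintegral_ballMaximal_rpow_le {P : ℝ} (hP : 1 < P) :
    ∃ C : ℝ≥0, ∀ (R : ℝ) (h : E → ℝ≥0∞), Measurable h →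
      ∫⁻ x, ballMaximal μ R h x ^ P ∂μ ≤ C * ∫⁻ x, h x ^ P ∂μ := by
  refine ⟨2 * 4 ^ Module.finrank ℝ E * (Real.toNNReal (P / (P - 1)) * 2 ^ (P - 1)),
    fun R h hh => ?_⟩
  have hP0 : 0 < P := by linarith
  have hP1 : 0 < P - 1 := by linarith
  have hM := measurable_ballMaximal_right μ R hh
  have weak : ∀ t : ℝ, 0 < t → μ {x | ENNReal.ofReal t < ballMaximal μ R h x} ≤
      ENNReal.ofReal (2 / t) * (4 ^ Module.finrank ℝ E *
        ∫⁻ x, if ENNReal.ofReal t < 2 * h x then h x else 0 ∂μ) := by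
    intro t ht
    -- Truncation at half the level: the part of `h` below t/2 contributes at most t/2 to the
    -- maximal function, so the other half of the level must come from `h'`.
    set h' : E → ℝ≥0∞ := fun x => if ENNReal.ofReal t < 2 * h x then h x else 0 with hh'
    have hle : ∀ x, h x ≤ h' x + ENNReal.ofReal (t / 2) := by
      intro x
      simp only [hh']
      split_ifs with hx
      · exact le_self_add
      · rw [zero_add, ENNReal.ofReal_div_of_pos (by norm_num),
          ENNReal.le_div_iff_mul_le (by simp) (by simp), mul_comm]
        simpa using not_lt.1 hx
    have hw := ballMaximal_weak_type μ R (h := h') (l := ENNReal.ofReal (t / 2))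
    have hsub : {x | ENNReal.ofReal t < ballMaximal μ R h x} ⊆
        {x | ENNReal.ofReal (t / 2) < ballMaximal μ R h' x} := by
      intro x hx
      rw [mem_ofPred_eq] at hx ⊢
      have h1 := hx.trans_le (ballMaximal_add_const_le μ R _ hle x)
      rw [show t = t / 2 + t / 2 by ring, ENNReal.ofReal_add (by positivity) (by positivity),
        add_halves] at h1
      exact lt_of_add_lt_add_right h1
    calc _ ≤ μ {x | ENNReal.ofReal (t / 2) < ballMaximal μ R h' x} := measure_mono hsub
      _ = ENNReal.ofReal (2 / t) * (ENNReal.ofReal (t / 2) *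
          μ {x | ENNReal.ofReal (t / 2) < ballMaximal μ R h' x}) := by
          rw [← mul_assoc, ← ENNReal.ofReal_mul (by positivity)]
          rw [show 2 / t * (t / 2) = 1 by field_simp]
          simp
      _ ≤ _ := by gcongr
  calc ∫⁻ x, ballMaximal μ R h x ^ P ∂μ
      = ∫⁻ x, (∫⁻ t in Ioi (0 : ℝ), if ENNReal.ofReal t < ballMaximal μ R h x then
          ENNReal.ofReal (P * t ^ (P - 1)) else 0) ∂μ := by
        refine lintegral_congr fun x => ?_
        exact rpow_eq_lintegral_Ioi hP0 _
    _ = ∫⁻ t in Ioi (0 : ℝ), (∫⁻ x, if ENNReal.ofReal t < ballMaximal μ R h x then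
          ENNReal.ofReal (P * t ^ (P - 1)) else 0 ∂μ) := by
        refine lintegral_lintegral_swap (Measurable.aemeasurable ?_)
        refine Measurable.ite (measurableSet_lt ?_ (hM.comp measurable_fst)) ?_ measurable_const
        · fun_prop
        · fun_prop
    _ ≤ ∫⁻ t in Ioi (0 : ℝ), ∫⁻ x, (2 * 4 ^ Module.finrank ℝ E) *
          (if ENNReal.ofReal t < 2 * h x then
            ENNReal.ofReal (P * t ^ (P - 1 - 1)) * h x else 0) ∂μ := by
        refine setLIntegral_mono' measurableSet_Ioi fun t ht => ?_
        have ht0 : 0 < t := ht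
        calc _ = ENNReal.ofReal (P * t ^ (P - 1)) *
              μ {x | ENNReal.ofReal t < ballMaximal μ R h x} := by
              rw [← lintegral_indicator_const (measurableSet_lt measurable_const hM)]
              refine lintegral_congr fun x => ?_
              simp [indicator]
          _ ≤ ENNReal.ofReal (P * t ^ (P - 1)) * (ENNReal.ofReal (2 / t) *
              (4 ^ Module.finrank ℝ E *
                ∫⁻ x, if ENNReal.ofReal t < 2 * h x then h x else 0 ∂μ)) := by
              gcongr
              exact weak t ht0
          _ = (2 * 4 ^ Module.finrank ℝ E) * ENNReal.ofReal (P * t ^ (P - 1 - 1)) *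
                ∫⁻ x, (if ENNReal.ofReal t < 2 * h x then h x else 0) ∂μ := by
              rw [Real.rpow_sub_one ht0.ne' (P - 1), div_eq_mul_inv 2 t,
                ENNReal.ofReal_mul (p := 2) (by norm_num), div_eq_mul_inv, ← mul_assoc P,
                ENNReal.ofReal_mul (p := P * t ^ (P - 1)) (by positivity)]
              simp only [ENNReal.ofReal_ofNat]
              ring
          _ = _ := by
              rw [← lintegral_const_mul]
              · refine lintegral_congr fun x => ?_
                split_ifs <;> simp [mul_assoc]
              · exact Measurable.ite (measurableSet_lt measurable_const (hh.const_mul 2)) hh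
                  measurable_const
    _ = ∫⁻ x, (2 * 4 ^ Module.finrank ℝ E * ∫⁻ t in Ioi (0 : ℝ),
          if ENNReal.ofReal t < 2 * h x then
            ENNReal.ofReal (P * t ^ (P - 1 - 1)) * h x else 0) ∂μ := by
        symm
        rw [← lintegral_lintegral_swap]
        · refine lintegral_congr fun x => ?_
          rw [lintegral_const_mul' _ _ (by finiteness)]
        · refine Measurable.aemeasurable (Measurable.const_mul ?_ _)
          refine Measurable.ite (measurableSet_lt ?_ ((hh.comp measurable_fst).const_mul 2)) ?_
            measurable_const
          · fun_prop
          · exact Measurable.mul (by fun_prop) (hh.comp measurable_fst)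
    _ = ∫⁻ x, (2 * 4 ^ Module.finrank ℝ E *
          (ENNReal.ofReal (P / (P - 1)) * 2 ^ (P - 1))) * h x ^ P ∂μ := by
        refine lintegral_congr fun x => ?_
        have h1 : ∀ t : ℝ, (if ENNReal.ofReal t < 2 * h x then
            ENNReal.ofReal (P * t ^ (P - 1 - 1)) * h x else 0) =
            (if ENNReal.ofReal t < 2 * h x then ENNReal.ofReal ((P - 1) * t ^ (P - 1 - 1)) else 0)
             * (ENNReal.ofReal (P / (P - 1)) * h x) := by
          intro t
          split_ifs
          · rw [← mul_assoc, ← ENNReal.ofReal_mul' (by positivity)]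
            congr 2
            field_simp
          · simp
        simp_rw [h1]
        rw [lintegral_mul_const _ (by
          refine Measurable.ite (measurableSet_lt ?_ measurable_const) ?_ measurable_const
          · fun_prop
          · fun_prop), ← rpow_eq_lintegral_Ioi hP1, ENNReal.mul_rpow_of_nonneg _ _ hP1.le]
        conv_rhs => rw [show P = (P - 1) + 1 by ring,
          ENNReal.rpow_add_of_nonneg (P - 1) 1 hP1.le zero_le_one, ENNReal.rpow_one]
        rw [sub_add_cancel]
        ring
    _ = _ := by
        rw [lintegral_const_mul _ (hh.pow_const P)]
        congr 1
        push_cast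
        rw [ENNReal.coe_rpow_of_nonneg _ hP1.le]
        rfl

end Maximal

end EulerFlow

namespace EulerFlow

/-! ### Differences of a C¹ function controlled by averages of its derivative. -/

section Averages

open Metric

variable {E : Type*} [NormedAddCommGroup E] [NormedSpace ℝ E] [FiniteDimensional ℝ E]
  [MeasurableSpace E] [BorelSpace E] (μ : Measure E) [μ.IsAddHaarMeasure]

theorem lintegral_comp_add_smul {g : E → ℝ≥0∞} (hg : Measurable g) (x : E) {θ : ℝ} (hθ : 0 < θ) :
    ENNReal.ofReal (θ ^ Module.finrank ℝ E) * ∫⁻ w, g (x + θ • w) ∂μ = ∫⁻ z, g z ∂μ := by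
  have h1 : ∫⁻ w, g (x + θ • w) ∂μ = ∫⁻ w, g (x + w) ∂(μ.map (θ • ·)) := by
    rw [lintegral_map (by fun_prop) (by fun_prop)]
  rw [h1, Measure.map_addHaar_smul μ hθ.ne', lintegral_smul_measure, lintegral_add_left_eq_self,
    smul_eq_mul, ← mul_assoc, ← ENNReal.ofReal_mul (by positivity), abs_of_pos (by positivity),
    mul_inv_cancel₀ (by positivity)]
  simp

theorem setLIntegral_ball_comp_add_smul {g : E → ℝ≥0∞} (hg : Measurable g) (x : E) {θ r : ℝ}
    (hθ : 0 < θ) :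
    ENNReal.ofReal (θ ^ Module.finrank ℝ E) * ∫⁻ w in ball x r, g (x + θ • (w - x)) ∂μ =
      ∫⁻ z in ball x (θ * r), g z ∂μ := by
  rw [← lintegral_indicator measurableSet_ball, ← lintegral_indicator measurableSet_ball,
    ← lintegral_comp_add_smul μ (hg.indicator measurableSet_ball) x hθ,
    ← lintegral_add_right_eq_self (μ := μ) _ x]
  congr 1
  refine lintegral_congr fun w => ?_
  have : w + x ∈ ball x r ↔ x + θ • w ∈ ball x (θ * r) := by
    simp [dist_eq_norm, norm_smul, abs_of_pos hθ, mul_lt_mul_iff_right₀ hθ]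
  by_cases hw : w + x ∈ ball x r
  · rw [indicator_of_mem hw, indicator_of_mem (this.1 hw), add_sub_cancel_right]
  · rw [indicator_of_notMem hw, indicator_of_notMem (fun h => hw (this.2 h))]

variable {F : Type*} [NormedAddCommGroup F] [NormedSpace ℝ F] [CompleteSpace F]

theorem enorm_sub_le_lintegral_fderiv {f : E → F} (hf : ContDiff ℝ 1 f) (x w : E) :
    ‖f w - f x‖ₑ ≤ ‖w - x‖ₑ * ∫⁻ θ in Ioo (0 : ℝ) 1, ‖fderiv ℝ f (x + θ • (w - x))‖ₑ := by
  have hderiv : ∀ θ ∈ uIcc (0 : ℝ) 1, HasDerivAt (fun θ : ℝ => f (x + θ • (w - x)))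
      (fderiv ℝ f (x + θ • (w - x)) (w - x)) θ := by
    intro θ _
    have h1 : HasDerivAt (fun θ : ℝ => x + θ • (w - x)) (w - x) θ := by
      simpa using ((hasDerivAt_id θ).smul_const (w - x)).const_add x
    exact ((hf.differentiable one_ne_zero _).hasFDerivAt).comp_hasDerivAt θ h1
  have hcont : Continuous fun θ : ℝ => fderiv ℝ f (x + θ • (w - x)) (w - x) := by
    have := hf.continuous_fderiv one_ne_zero
    fun_prop
  have h := intervalIntegral.integral_eq_sub_of_hasDerivAt hderiv (hcont.intervalIntegrable 0 1)
  simp only [one_smul, add_sub_cancel, zero_smul, add_zero] at h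
  rw [← h, intervalIntegral.integral_of_le zero_le_one, ← restrict_Ioo_eq_restrict_Ioc,
    ← lintegral_const_mul' _ _ (by finiteness)]
  refine (enorm_integral_le_lintegral_enorm _).trans (lintegral_mono fun θ => ?_)
  rw [mul_comm]
  exact ContinuousLinearMap.le_opENorm _ _

/-- Integrate along the segments from x and substitute z = x + θ(w - x): the factor θ ^ dim from the
substitution cancels against the volume of the ball of radius θr. Keeping `A` dependent on θ serves
both the maximal function bound (constant `A`) and the Morrey bound. -/
theorem setLIntegral_ball_enorm_sub_le {f : E → F} (hf : ContDiff ℝ 1 f) (x : E) {r : ℝ} {A : ℝ → ℝ≥0∞}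
    (hA : ∀ θ ∈ Ioo (0 : ℝ) 1, ∫⁻ z in ball x (θ * r), ‖fderiv ℝ f z‖ₑ ∂μ ≤
      A θ * μ (ball 0 (θ * r))) :
    ∫⁻ w in ball x r, ‖f w - f x‖ₑ ∂μ ≤
      ENNReal.ofReal r * μ (ball 0 r) * ∫⁻ θ in Ioo (0 : ℝ) 1, A θ := by
  have hc : Continuous (fderiv ℝ f) := hf.continuous_fderiv one_ne_zero
  calc ∫⁻ w in ball x r, ‖f w - f x‖ₑ ∂μ
      ≤ ∫⁻ w in ball x r, ENNReal.ofReal r *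
          (∫⁻ θ in Ioo (0 : ℝ) 1, ‖fderiv ℝ f (x + θ • (w - x))‖ₑ) ∂μ := by
        refine setLIntegral_mono' measurableSet_ball fun w hw => ?_
        refine (enorm_sub_le_lintegral_fderiv hf x w).trans ?_
        gcongr
        rw [← ofReal_norm]
        exact ENNReal.ofReal_le_ofReal (mem_ball_iff_norm.1 hw).le
    _ = ENNReal.ofReal r * ∫⁻ θ in Ioo (0 : ℝ) 1,
          (∫⁻ w in ball x r, ‖fderiv ℝ f (x + θ • (w - x))‖ₑ ∂μ) := by
        rw [lintegral_const_mul' _ _ (by finiteness), lintegral_lintegral_swap]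
        refine Continuous.aemeasurable ?_
        fun_prop
    _ ≤ ENNReal.ofReal r * ∫⁻ θ in Ioo (0 : ℝ) 1, μ (ball 0 r) * A θ := by
        gcongr ENNReal.ofReal r * ?_
        refine setLIntegral_mono' measurableSet_Ioo fun θ hθ => ?_
        have h1 := setLIntegral_ball_comp_add_smul μ (g := fun z => ‖fderiv ℝ f z‖ₑ)
          hc.enorm.measurable x (r := r) hθ.1
        have h2 := hA θ hθ
        rw [← h1, Measure.addHaar_ball_mul_of_pos μ _ hθ.1, mul_left_comm] at h2
        rw [ENNReal.mul_le_mul_iff_right (by simpa using pow_pos hθ.1 _)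
          ENNReal.ofReal_ne_top] at h2
        rwa [mul_comm (μ _)]
    _ = _ := by
        rw [lintegral_const_mul' _ _ measure_ball_lt_top.ne, mul_assoc]

/-- The ball of radius r/2 about the midpoint lies in both balls; averaging the triangle inequality
over it produces the factor 2 ^ dim. -/
theorem enorm_sub_le_of_lintegral_ball_le {f : E → F} (hf : Continuous f)
    {x y : E} {r : ℝ} (hr : 0 < r) (hxy : dist x y ≤ r) {a b : ℝ≥0∞}
    (ha : ∫⁻ w in ball x r, ‖f w - f x‖ₑ ∂μ ≤ a * μ (ball 0 r))
    (hb : ∫⁻ w in ball y r, ‖f w - f y‖ₑ ∂μ ≤ b * μ (ball 0 r)) :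
    ‖f x - f y‖ₑ ≤ 2 ^ Module.finrank ℝ E * (a + b) := by
  set m := midpoint ℝ x y with hm
  have hr2 : 0 < r / 2 := by positivity
  have hx : ball m (r / 2) ⊆ ball x r := by
    refine ball_subset_ball' ?_
    rw [dist_midpoint_left, Real.norm_eq_abs, abs_of_pos (by norm_num)]
    linarith
  have hy : ball m (r / 2) ⊆ ball y r := by
    refine ball_subset_ball' ?_
    rw [dist_midpoint_right, Real.norm_eq_abs, abs_of_pos (by norm_num)]
    linarith
  have h1 : ‖f x - f y‖ₑ * μ (ball m (r / 2)) ≤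
      (2 ^ Module.finrank ℝ E * (a + b)) * μ (ball m (r / 2)) := by
    calc ‖f x - f y‖ₑ * μ (ball m (r / 2)) = ∫⁻ w in ball m (r / 2), ‖f x - f y‖ₑ ∂μ := by simp
      _ ≤ ∫⁻ w in ball m (r / 2), ‖f w - f x‖ₑ + ‖f w - f y‖ₑ ∂μ := by
          refine lintegral_mono fun w => ?_
          rw [← edist_eq_enorm_sub, ← edist_eq_enorm_sub, ← edist_eq_enorm_sub, edist_comm (f w)]
          exact edist_triangle _ _ _
      _ = ∫⁻ w in ball m (r / 2), ‖f w - f x‖ₑ ∂μ + ∫⁻ w in ball m (r / 2), ‖f w - f y‖ₑ ∂μ :=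
          lintegral_add_left (hf.sub continuous_const).enorm.measurable _
      _ ≤ a * μ (ball 0 r) + b * μ (ball 0 r) :=
          add_le_add ((lintegral_mono_set hx).trans ha) ((lintegral_mono_set hy).trans hb)
      _ = _ := by
          rw [show r = 2 * (r / 2) by ring, Measure.addHaar_ball_mul_of_pos μ _ (by norm_num),
            ENNReal.ofReal_pow (by norm_num), ← add_mul, Measure.addHaar_ball_center μ m]
          simp only [ENNReal.ofReal_ofNat]
          rw [show 2 * (r / 2) = r by ring]
          ring
  rwa [ENNReal.mul_le_mul_iff_left (measure_ball_pos μ _ hr2).ne' measure_ball_lt_top.ne] at h1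

theorem enorm_sub_le_of_lintegral_ball_fderiv_le {f : E → F} (hf : ContDiff ℝ 1 f)
    {x y : E} {a b : ℝ≥0∞}
    (ha : ∀ ρ ∈ Ioo 0 (dist x y), ∫⁻ z in ball x ρ, ‖fderiv ℝ f z‖ₑ ∂μ ≤ a * μ (ball 0 ρ))
    (hb : ∀ ρ ∈ Ioo 0 (dist x y), ∫⁻ z in ball y ρ, ‖fderiv ℝ f z‖ₑ ∂μ ≤ b * μ (ball 0 ρ)) :
    ‖f x - f y‖ₑ ≤ 2 ^ Module.finrank ℝ E * (a + b) * ‖x - y‖ₑ := by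
  rcases eq_or_ne x y with rfl | hxy
  · simp
  have hr : 0 < dist x y := dist_pos.2 hxy
  have hmem : ∀ θ ∈ Ioo (0 : ℝ) 1, θ * dist x y ∈ Ioo 0 (dist x y) := fun θ hθ =>
    ⟨mul_pos hθ.1 hr, mul_lt_of_lt_one_left hr hθ.2⟩
  have h := enorm_sub_le_of_lintegral_ball_le μ hf.continuous hr le_rfl
    (a := ENNReal.ofReal (dist x y) * a) (b := ENNReal.ofReal (dist x y) * b)
    ((setLIntegral_ball_enorm_sub_le μ hf x (A := fun _ => a)
      (fun θ hθ => ha _ (hmem θ hθ))).trans_eq ?_)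
    ((setLIntegral_ball_enorm_sub_le μ hf y (A := fun _ => b)
      (fun θ hθ => hb _ (hmem θ hθ))).trans_eq ?_)
  · rw [← edist_eq_enorm_sub x y, edist_dist]
    convert h using 1
    ring
  · simp
    ring
  · simp
    ring

-- Hölder against the constant 1, that is, Jensen without normalising the measure.
omit [NormedSpace ℝ E] [FiniteDimensional ℝ E] [BorelSpace E] [μ.IsAddHaarMeasure] in
theorem lintegral_rpow_le_of_one_lt {α : Type*} [MeasurableSpace α] (ν : Measure α)
    {q : ℝ} (hq : 1 < q) {g : α → ℝ≥0∞} (hg : AEMeasurable g ν) :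
    (∫⁻ x, g x ∂ν) ^ q ≤ ν univ ^ (q - 1) * ∫⁻ x, g x ^ q ∂ν := by
  have hq0 : 0 < q := by linarith
  have h := ENNReal.lintegral_mul_le_Lp_mul_Lq ν (Real.HolderConjugate.conjExponent hq) hg
    (aemeasurable_const (b := (1 : ℝ≥0∞)))
  simp only [Pi.mul_apply, mul_one, ENNReal.one_rpow, lintegral_const, one_mul] at h
  calc (∫⁻ x, g x ∂ν) ^ q ≤ ((∫⁻ x, g x ^ q ∂ν) ^ (1 / q) *
        ν univ ^ (1 / Real.conjExponent q)) ^ q := by gcongr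
    _ = _ := by
      rw [ENNReal.mul_rpow_of_nonneg _ _ hq0.le, ← ENNReal.rpow_mul, ← ENNReal.rpow_mul, mul_comm]
      congr 2
      · rw [Real.conjExponent]
        field_simp
      · rw [one_div_mul_cancel hq0.ne', ENNReal.rpow_one]

theorem lintegral_Ioo_rpow_lt_top {s : ℝ} (hs : -1 < s) :
    ∫⁻ θ in Ioo (0 : ℝ) 1, ENNReal.ofReal (θ ^ s) < ⊤ := by
  have h : IntegrableOn (fun θ : ℝ => θ ^ s) (Ioo 0 1) :=
    (intervalIntegral.integrableOn_Ioo_rpow_iff zero_lt_one).2 hs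
  have h2 := h.2
  rw [hasFiniteIntegral_iff_ofReal] at h2
  · exact h2
  · exact (ae_restrict_mem measurableSet_Ioo).mono fun θ hθ => Real.rpow_nonneg hθ.1.le _

/-- Here an L^q average is known on the largest ball only. Hölder on the concentric ball of radius
θr loses θ^(-dim/q), whose integral over (0,1) is finite exactly when q exceeds the dimension, as in
Morrey's inequality. -/
theorem setLIntegral_ball_enorm_sub_le_of_rpow {f : E → F} (hf : ContDiff ℝ 1 f) (x : E) {r : ℝ}
    (hr : 0 < r) {q : ℝ} (hq : 1 < q) {a : ℝ≥0∞}
    (ha : ∫⁻ z in ball x r, ‖fderiv ℝ f z‖ₑ ^ q ∂μ ≤ a ^ q * μ (ball 0 r)) :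
    ∫⁻ w in ball x r, ‖f w - f x‖ₑ ∂μ ≤ ENNReal.ofReal r *
      (a * ∫⁻ θ in Ioo (0 : ℝ) 1, ENNReal.ofReal (θ ^ (-(Module.finrank ℝ E / q)))) *
        μ (ball 0 r) := by
  have hq0 : 0 < q := by linarith
  have hc : Continuous (fderiv ℝ f) := hf.continuous_fderiv one_ne_zero
  refine (setLIntegral_ball_enorm_sub_le μ hf x
    (A := fun θ => ENNReal.ofReal (θ ^ (-(Module.finrank ℝ E / q))) * a) ?_).trans_eq ?_
  · intro θ hθ
    have h1 := lintegral_rpow_le_of_one_lt (μ.restrict (ball x (θ * r))) hq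
      (g := fun z => ‖fderiv ℝ f z‖ₑ) hc.enorm.aemeasurable
    rw [Measure.restrict_apply_univ, Measure.addHaar_ball_center] at h1
    have h2 : ∫⁻ z in ball x (θ * r), ‖fderiv ℝ f z‖ₑ ^ q ∂μ ≤ a ^ q * μ (ball 0 r) :=
      (lintegral_mono_set (ball_subset_ball (mul_le_of_le_one_left hr.le hθ.2.le))).trans ha
    have hV : μ (ball (0 : E) (θ * r)) =
        ENNReal.ofReal (θ ^ Module.finrank ℝ E) * μ (ball 0 r) :=
      Measure.addHaar_ball_mul_of_pos μ _ hθ.1 _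
    have hV0 : μ (ball (0 : E) (θ * r)) ≠ 0 := (measure_ball_pos μ _ (mul_pos hθ.1 hr)).ne'
    have hVt : μ (ball (0 : E) (θ * r)) ≠ ⊤ := measure_ball_lt_top.ne
    rw [← ENNReal.rpow_le_rpow_iff hq0]
    refine (h1.trans (mul_le_mul_right h2 _)).trans_eq ?_
    rw [ENNReal.mul_rpow_of_nonneg _ _ hq0.le, ENNReal.mul_rpow_of_nonneg _ _ hq0.le]
    conv_rhs => rw [show q = (q - 1) + 1 by ring, ENNReal.rpow_add _ _ hV0 hVt, ENNReal.rpow_one]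
    rw [sub_add_cancel]
    have h3 : ENNReal.ofReal (θ ^ (-(Module.finrank ℝ E / q))) ^ q * μ (ball (0 : E) (θ * r)) =
        μ (ball 0 r) := by
      rw [hV, ENNReal.ofReal_rpow_of_nonneg (Real.rpow_nonneg hθ.1.le _) hq0.le,
        ← Real.rpow_mul hθ.1.le, ← mul_assoc, ← ENNReal.ofReal_mul (Real.rpow_nonneg hθ.1.le _),
        ← Real.rpow_natCast, ← Real.rpow_add hθ.1]
      field_simp
      simp
    rw [← h3]
    ring
  · rw [lintegral_mul_const _ (by fun_prop)]
    ring

end Averages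

end EulerFlow

namespace EulerFlow

/-! ### Rescaled mollifiers and convolution with a weakly differentiable field. -/

section Mollifier

open Metric

variable {d : ℕ} {η : EuclideanSpace ℝ (Fin d) → ℝ}

theorem IsMollifier.hasCompactSupport (hη : IsMollifier η) : HasCompactSupport η :=
  HasCompactSupport.intro (isCompact_closedBall 0 1) fun x hx => by
    by_contra h
    exact hx (hη.support h)

theorem support_rescale_subset (hη : IsMollifier η) {δ : ℝ} (hδ : 0 < δ) :
    Function.support (rescale η δ) ⊆ closedBall 0 δ := by
  intro x hx
  have h1 : δ⁻¹ • x ∈ Function.support η := fun h => hx (by simp [rescale, h])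
  have h2 := hη.support h1
  rw [mem_closedBall_zero_iff, norm_smul, norm_inv, Real.norm_of_nonneg hδ.le,
    inv_mul_le_iff₀ hδ, mul_one] at h2
  rwa [mem_closedBall_zero_iff]

theorem hasCompactSupport_rescale (hη : IsMollifier η) {δ : ℝ} (hδ : 0 < δ) :
    HasCompactSupport (rescale η δ) :=
  HasCompactSupport.intro (isCompact_closedBall 0 δ) fun x hx => by
    by_contra h
    exact hx (support_rescale_subset hη hδ h)

theorem contDiff_rescale (hη : IsMollifier η) (δ : ℝ) : ContDiff ℝ ∞ (rescale η δ) :=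
  contDiff_const.mul (hη.smooth.comp (contDiff_const_smul δ⁻¹))

theorem rescale_nonneg (hη : IsMollifier η) {δ : ℝ} (hδ : 0 < δ) (x : EuclideanSpace ℝ (Fin d)) :
    0 ≤ rescale η δ x :=
  mul_nonneg (by positivity) (hη.nonneg _)

theorem integral_rescale (hη : IsMollifier η) {δ : ℝ} (hδ : 0 < δ) :
    ∫ x, rescale η δ x = 1 := by
  unfold rescale
  rw [integral_const_mul, Measure.integral_comp_smul, finrank_euclideanSpace_fin, hη.integral,
    inv_pow, inv_inv, abs_of_pos (by positivity), smul_eq_mul, mul_one,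
    inv_mul_cancel₀ (by positivity)]

theorem lintegral_rescale_sub (hη : IsMollifier η) {δ : ℝ} (hδ : 0 < δ)
    (y : EuclideanSpace ℝ (Fin d)) :
    ∫⁻ x, ENNReal.ofReal (rescale η δ (x - y)) = 1 := by
  rw [lintegral_sub_right_eq_self (fun x => ENNReal.ofReal (rescale η δ x)),
    ← ofReal_integral_eq_lintegral_ofReal, integral_rescale hη hδ, ENNReal.ofReal_one]
  · exact (contDiff_rescale hη δ).continuous.integrable_of_hasCompactSupport
      (hasCompactSupport_rescale hη hδ)
  · exact Eventually.of_forall fun x => rescale_nonneg hη hδ x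

theorem lintegral_rescale_sub_left (hη : IsMollifier η) {δ : ℝ} (hδ : 0 < δ)
    (x : EuclideanSpace ℝ (Fin d)) :
    ∫⁻ y, ENNReal.ofReal (rescale η δ (x - y)) = 1 := by
  rw [lintegral_sub_left_eq_self (fun x => ENNReal.ofReal (rescale η δ x)),
    ← lintegral_rescale_sub hη hδ 0]
  simp

theorem exists_rescale_le (hη : IsMollifier η) :
    ∃ S : ℝ≥0, ∀ δ : ℝ, 0 < δ → ∀ x, rescale η δ x ≤ S * (δ ^ d)⁻¹ := by
  obtain ⟨C, hC⟩ := hη.hasCompactSupport.exists_bound_of_continuous hη.smooth.continuous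
  refine ⟨C.toNNReal, fun δ hδ x => ?_⟩
  rw [rescale, mul_comm]
  gcongr
  exact ((le_abs_self _).trans (hC _)).trans (Real.le_coe_toNNReal C)

variable {f : EuclideanSpace ℝ (Fin d) → EuclideanSpace ℝ (Fin d)}
  {g : EuclideanSpace ℝ (Fin d) → EuclideanSpace ℝ (Fin d) →L[ℝ] EuclideanSpace ℝ (Fin d)}

theorem contDiff_rescale_convolution (hη : IsMollifier η) {δ : ℝ} (hδ : 0 < δ)
    (hf : LocallyIntegrable f) :
    ContDiff ℝ ∞ (rescale η δ ⋆[ContinuousLinearMap.lsmul ℝ ℝ, volume] f) :=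
  (hasCompactSupport_rescale hη hδ).contDiff_convolution_left _ (contDiff_rescale hη δ) hf

theorem rescale_convolution_apply (δ : ℝ) (x : EuclideanSpace ℝ (Fin d)) :
    (rescale η δ ⋆[ContinuousLinearMap.lsmul ℝ ℝ, volume] f) x =
      ∫ y, rescale η δ (x - y) • f y := by
  rw [convolution_eq_swap]
  rfl

theorem integrable_rescale_smul {F : Type*} [NormedAddCommGroup F] [NormedSpace ℝ F]
    {k : EuclideanSpace ℝ (Fin d) → F} (hη : IsMollifier η) {δ : ℝ} (hδ : 0 < δ)
    (hk : LocallyIntegrable k) (x : EuclideanSpace ℝ (Fin d)) :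
    Integrable fun y => rescale η δ (x - y) • k y := by
  have h := (hasCompactSupport_rescale hη hδ).convolutionExists_left
    (ContinuousLinearMap.lsmul ℝ ℝ) (contDiff_rescale hη δ).continuous hk x
  exact h.integrable_swap

/-- Differentiate the kernel and test the weak gradient against y ↦ η_δ(x - y); the sign from
reflecting the argument cancels the sign in the integration by parts. -/
theorem fderiv_rescale_convolution (hη : IsMollifier η) {δ : ℝ} (hδ : 0 < δ)
    (hfg : HasWeakGradient f g) (x : EuclideanSpace ℝ (Fin d)) :
    fderiv ℝ (rescale η δ ⋆[ContinuousLinearMap.lsmul ℝ ℝ, volume] f) x =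
      ∫ y, rescale η δ (x - y) • g y := by
  obtain ⟨hf, hg, hw⟩ := hfg
  have hcs := hasCompactSupport_rescale hη hδ
  have hsm := contDiff_rescale hη δ
  rw [(hcs.hasFDerivAt_convolution_left (ContinuousLinearMap.lsmul ℝ ℝ)
    (hsm.of_le (by simp)) hf x).fderiv]
  ext1 v
  rw [ContinuousLinearMap.integral_apply (integrable_rescale_smul hη hδ hg x)]
  have hφ : ContDiff ℝ ∞ fun y => rescale η δ (x - y) := hsm.comp (contDiff_const.sub contDiff_id)
  have hφc : HasCompactSupport fun y => rescale η δ (x - y) :=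
    hcs.comp_homeomorph (Homeomorph.subLeft x)
  have h1 := hw _ hφ hφc v
  have h2 : ∀ y, fderiv ℝ (fun y => rescale η δ (x - y)) y v =
      - fderiv ℝ (rescale η δ) (x - y) v := by
    intro y
    have h3 := ((hsm.differentiable (by simp) (x - y)).hasFDerivAt).comp y
      ((hasFDerivAt_id y).const_sub x)
    have h4 : fderiv ℝ (fun y => rescale η δ (x - y)) y = _ := h3.fderiv
    rw [h4]
    simp
  simp_rw [h2, neg_smul, integral_neg, neg_inj] at h1
  rw [convolution_eq_swap]
  have hcs' : HasCompactSupport (fderiv ℝ (rescale η δ)) := hcs.fderiv ℝ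
  have hint := (hcs'.convolutionExists_left ((ContinuousLinearMap.lsmul ℝ ℝ).precompL
    (EuclideanSpace ℝ (Fin d))) (hsm.continuous_fderiv (by simp)) hf x).integrable_swap
  rw [ContinuousLinearMap.integral_apply hint]
  simpa using h1

theorem enorm_fderiv_rescale_convolution_le (hη : IsMollifier η) {δ : ℝ} (hδ : 0 < δ)
    (hfg : HasWeakGradient f g) (x : EuclideanSpace ℝ (Fin d)) :
    ‖fderiv ℝ (rescale η δ ⋆[ContinuousLinearMap.lsmul ℝ ℝ, volume] f) x‖ₑ ≤
      ∫⁻ y, ENNReal.ofReal (rescale η δ (x - y)) * ‖g y‖ₑ := by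
  rw [fderiv_rescale_convolution hη hδ hfg]
  refine (enorm_integral_le_lintegral_enorm _).trans_eq (lintegral_congr fun y => ?_)
  rw [enorm_smul, Real.enorm_of_nonneg (rescale_nonneg hη hδ _)]

/-- The kernel sees only points within δ of the ball and has mass one, so Tonelli gives the bound on
the enlarged ball. -/
theorem setLIntegral_ball_rescale_le (hη : IsMollifier η) {δ : ℝ} (hδ : 0 < δ)
    {G : EuclideanSpace ℝ (Fin d) → ℝ≥0∞} (hG : AEMeasurable G)
    (x : EuclideanSpace ℝ (Fin d)) (ρ : ℝ) :
    ∫⁻ z in ball x ρ, ∫⁻ y, ENNReal.ofReal (rescale η δ (z - y)) * G y ≤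
      ∫⁻ y in ball x (ρ + δ), G y := by
  have hcont := (contDiff_rescale hη δ).continuous
  have key : ∀ z ∈ ball x ρ, ∀ y, ENNReal.ofReal (rescale η δ (z - y)) * G y =
      ENNReal.ofReal (rescale η δ (z - y)) * (ball x (ρ + δ)).indicator G y := by
    intro z hz y
    by_cases hy : y ∈ ball x (ρ + δ)
    · rw [indicator_of_mem hy]
    · have : rescale η δ (z - y) = 0 := by
        by_contra h
        have h1 := support_rescale_subset hη hδ h
        rw [mem_closedBall_zero_iff, ← dist_eq_norm] at h1
        refine hy (mem_ball.2 ?_)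
        have := dist_triangle y z x
        rw [dist_comm y z] at this
        have := mem_ball.1 hz
        linarith
      simp [this]
  calc _ = ∫⁻ z in ball x ρ, ∫⁻ y, ENNReal.ofReal (rescale η δ (z - y)) *
        (ball x (ρ + δ)).indicator G y :=
        setLIntegral_congr_fun measurableSet_ball fun z hz => lintegral_congr (key z hz)
    _ ≤ ∫⁻ z, ∫⁻ y, ENNReal.ofReal (rescale η δ (z - y)) * (ball x (ρ + δ)).indicator G y :=
        lintegral_mono' Measure.restrict_le_self le_rfl
    _ = ∫⁻ y, ∫⁻ z, ENNReal.ofReal (rescale η δ (z - y)) * (ball x (ρ + δ)).indicator G y := by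
        rw [lintegral_lintegral_swap]
        refine AEMeasurable.mul (by fun_prop) ?_
        exact (hG.indicator measurableSet_ball).comp_quasiMeasurePreserving
          Measure.quasiMeasurePreserving_snd
    _ = ∫⁻ y, (ball x (ρ + δ)).indicator G y := by
        refine lintegral_congr fun y => ?_
        rw [lintegral_mul_const _ (by fun_prop), lintegral_rescale_sub hη hδ, one_mul]
    _ = _ := lintegral_indicator measurableSet_ball _

end Mollifier

end EulerFlow

namespace EulerFlow

/-! ### Pointwise Lipschitz-type estimates for mollified and for continuous Sobolev fields. -/

section PointwiseEstimates

open Metric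

variable {d : ℕ} {η : EuclideanSpace ℝ (Fin d) → ℝ}

/-- Averages of the derivative of f ∗ η_δ over small balls are controlled by averages of |g| over
balls of comparable radius, or of radius 2δ. The point is that the constant does not depend on δ. -/
theorem exists_enorm_rescale_convolution_sub_le (hη : IsMollifier η) :
    ∃ C : ℝ≥0, ∀ (f : EuclideanSpace ℝ (Fin d) → EuclideanSpace ℝ (Fin d))
      (g : EuclideanSpace ℝ (Fin d) → EuclideanSpace ℝ (Fin d) →L[ℝ] EuclideanSpace ℝ (Fin d)),
      HasWeakGradient f g → ∀ (δ : ℝ), 0 < δ → ∀ (x y : EuclideanSpace ℝ (Fin d)) (a b : ℝ≥0∞),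
      (∀ ρ, 0 < ρ → ρ ≤ dist x y + 2 * δ →
        ∫⁻ z in ball x ρ, ‖g z‖ₑ ≤ a * volume (ball (0 : EuclideanSpace ℝ (Fin d)) ρ)) →
      (∀ ρ, 0 < ρ → ρ ≤ dist x y + 2 * δ →
        ∫⁻ z in ball y ρ, ‖g z‖ₑ ≤ b * volume (ball (0 : EuclideanSpace ℝ (Fin d)) ρ)) →
      ‖(rescale η δ ⋆[ContinuousLinearMap.lsmul ℝ ℝ, volume] f) x -
        (rescale η δ ⋆[ContinuousLinearMap.lsmul ℝ ℝ, volume] f) y‖ₑ ≤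
          C * (a + b) * ‖x - y‖ₑ := by
  obtain ⟨S, hS⟩ := exists_rescale_le hη
  set W : ℝ≥0 := (volume (ball (0 : EuclideanSpace ℝ (Fin d)) 1)).toNNReal with hW
  have hWt : volume (ball (0 : EuclideanSpace ℝ (Fin d)) 1) = W :=
    (ENNReal.coe_toNNReal measure_ball_lt_top.ne).symm
  have hvol : ∀ (r : ℝ), 0 < r → ∀ s, volume (ball (0 : EuclideanSpace ℝ (Fin d)) (r * s)) =
      ENNReal.ofReal (r ^ d) * volume (ball (0 : EuclideanSpace ℝ (Fin d)) s) := by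
    intro r hr s
    rw [Measure.addHaar_ball_mul_of_pos _ _ hr, finrank_euclideanSpace_fin]
  refine ⟨2 ^ d * (2 ^ d * (1 + S * W)), fun f g hfg δ hδ x y a b ha hb => ?_⟩
  set F := rescale η δ ⋆[ContinuousLinearMap.lsmul ℝ ℝ, volume] f with hF
  have hFs : ContDiff ℝ 1 F :=
    (contDiff_rescale_convolution hη hδ hfg.1).of_le (by simp)
  have hgm : AEMeasurable (fun z => ‖g z‖ₑ) := hfg.2.1.aestronglyMeasurable.enorm
  have key : ∀ (x : EuclideanSpace ℝ (Fin d)) (a : ℝ≥0∞) (R : ℝ),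
      (∀ ρ, 0 < ρ → ρ ≤ R + 2 * δ →
        ∫⁻ z in ball x ρ, ‖g z‖ₑ ≤ a * volume (ball (0 : EuclideanSpace ℝ (Fin d)) ρ)) →
      ∀ ρ ∈ Ioo 0 R, ∫⁻ z in ball x ρ, ‖fderiv ℝ F z‖ₑ ≤
        (2 ^ d * (1 + S * W) * a) * volume (ball (0 : EuclideanSpace ℝ (Fin d)) ρ) := by
    intro x a R ha ρ hρ
    -- At scales above δ the enlarged ball has radius at most 2ρ. Below δ the derivative is bounded
    -- pointwise: the kernel is at most S δ^(-d) and the points it sees lie in the ball of radius 2δ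
    -- about x, which is why the hypothesis covers radii up to dist x y + 2δ.
    rcases le_or_gt δ ρ with h | h
    · calc ∫⁻ z in ball x ρ, ‖fderiv ℝ F z‖ₑ
          ≤ ∫⁻ z in ball x ρ, ∫⁻ y, ENNReal.ofReal (rescale η δ (z - y)) * ‖g y‖ₑ :=
            lintegral_mono fun z => enorm_fderiv_rescale_convolution_le hη hδ hfg z
        _ ≤ ∫⁻ y in ball x (ρ + δ), ‖g y‖ₑ := setLIntegral_ball_rescale_le hη hδ hgm x ρ
        _ ≤ a * volume (ball (0 : EuclideanSpace ℝ (Fin d)) (ρ + δ)) :=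
            ha _ (by linarith) (by linarith [hρ.2])
        _ ≤ a * volume (ball (0 : EuclideanSpace ℝ (Fin d)) (2 * ρ)) := by
            gcongr
            linarith
        _ = (2 ^ d * 1 * a) * volume (ball (0 : EuclideanSpace ℝ (Fin d)) ρ) := by
            rw [hvol 2 (by norm_num), ENNReal.ofReal_pow (by norm_num)]
            simp only [ENNReal.ofReal_ofNat]
            ring
        _ ≤ _ := by
            gcongr
            exact le_self_add
    · have hpt : ∀ z ∈ ball x ρ, ‖fderiv ℝ F z‖ₑ ≤ 2 ^ d * (S * W) * a := by
        intro z hz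
        calc ‖fderiv ℝ F z‖ₑ ≤ ∫⁻ y, ENNReal.ofReal (rescale η δ (z - y)) * ‖g y‖ₑ :=
              enorm_fderiv_rescale_convolution_le hη hδ hfg z
          _ ≤ ∫⁻ y, (ball x (2 * δ)).indicator
                (fun y => ENNReal.ofReal (S * (δ ^ d)⁻¹) * ‖g y‖ₑ) y := by
              refine lintegral_mono fun y => ?_
              by_cases hy : y ∈ ball x (2 * δ)
              · rw [indicator_of_mem hy]
                gcongr
                exact hS δ hδ _
              · have : rescale η δ (z - y) = 0 := by
                  by_contra h0
                  have h1 := support_rescale_subset hη hδ h0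
                  rw [mem_closedBall_zero_iff, ← dist_eq_norm] at h1
                  refine hy (mem_ball.2 ?_)
                  have := dist_triangle y z x
                  rw [dist_comm y z] at this
                  have := mem_ball.1 hz
                  linarith
                simp [this]
          _ = ENNReal.ofReal (S * (δ ^ d)⁻¹) * ∫⁻ y in ball x (2 * δ), ‖g y‖ₑ := by
              rw [lintegral_indicator measurableSet_ball, lintegral_const_mul' _ _ (by finiteness)]
          _ ≤ ENNReal.ofReal (S * (δ ^ d)⁻¹) *
                (a * volume (ball (0 : EuclideanSpace ℝ (Fin d)) (2 * (δ * 1)))) := by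
              gcongr
              rw [mul_one]
              exact ha _ (by linarith) (by linarith [hρ.1, hρ.2])
          _ = _ := by
              rw [hvol 2 (by norm_num), hvol δ hδ, hWt, ENNReal.ofReal_pow (by norm_num),
                ENNReal.ofReal_mul (by positivity), ENNReal.ofReal_inv_of_pos (by positivity),
                ENNReal.ofReal_coe_nnreal]
              simp only [ENNReal.ofReal_ofNat]
              have h0 : ENNReal.ofReal (δ ^ d) ≠ 0 := by simpa using pow_pos hδ d
              calc _ = 2 ^ d * (S * W) * a *
                    ((ENNReal.ofReal (δ ^ d))⁻¹ * ENNReal.ofReal (δ ^ d)) := by ring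
                _ = _ := by rw [ENNReal.inv_mul_cancel h0 ENNReal.ofReal_ne_top, mul_one]
      calc ∫⁻ z in ball x ρ, ‖fderiv ℝ F z‖ₑ ≤ ∫⁻ z in ball x ρ, 2 ^ d * (S * W) * a :=
            setLIntegral_mono' measurableSet_ball hpt
        _ = 2 ^ d * (S * W) * a * volume (ball (0 : EuclideanSpace ℝ (Fin d)) ρ) := by
            rw [setLIntegral_const, Measure.addHaar_ball_center]
        _ ≤ _ := by
            gcongr
            exact le_add_self
  have h := enorm_sub_le_of_lintegral_ball_fderiv_le volume hFs (key x a _ ha) (key y b _ hb)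
  rw [finrank_euclideanSpace_fin] at h
  refine h.trans_eq ?_
  push_cast
  ring

/-- Jensen for the probability measure with density η_δ(z - ·). -/
theorem rpow_lintegral_rescale_le (hη : IsMollifier η) {δ : ℝ} (hδ : 0 < δ) {q : ℝ} (hq : 1 < q)
    {G : EuclideanSpace ℝ (Fin d) → ℝ≥0∞} (hG : AEMeasurable G) (z : EuclideanSpace ℝ (Fin d)) :
    (∫⁻ y, ENNReal.ofReal (rescale η δ (z - y)) * G y) ^ q ≤
      ∫⁻ y, ENNReal.ofReal (rescale η δ (z - y)) * G y ^ q := by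
  have hc := (contDiff_rescale hη δ).continuous
  have hm : Measurable fun y => ENNReal.ofReal (rescale η δ (z - y)) := by fun_prop
  set ν := volume.withDensity fun y => ENNReal.ofReal (rescale η δ (z - y)) with hν
  have h := lintegral_rpow_le_of_one_lt ν hq
    (hG.mono_ac (withDensity_absolutelyContinuous _ _))
  rw [lintegral_withDensity_eq_lintegral_mul₀ hm.aemeasurable hG,
    lintegral_withDensity_eq_lintegral_mul₀ hm.aemeasurable (hG.pow_const q),
    withDensity_apply _ MeasurableSet.univ, setLIntegral_univ,
    lintegral_rescale_sub_left hη hδ, ENNReal.one_rpow, one_mul] at h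
  exact h

theorem tendsto_rescale_convolution (hη : IsMollifier η)
    {f : EuclideanSpace ℝ (Fin d) → EuclideanSpace ℝ (Fin d)} (hf : Continuous f)
    (x : EuclideanSpace ℝ (Fin d)) :
    Tendsto (fun δ => (rescale η δ ⋆[ContinuousLinearMap.lsmul ℝ ℝ, volume] f) x) (𝓝[>] 0)
      (𝓝 (f x)) := by
  refine convolution_tendsto_right (k := fun _ => x) (g := fun _ => f) ?_ ?_ ?_ ?_ ?_
    tendsto_const_nhds
  · filter_upwards [self_mem_nhdsWithin] with δ hδ using rescale_nonneg hη hδ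
  · filter_upwards [self_mem_nhdsWithin] with δ hδ using integral_rescale hη hδ
  · rw [tendsto_smallSets_iff]
    intro t ht
    obtain ⟨ε, hε, hεt⟩ := Metric.nhds_basis_closedBall.mem_iff.1 ht
    filter_upwards [Ioc_mem_nhdsGT hε] with δ hδ
    exact (support_rescale_subset hη hδ.1).trans ((closedBall_subset_closedBall hδ.2).trans hεt)
  · exact Eventually.of_forall fun _ => hf.aestronglyMeasurable
  · exact (hf.tendsto x).comp tendsto_snd

/-- Morrey's inequality, proved for the mollifications and passed to the limit δ → 0 by continuity.
Only balls centred at x enter the hypothesis; this asymmetry is what lets the second flow avoid any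
compressibility of the Euler map. -/
theorem exists_enorm_sub_le_of_finrank_lt (hη : IsMollifier η) {q : ℝ} (hq : 1 < q)
    (hdq : d < q) :
    ∃ C : ℝ≥0, ∀ (f : EuclideanSpace ℝ (Fin d) → EuclideanSpace ℝ (Fin d))
      (g : EuclideanSpace ℝ (Fin d) → EuclideanSpace ℝ (Fin d) →L[ℝ] EuclideanSpace ℝ (Fin d)),
      HasWeakGradient f g → Continuous f → ∀ (x y : EuclideanSpace ℝ (Fin d)) (a : ℝ≥0∞),
      ∫⁻ z in ball x (3 * dist x y), ‖g z‖ₑ ^ q ≤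
        a ^ q * volume (ball (0 : EuclideanSpace ℝ (Fin d)) (3 * dist x y)) →
      ‖f x - f y‖ₑ ≤ C * a * ‖x - y‖ₑ := by
  have hq0 : 0 < q := by linarith
  set I : ℝ≥0∞ := ∫⁻ θ in Ioo (0 : ℝ) 1, ENNReal.ofReal (θ ^ (-(d / q))) with hI
  have hIt : I < ⊤ := lintegral_Ioo_rpow_lt_top (by
    have : (d : ℝ) / q < 1 := (div_lt_one hq0).2 hdq
    linarith)
  refine ⟨2 ^ d * (2 * ((3 ^ d) ^ (1 / q) * I.toNNReal)), fun f g hfg hf x y a ha => ?_⟩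
  rcases eq_or_ne x y with rfl | hxy
  · simp
  set r := dist x y with hr
  have hr0 : 0 < r := dist_pos.2 hxy
  have hgm : AEMeasurable (fun z => ‖g z‖ₑ) := hfg.2.1.aestronglyMeasurable.enorm
  -- With x' = x or y and δ ≤ r, the ball of radius r + δ about x' lies in the ball of radius 3r
  -- about x. The factor (3 ^ d) ^ (1 / q) pays for the ratio of volumes.
  have key : ∀ δ ∈ Ioc 0 r, ∀ x', dist x' x ≤ r →
      ∫⁻ z in ball x' r, ‖fderiv ℝ (rescale η δ ⋆[ContinuousLinearMap.lsmul ℝ ℝ, volume] f) z‖ₑ ^ q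
        ≤ (a * (3 ^ d) ^ (1 / q)) ^ q * volume (ball (0 : EuclideanSpace ℝ (Fin d)) r) := by
    intro δ hδ x' hx'
    calc _ ≤ ∫⁻ z in ball x' r, ∫⁻ y, ENNReal.ofReal (rescale η δ (z - y)) * ‖g y‖ₑ ^ q := by
          refine lintegral_mono fun z => ?_
          refine le_trans ?_ (rpow_lintegral_rescale_le hη hδ.1 hq hgm z)
          gcongr
          exact enorm_fderiv_rescale_convolution_le hη hδ.1 hfg z
      _ ≤ ∫⁻ y in ball x' (r + δ), ‖g y‖ₑ ^ q :=
          setLIntegral_ball_rescale_le hη hδ.1 (hgm.pow_const q) x' r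
      _ ≤ ∫⁻ y in ball x (3 * r), ‖g y‖ₑ ^ q :=
          lintegral_mono_set (ball_subset_ball' (by linarith [hδ.2]))
      _ ≤ _ := ha
      _ = _ := by
          rw [Measure.addHaar_ball_mul_of_pos _ _ (by norm_num : (0 : ℝ) < 3),
            finrank_euclideanSpace_fin, ENNReal.mul_rpow_of_nonneg _ _ hq0.le, ← ENNReal.rpow_mul,
            one_div_mul_cancel hq0.ne', ENNReal.rpow_one, ENNReal.ofReal_pow (by norm_num)]
          simp only [ENNReal.ofReal_ofNat]
          ring
  have hev : ∀ᶠ δ in 𝓝[>] (0 : ℝ),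
      ‖(rescale η δ ⋆[ContinuousLinearMap.lsmul ℝ ℝ, volume] f) x -
        (rescale η δ ⋆[ContinuousLinearMap.lsmul ℝ ℝ, volume] f) y‖ₑ ≤
        (2 ^ d * (2 * ((3 ^ d) ^ (1 / q) * I))) * a * ‖x - y‖ₑ := by
    filter_upwards [Ioc_mem_nhdsGT hr0] with δ hδ
    have hFs : ContDiff ℝ 1 (rescale η δ ⋆[ContinuousLinearMap.lsmul ℝ ℝ, volume] f) :=
      (contDiff_rescale_convolution hη hδ.1 hfg.1).of_le (by simp)
    have h := enorm_sub_le_of_lintegral_ball_le volume hFs.continuous hr0 hr.ge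
      (setLIntegral_ball_enorm_sub_le_of_rpow volume hFs x hr0 hq
        (key δ hδ x (by simpa using hr0.le)))
      (setLIntegral_ball_enorm_sub_le_of_rpow volume hFs y hr0 hq
        (key δ hδ y (by rw [dist_comm])))
    rw [finrank_euclideanSpace_fin, ← hI] at h
    refine h.trans_eq ?_
    rw [← edist_eq_enorm_sub x y, edist_dist, ← hr]
    ring
  have hlim : Tendsto (fun δ => ‖(rescale η δ ⋆[ContinuousLinearMap.lsmul ℝ ℝ, volume] f) x -
      (rescale η δ ⋆[ContinuousLinearMap.lsmul ℝ ℝ, volume] f) y‖ₑ) (𝓝[>] 0)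
      (𝓝 ‖f x - f y‖ₑ) :=
    ((tendsto_rescale_convolution hη hf x).sub (tendsto_rescale_convolution hη hf y)).enorm
  refine (le_of_tendsto hlim hev).trans_eq ?_
  push_cast
  rw [ENNReal.coe_toNNReal hIt.ne, ENNReal.coe_rpow_of_nonneg _ (by positivity)]
  push_cast
  rfl

end PointwiseEstimates

end EulerFlow

namespace EulerFlow

/-! ### Determinants near the identity and compression of near-identity maps. -/

section Jacobian

open Metric

variable {d : ℕ}

theorem det_eq_det_matrix (A : EuclideanSpace ℝ (Fin d) →L[ℝ] EuclideanSpace ℝ (Fin d)) :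
    A.det = (Matrix.of fun i j => A (EuclideanSpace.single j 1) i).det := by
  rw [ContinuousLinearMap.det, ← LinearMap.det_toMatrix (EuclideanSpace.basisFun (Fin d) ℝ).toBasis]
  congr 1

theorem contDiff_det : ContDiff ℝ ∞
    fun A : EuclideanSpace ℝ (Fin d) →L[ℝ] EuclideanSpace ℝ (Fin d) => A.det := by
  simp_rw [det_eq_det_matrix, Matrix.det_apply]
  refine ContDiff.sum fun σ _ => ContDiff.const_smul _ (contDiff_prod fun i _ => ?_)
  have : ContDiff ℝ ∞ fun A : EuclideanSpace ℝ (Fin d) →L[ℝ] EuclideanSpace ℝ (Fin d) =>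
      EuclideanSpace.proj (𝕜 := ℝ) (σ i) (A (EuclideanSpace.single i 1)) := by fun_prop
  exact this

/-- The polynomial det(1 + tM) equals 1 + t tr M plus a multiple of t². -/
theorem hasDerivAt_det_one_add_smul
    (A : EuclideanSpace ℝ (Fin d) →L[ℝ] EuclideanSpace ℝ (Fin d)) :
    HasDerivAt (fun t : ℝ => (1 + t • A).det) (∑ i, A (EuclideanSpace.single i 1) i) 0 := by
  set M : Matrix (Fin d) (Fin d) ℝ := Matrix.of fun i j => A (EuclideanSpace.single j 1) i with hM
  set P := (Matrix.det (1 + (Polynomial.X : Polynomial ℝ) • M.map Polynomial.C)).divX.divX with hP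
  have h1 : (fun t : ℝ => (1 + t • A).det) = fun t => 1 + M.trace * t + P.eval t * t ^ 2 := by
    ext t
    rw [hP, ← Matrix.det_one_add_smul, det_eq_det_matrix]
    congr 1
    ext i j
    simp [hM, Matrix.one_apply]
  rw [h1]
  have h2 := (((hasDerivAt_const (0 : ℝ) (1 : ℝ)).add
    ((hasDerivAt_id (0 : ℝ)).const_mul M.trace))).add
    ((P.hasDerivAt 0).mul ((hasDerivAt_id (0 : ℝ)).pow 2))
  convert! h2 using 1
  simp [Matrix.trace, hM]

/-- Second order Taylor bound: the derivative of the determinant is Lipschitz on the unit ball by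
compactness, and at the identity it is the trace. -/
theorem exists_le_det_one_add (d : ℕ) : ∃ C : ℝ, 0 ≤ C ∧
    ∀ A : EuclideanSpace ℝ (Fin d) →L[ℝ] EuclideanSpace ℝ (Fin d), ‖A‖ ≤ 1 →
      1 + ∑ i, A (EuclideanSpace.single i 1) i - C * ‖A‖ ^ 2 ≤ (1 + A).det := by
  set f : (EuclideanSpace ℝ (Fin d) →L[ℝ] EuclideanSpace ℝ (Fin d)) → ℝ :=
    fun A => (1 + A).det with hf
  have hfs : ContDiff ℝ ∞ f := contDiff_det.comp (contDiff_const.add contDiff_id)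
  have hfs' : ContDiff ℝ ∞ (fderiv ℝ f) := hfs.fderiv_right (by simp)
  have hfd : Differentiable ℝ f := hfs.differentiable (by simp)
  have hfd' : Differentiable ℝ (fderiv ℝ f) := hfs'.differentiable (by simp)
  obtain ⟨C, hC⟩ := (isCompact_closedBall (0 : EuclideanSpace ℝ (Fin d) →L[ℝ]
    EuclideanSpace ℝ (Fin d)) 1).exists_bound_of_continuousOn
    (hfs'.continuous_fderiv (by simp)).continuousOn
  have hC0 : 0 ≤ C := (norm_nonneg _).trans (hC 0 (by simp))
  refine ⟨C, hC0, fun A hA => ?_⟩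
  have h1 : ∀ B ∈ closedBall (0 : EuclideanSpace ℝ (Fin d) →L[ℝ] EuclideanSpace ℝ (Fin d)) ‖A‖,
      ‖fderiv ℝ f B - fderiv ℝ f 0‖ ≤ C * ‖A‖ := by
    intro B hB
    have hB' := mem_closedBall_zero_iff.1 hB
    have := (convex_closedBall (0 : EuclideanSpace ℝ (Fin d) →L[ℝ]
      EuclideanSpace ℝ (Fin d)) 1).norm_image_sub_le_of_norm_fderiv_le (𝕜 := ℝ)
      (f := fderiv ℝ f) (x := 0) (y := B) (fun x _ => hfd' x) hC (by simp)
      (mem_closedBall_zero_iff.2 (hB'.trans hA))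
    refine this.trans ?_
    rw [sub_zero]
    gcongr
  have h2 := (convex_closedBall (0 : EuclideanSpace ℝ (Fin d) →L[ℝ]
      EuclideanSpace ℝ (Fin d)) ‖A‖).norm_image_sub_le_of_norm_fderiv_le' (𝕜 := ℝ)
      (f := f) (x := 0) (y := A) (fun x _ => hfd x) h1 (by simp) (by simp)
  have h3 : fderiv ℝ f 0 A = ∑ i, A (EuclideanSpace.single i 1) i := by
    have h4 : HasDerivAt (fun t : ℝ => f (t • A)) (fderiv ℝ f 0 A) 0 := by
      have h5 : HasDerivAt (fun t : ℝ => t • A) A 0 := by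
        simpa using (hasDerivAt_id (0 : ℝ)).smul_const A
      have h6 : HasFDerivAt f (fderiv ℝ f 0) ((0 : ℝ) • A) := by
        rw [show (0 : ℝ) • A = 0 from zero_smul ℝ A]
        exact (hfd 0).hasFDerivAt
      exact h6.comp_hasDerivAt (0 : ℝ) h5
    exact h4.unique (hasDerivAt_det_one_add_smul A)
  have h0 : f 0 = 1 := by
    simp [hf, ContinuousLinearMap.det]
  rw [sub_zero, h3, h0, Real.norm_eq_abs] at h2
  have h5 := (abs_le.1 h2).1
  have : f A = (1 + A).det := rfl
  nlinarith

/-- Since B is a 1/2-contraction, x + B x = y + B y forces x = y, so the map is injective and the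
area formula turns a lower bound on the Jacobian into an upper bound on the image measure. -/
theorem map_id_add_le {B : EuclideanSpace ℝ (Fin d) → EuclideanSpace ℝ (Fin d)}
    {B' : EuclideanSpace ℝ (Fin d) → EuclideanSpace ℝ (Fin d) →L[ℝ] EuclideanSpace ℝ (Fin d)}
    (hB : ∀ x, HasFDerivAt B (B' x) x) (hB' : ∀ x, ‖B' x‖ ≤ 1 / 2) {c : ℝ} (hc : 0 < c)
    (hdet : ∀ x, c⁻¹ ≤ (1 + B' x).det) :
    Measure.map (fun x => x + B x) volume ≤
      ENNReal.ofReal c • (volume : Measure (EuclideanSpace ℝ (Fin d))) := by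
  set f : EuclideanSpace ℝ (Fin d) → EuclideanSpace ℝ (Fin d) := fun x => x + B x with hf
  have hfd : ∀ x, HasFDerivAt f (1 + B' x) x := fun x => (hasFDerivAt_id x).add (hB x)
  have hfm : Measurable f :=
    (continuous_iff_continuousAt.2 fun x => (hfd x).continuousAt).measurable
  have hinj : Function.Injective f := by
    intro x y hxy
    have h1 := convex_univ.norm_image_sub_le_of_norm_hasFDerivWithin_le (C := 1 / 2)
      (fun x _ => (hB x).hasFDerivWithinAt) (fun x _ => hB' x) (mem_univ x) (mem_univ y)
    have h2 : B y - B x = x - y := by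
      have : x + B x = y + B y := hxy
      rw [sub_eq_sub_iff_add_eq_add, add_comm, ← this, add_comm]
    rw [h2, norm_sub_rev] at h1
    have h3 : ‖y - x‖ = 0 := by linarith [norm_nonneg (y - x)]
    exact (sub_eq_zero.1 (norm_eq_zero.1 h3)).symm
  refine Measure.le_iff.2 fun s hs => ?_
  rw [Measure.map_apply hfm hs, Measure.smul_apply, smul_eq_mul]
  have h1 := lintegral_abs_det_fderiv_eq_addHaar_image volume (hfm hs)
    (fun x _ => (hfd x).hasFDerivWithinAt) hinj.injOn
  calc volume (f ⁻¹' s) = ENNReal.ofReal c * (ENNReal.ofReal c⁻¹ * volume (f ⁻¹' s)) := by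
        rw [← mul_assoc, ← ENNReal.ofReal_mul hc.le, mul_inv_cancel₀ hc.ne', ENNReal.ofReal_one,
          one_mul]
    _ = ENNReal.ofReal c * ∫⁻ x in f ⁻¹' s, ENNReal.ofReal c⁻¹ := by rw [setLIntegral_const]
    _ ≤ ENNReal.ofReal c * ∫⁻ x in f ⁻¹' s, ENNReal.ofReal |(1 + B' x).det| := by
        gcongr with x
        exact (hdet x).trans (le_abs_self _)
    _ = ENNReal.ofReal c * volume (f '' (f ⁻¹' s)) := by rw [h1]
    _ ≤ _ := by
        gcongr
        exact image_preimage_subset f s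

end Jacobian

end EulerFlow

namespace EulerFlow

/-! ### Uniform bounds for mollified fields. -/

section MollifiedField

open Metric

variable {d : ℕ} {η : EuclideanSpace ℝ (Fin d) → ℝ}
  {f : EuclideanSpace ℝ (Fin d) → EuclideanSpace ℝ (Fin d)}
  {g : EuclideanSpace ℝ (Fin d) → EuclideanSpace ℝ (Fin d) →L[ℝ] EuclideanSpace ℝ (Fin d)}

theorem norm_rescale_convolution_le (hη : IsMollifier η) {δ : ℝ} (hδ : 0 < δ) {K : ℝ}
    (hf : ∀ᵐ x, ‖f x‖ ≤ K) (x : EuclideanSpace ℝ (Fin d)) :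
    ‖(rescale η δ ⋆[ContinuousLinearMap.lsmul ℝ ℝ, volume] f) x‖ ≤ K := by
  have hK : 0 ≤ K := by
    obtain ⟨y, hy⟩ := hf.exists
    exact (norm_nonneg _).trans hy
  rw [rescale_convolution_apply, ← ENNReal.ofReal_le_ofReal_iff hK, ofReal_norm]
  calc _ ≤ ∫⁻ y, ‖rescale η δ (x - y) • f y‖ₑ := enorm_integral_le_lintegral_enorm _
    _ ≤ ∫⁻ y, ENNReal.ofReal (rescale η δ (x - y)) * ENNReal.ofReal K := by
        refine lintegral_mono_ae ?_
        filter_upwards [hf] with y hy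
        rw [enorm_smul, Real.enorm_of_nonneg (rescale_nonneg hη hδ _)]
        gcongr
        rw [← ofReal_norm]
        exact ENNReal.ofReal_le_ofReal hy
    _ = _ := by
        rw [lintegral_mul_const' _ _ ENNReal.ofReal_ne_top, lintegral_rescale_sub_left hη hδ,
          one_mul]

theorem lintegral_enorm_fderiv_rescale (η : EuclideanSpace ℝ (Fin d) → ℝ) {δ : ℝ} (hδ : 0 < δ)
    (hη : IsMollifier η) :
    ∫⁻ y, ‖fderiv ℝ (rescale η δ) y‖ₑ = ENNReal.ofReal (δ⁻¹ * ∫ y, ‖fderiv ℝ η y‖) := by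
  have h1 : ∀ y, fderiv ℝ (rescale η δ) y = ((δ ^ d)⁻¹ * δ⁻¹) • fderiv ℝ η (δ⁻¹ • y) := by
    intro y
    have h2 := ((hη.smooth.differentiable (by simp) (δ⁻¹ • y)).hasFDerivAt.comp y
      ((hasFDerivAt_id y).const_smul δ⁻¹)).const_mul (δ ^ d)⁻¹
    have h3 : fderiv ℝ (rescale η δ) y = _ := h2.fderiv
    rw [h3]
    ext v
    simp [mul_assoc]
  have hc : Integrable fun y => ‖fderiv ℝ (rescale η δ) y‖ :=
    (((contDiff_rescale hη δ).continuous_fderiv (by simp)).integrable_of_hasCompactSupport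
      ((hasCompactSupport_rescale hη hδ).fderiv ℝ)).norm
  simp_rw [← ofReal_norm]
  rw [← ofReal_integral_eq_lintegral_ofReal hc (Eventually.of_forall fun _ => norm_nonneg _)]
  congr 1
  simp_rw [h1, norm_smul]
  rw [integral_const_mul, Measure.integral_comp_smul volume (fun y => ‖fderiv ℝ η y‖),
    finrank_euclideanSpace_fin, norm_mul, norm_inv, norm_inv, norm_pow,
    Real.norm_of_nonneg hδ.le, inv_pow, inv_inv, abs_of_pos (by positivity), smul_eq_mul]
  field_simp

/-- Putting the derivative on the kernel uses only the sup bound of f and costs 1/δ. This is the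
source of the condition h ≤ δ² below. -/
theorem norm_fderiv_rescale_convolution_le (hη : IsMollifier η) {δ : ℝ} (hδ : 0 < δ)
    (hfl : LocallyIntegrable f) {K : ℝ} (hf : ∀ᵐ x, ‖f x‖ ≤ K) (x : EuclideanSpace ℝ (Fin d)) :
    ‖fderiv ℝ (rescale η δ ⋆[ContinuousLinearMap.lsmul ℝ ℝ, volume] f) x‖ ≤
      (∫ y, ‖fderiv ℝ η y‖) * K / δ := by
  have hK : 0 ≤ K := by
    obtain ⟨y, hy⟩ := hf.exists
    exact (norm_nonneg _).trans hy
  have hI : 0 ≤ ∫ y, ‖fderiv ℝ η y‖ := integral_nonneg fun _ => norm_nonneg _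
  rw [((hasCompactSupport_rescale hη hδ).hasFDerivAt_convolution_left
    (ContinuousLinearMap.lsmul ℝ ℝ) ((contDiff_rescale hη δ).of_le (by simp)) hfl x).fderiv,
    convolution_eq_swap, ← ENNReal.ofReal_le_ofReal_iff (by positivity), ofReal_norm]
  calc _ ≤ ∫⁻ y, ‖(ContinuousLinearMap.lsmul ℝ ℝ).precompL (EuclideanSpace ℝ (Fin d))
        (fderiv ℝ (rescale η δ) (x - y)) (f y)‖ₑ := enorm_integral_le_lintegral_enorm _
    _ ≤ ∫⁻ y, ‖fderiv ℝ (rescale η δ) (x - y)‖ₑ * ENNReal.ofReal K := by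
        refine lintegral_mono_ae ?_
        filter_upwards [hf] with y hy
        rw [← ofReal_norm, ← ofReal_norm, ← ENNReal.ofReal_mul (norm_nonneg _)]
        refine ENNReal.ofReal_le_ofReal ?_
        refine (ContinuousLinearMap.le_opNorm₂ _ _ _).trans ?_
        have h1 : ‖(ContinuousLinearMap.lsmul ℝ ℝ : ℝ →L[ℝ] EuclideanSpace ℝ (Fin d) →L[ℝ]
            EuclideanSpace ℝ (Fin d)).precompL (EuclideanSpace ℝ (Fin d))‖ ≤ 1 :=
          (ContinuousLinearMap.norm_precompL_le _ _).trans ContinuousLinearMap.opNorm_lsmul_le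
        calc _ ≤ 1 * ‖fderiv ℝ (rescale η δ) (x - y)‖ * K := by gcongr
          _ = _ := by rw [one_mul]
    _ = _ := by
        rw [lintegral_mul_const' _ _ ENNReal.ofReal_ne_top,
          lintegral_sub_left_eq_self (fun y => ‖fderiv ℝ (rescale η δ) y‖ₑ),
          lintegral_enorm_fderiv_rescale η hδ hη, ← ENNReal.ofReal_mul (by positivity)]
        congr 1
        field_simp

/-- Averaging against a probability kernel preserves a one-sided bound on the divergence, with no
loss in δ. -/
theorem neg_trace_fderiv_rescale_convolution_le (hη : IsMollifier η) {δ : ℝ} (hδ : 0 < δ)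
    (hfg : HasWeakGradient f g) {m : ℝ}
    (hm : ∀ᵐ x, -(∑ i, (g x (EuclideanSpace.single i 1)) i) ≤ m)
    (x : EuclideanSpace ℝ (Fin d)) :
    -(∑ i, (fderiv ℝ (rescale η δ ⋆[ContinuousLinearMap.lsmul ℝ ℝ, volume] f) x
      (EuclideanSpace.single i 1)) i) ≤ m := by
  have hint := integrable_rescale_smul hη hδ hfg.2.1 x
  set tr : (EuclideanSpace ℝ (Fin d) →L[ℝ] EuclideanSpace ℝ (Fin d)) →L[ℝ] ℝ :=
    ∑ i, (EuclideanSpace.proj (𝕜 := ℝ) i).comp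
      (ContinuousLinearMap.apply ℝ (EuclideanSpace ℝ (Fin d)) (EuclideanSpace.single i 1)) with htr
  have htr' : ∀ A, tr A = ∑ i, (A (EuclideanSpace.single i 1)) i := by
    intro A
    simp [htr]
  rw [fderiv_rescale_convolution hη hδ hfg, ← htr', ← tr.integral_comp_comm hint, ← integral_neg]
  have hρi : Integrable fun y => rescale η δ (x - y) :=
    ((contDiff_rescale hη δ).continuous.integrable_of_hasCompactSupport
      (hasCompactSupport_rescale hη hδ)).comp_sub_left x
  calc ∫ y, -tr (rescale η δ (x - y) • g y) ≤ ∫ y, rescale η δ (x - y) * m := by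
        refine integral_mono_ae (tr.integrable_comp hint).neg (hρi.mul_const m) ?_
        filter_upwards [hm] with y hy
        rw [map_smul, smul_eq_mul, ← mul_neg, htr']
        exact mul_le_mul_of_nonneg_left hy (rescale_nonneg hη hδ _)
    _ = m := by
        rw [integral_mul_const, integral_sub_left_eq_self (fun y => rescale η δ y) volume,
          integral_rescale hη hδ, one_mul]

/-- Bounds on a field on `(0,T) × ℝᵈ` with weak spatial gradient `Du`: a uniform bound `K`
on the field and an integrable in time bound `m` on the negative part of its divergence. -/
structure FieldBounds (T K : ℝ) (m : ℝ → ℝ)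
    (u : ℝ → EuclideanSpace ℝ (Fin d) → EuclideanSpace ℝ (Fin d))
    (Du : ℝ → EuclideanSpace ℝ (Fin d) →
      EuclideanSpace ℝ (Fin d) →L[ℝ] EuclideanSpace ℝ (Fin d)) : Prop where
  measurable : AEStronglyMeasurable (fun z : ℝ × EuclideanSpace ℝ (Fin d) => u z.1 z.2)
    ((volume.restrict (Ioo 0 T)).prod volume)
  measurable_grad : AEStronglyMeasurable (fun z : ℝ × EuclideanSpace ℝ (Fin d) => Du z.1 z.2)
    ((volume.restrict (Ioo 0 T)).prod volume)
  bound : ∀ᵐ s ∂(volume.restrict (Ioo 0 T)), ∀ᵐ x, ‖u s x‖ ≤ K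
  weakGradient : ∀ᵐ s ∂(volume.restrict (Ioo 0 T)), HasWeakGradient (u s) (Du s)
  integrable : IntegrableOn m (Ioo 0 T)
  nonneg : ∀ s, 0 ≤ m s
  divergence : ∀ᵐ s ∂(volume.restrict (Ioo 0 T)), ∀ᵐ x,
    -(∑ i, (Du s x (EuclideanSpace.single i 1)) i) ≤ m s

variable {T K : ℝ} {m : ℝ → ℝ} {u : ℝ → EuclideanSpace ℝ (Fin d) → EuclideanSpace ℝ (Fin d)}
  {Du : ℝ → EuclideanSpace ℝ (Fin d) →
    EuclideanSpace ℝ (Fin d) →L[ℝ] EuclideanSpace ℝ (Fin d)}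

theorem FieldBounds.aestronglyMeasurable_mollify (hu : FieldBounds T K m u Du)
    (hη : IsMollifier η) (δ : ℝ) (x : EuclideanSpace ℝ (Fin d)) :
    AEStronglyMeasurable (fun s => mollify η δ u s x) (volume.restrict (Ioo 0 T)) := by
  unfold mollify
  simp_rw [rescale_convolution_apply]
  refine AEStronglyMeasurable.integral_prod_right' (f := fun z : ℝ × EuclideanSpace ℝ (Fin d) =>
    rescale η δ (x - z.2) • u z.1 z.2) ?_
  have := (contDiff_rescale hη δ).continuous
  exact (Continuous.aestronglyMeasurable (f := fun z : ℝ × EuclideanSpace ℝ (Fin d) =>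
    rescale η δ (x - z.2)) (by fun_prop)).smul hu.measurable

theorem FieldBounds.aestronglyMeasurable_fderiv_mollify (hu : FieldBounds T K m u Du)
    (hη : IsMollifier η) {δ : ℝ} (hδ : 0 < δ) (x : EuclideanSpace ℝ (Fin d)) :
    AEStronglyMeasurable (fun s => fderiv ℝ (mollify η δ u s) x) (volume.restrict (Ioo 0 T)) := by
  have h : AEStronglyMeasurable (fun s => ∫ y, rescale η δ (x - y) • Du s y)
      (volume.restrict (Ioo 0 T)) := by
    refine AEStronglyMeasurable.integral_prod_right' (f := fun z : ℝ × EuclideanSpace ℝ (Fin d) =>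
      rescale η δ (x - z.2) • Du z.1 z.2) ?_
    have := (contDiff_rescale hη δ).continuous
    exact (Continuous.aestronglyMeasurable (f := fun z : ℝ × EuclideanSpace ℝ (Fin d) =>
      rescale η δ (x - z.2)) (by fun_prop)).smul hu.measurable_grad
  refine h.congr ?_
  filter_upwards [hu.weakGradient] with s hs
  exact (fderiv_rescale_convolution hη hδ hs x).symm

end MollifiedField

end EulerFlow

namespace EulerFlow

/-! ### Exact trajectories against Euler nodes: the discrete logarithmic Gronwall estimate. -/

section Trajectories

variable {d : ℕ}

/-- A field on `(0,T) × ℝᵈ` that is bounded by `K`, continuous in space and measurable in time. -/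
structure IsBoundedField (T K : ℝ)
    (v : ℝ → EuclideanSpace ℝ (Fin d) → EuclideanSpace ℝ (Fin d)) : Prop where
  measurable : ∀ x, AEStronglyMeasurable (fun s => v s x) (volume.restrict (Ioo 0 T))
  continuous : ∀ᵐ s ∂(volume.restrict (Ioo 0 T)), Continuous (v s)
  bound : ∀ᵐ s ∂(volume.restrict (Ioo 0 T)), ∀ x, ‖v s x‖ ≤ K

variable {T K : ℝ} {v : ℝ → EuclideanSpace ℝ (Fin d) → EuclideanSpace ℝ (Fin d)}

theorem restrict_uIoc_le_restrict_Ioo {a b : ℝ} (ha : a ∈ Icc 0 T) (hb : b ∈ Icc 0 T) :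
    (volume.restrict (uIoc a b) : Measure ℝ) ≤ volume.restrict (Ioo 0 T) := by
  rw [restrict_Ioo_eq_restrict_Ioc]
  refine Measure.restrict_mono (fun s hs => ?_) le_rfl
  rw [mem_uIoc] at hs
  rcases hs with hs | hs
  · exact ⟨ha.1.trans_lt hs.1, hs.2.trans hb.2⟩
  · exact ⟨hb.1.trans_lt hs.1, hs.2.trans ha.2⟩

theorem intervalIntegrable_of_ae_norm_le {F : Type*} [NormedAddCommGroup F] {w : ℝ → F}
    (hw : AEStronglyMeasurable w (volume.restrict (Ioo 0 T)))
    (hK : ∀ᵐ s ∂(volume.restrict (Ioo 0 T)), ‖w s‖ ≤ K) {a b : ℝ}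
    (ha : a ∈ Icc 0 T) (hb : b ∈ Icc 0 T) : IntervalIntegrable w volume a b := by
  have hle := restrict_uIoc_le_restrict_Ioo ha hb
  rw [intervalIntegrable_iff]
  exact IntegrableOn.of_bound (by simp) (hw.mono_measure hle) K (ae_mono hle hK)

theorem norm_intervalIntegral_le_of_ae_norm_le {F : Type*} [NormedAddCommGroup F] [NormedSpace ℝ F]
    {w : ℝ → F} (hK : ∀ᵐ s ∂(volume.restrict (Ioo 0 T)), ‖w s‖ ≤ K) {a b : ℝ}
    (ha : a ∈ Icc 0 T) (hb : b ∈ Icc 0 T) (hab : a ≤ b) :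
    ‖∫ s in a..b, w s‖ ≤ K * (b - a) := by
  have hle := restrict_uIoc_le_restrict_Ioo ha hb
  rw [← abs_of_nonneg (sub_nonneg.2 hab)]
  exact intervalIntegral.norm_integral_le_of_norm_le_const_ae
    ((ae_restrict_iff' measurableSet_uIoc).1 (ae_mono hle hK))

theorem IsBoundedField.intervalIntegrable (hv : IsBoundedField T K v)
    (x : EuclideanSpace ℝ (Fin d)) {a b : ℝ} (ha : a ∈ Icc 0 T) (hb : b ∈ Icc 0 T) :
    IntervalIntegrable (fun s => v s x) volume a b :=
  intervalIntegrable_of_ae_norm_le (hv.measurable x) (hv.bound.mono fun _ h => h x) ha hb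

theorem IsBoundedField.continuous_integral (hv : IsBoundedField T K v) {a b : ℝ}
    (ha : a ∈ Icc 0 T) (hb : b ∈ Icc 0 T) : Continuous fun x => ∫ s in a..b, v s x := by
  have hle := restrict_uIoc_le_restrict_Ioo ha hb
  refine intervalIntegral.continuous_of_dominated_interval (bound := fun _ => K)
    (fun x => (hv.measurable x).mono_measure hle) (fun x => ?_) (by simp) ?_
  · exact (ae_restrict_iff' measurableSet_uIoc).1 (ae_mono hle (hv.bound.mono fun _ h => h x))
  · exact (ae_restrict_iff' measurableSet_uIoc).1 (ae_mono hle hv.continuous)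

theorem eulerNode_succ (v : ℝ → EuclideanSpace ℝ (Fin d) → EuclideanSpace ℝ (Fin d)) {h : ℝ}
    (hh : h ≠ 0) (n : ℕ) (x : EuclideanSpace ℝ (Fin d)) :
    eulerNode v h (n + 1) x = eulerNode v h n x +
      ∫ s in (n * h)..((n + 1) * h), v s (eulerNode v h n x) := by
  rw [eulerNode, interval_average_eq, smul_smul,
    show ((n : ℝ) + 1) * h - n * h = h by ring, mul_inv_cancel₀ hh, one_smul]

theorem mul_mem_Icc_of_succ {h : ℝ} (hh : 0 < h) {n : ℕ} (hn : ((n : ℝ) + 1) * h ≤ T) :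
    (n : ℝ) * h ∈ Icc 0 T ∧ ((n : ℝ) + 1) * h ∈ Icc 0 T :=
  ⟨⟨by positivity, by nlinarith⟩, ⟨by positivity, hn⟩⟩

theorem IsBoundedField.continuous_eulerNode (hv : IsBoundedField T K v) {h : ℝ} (hh : 0 < h)
    (n : ℕ) (hn : n * h ≤ T) : Continuous (eulerNode v h n) := by
  induction n with
  | zero => exact continuous_id
  | succ n ih =>
    push_cast at hn
    have h1 := mul_mem_Icc_of_succ hh hn
    have h2 := ih h1.1.2
    have h3 : eulerNode v h (n + 1) = fun x => eulerNode v h n x +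
      ∫ s in (n * h)..((n + 1) * h), v s (eulerNode v h n x) :=
      funext fun x => eulerNode_succ v hh.ne' n x
    rw [h3]
    exact h2.add ((hv.continuous_integral h1.1 h1.2).comp h2)

theorem IsBoundedField.norm_eulerNode_sub_le (hv : IsBoundedField T K v) {h : ℝ} (hh : 0 < h)
    (n : ℕ) (hn : n * h ≤ T) (x : EuclideanSpace ℝ (Fin d)) :
    ‖eulerNode v h n x - x‖ ≤ K * (n * h) := by
  induction n with
  | zero => simp [eulerNode]
  | succ n ih =>
    push_cast at hn ⊢
    have h1 := mul_mem_Icc_of_succ hh hn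
    rw [eulerNode_succ v hh.ne', add_sub_right_comm]
    refine (norm_add_le _ _).trans ?_
    have h2 := norm_intervalIntegral_le_of_ae_norm_le
      (hv.bound.mono fun s hs => hs (eulerNode v h n x)) h1.1 h1.2 (by nlinarith)
    have h3 := ih h1.1.2
    nlinarith

theorem IsBoundedField.norm_eulerFlow_sub_eulerNode_le (hv : IsBoundedField T K v) {N : ℕ}
    {h : ℝ} (hh : 0 < h) (hN : N * h = T) {t : ℝ} (ht : t ∈ Icc 0 T)
    (x : EuclideanSpace ℝ (Fin d)) :
    ‖eulerFlow v h t x - eulerNode v h ⌊t / h⌋₊ x‖ ≤ K * (t - ⌊t / h⌋₊ * h) := by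
  rw [eulerFlow, add_sub_cancel_left]
  have hle : (⌊t / h⌋₊ : ℝ) * h ≤ t := by
    rw [← le_div_iff₀ hh]
    exact Nat.floor_le (div_nonneg ht.1 hh.le)
  -- At t = T the floor is N and the averaging interval lies beyond T, where nothing is known about
  -- the field; there the prefactor t - N h is zero.
  rcases eq_or_lt_of_le ht.2 with h1 | h1
  · have : (⌊t / h⌋₊ : ℝ) * h = t := by
      have h2 : t / h = N := by rw [h1, ← hN, mul_div_cancel_right₀ _ hh.ne']
      rw [h2, Nat.floor_natCast, hN, h1]
    simp [this]
  · have h2 : ((⌊t / h⌋₊ : ℝ) + 1) * h ≤ T := by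
      rw [← hN]
      gcongr
      have : ⌊t / h⌋₊ < N := by
        rw [Nat.floor_lt (div_nonneg ht.1 hh.le), div_lt_iff₀ hh, hN]
        exact h1
      exact_mod_cast this
    have h3 := mul_mem_Icc_of_succ hh h2
    have h4 := norm_intervalIntegral_le_of_ae_norm_le
      (hv.bound.mono fun s hs => hs (eulerNode v h ⌊t / h⌋₊ x)) h3.1 h3.2 (by nlinarith)
    have h5 : ((⌊t / h⌋₊ : ℝ) + 1) * h - ⌊t / h⌋₊ * h = h := by ring
    rw [h5] at h4
    rw [interval_average_eq, norm_smul, norm_smul, norm_inv, h5, Real.norm_of_nonneg (sub_nonneg.2 hle), Real.norm_of_nonneg hh.le]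
    calc _ ≤ (t - ⌊t / h⌋₊ * h) * (h⁻¹ * (K * h)) := by
          have : 0 ≤ t - ⌊t / h⌋₊ * h := sub_nonneg.2 hle
          gcongr
      _ = K * (t - ⌊t / h⌋₊ * h) := by field_simp

variable {x : EuclideanSpace ℝ (Fin d)} {γ : ℝ → EuclideanSpace ℝ (Fin d)}

/-- γ minus the primitive of w is absolutely continuous with derivative zero almost everywhere,
hence constant. -/
theorem sub_eq_intervalIntegral_of_absolutelyContinuous {F : Type*} [NormedAddCommGroup F]
    [NormedSpace ℝ F] [CompleteSpace F] {γ w : ℝ → F} (hT : 0 ≤ T)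
    (hγ : AbsolutelyContinuousOnInterval γ 0 T)
    (hd : ∀ᵐ t ∂(volume.restrict (Ioo 0 T)), HasDerivAt γ (w t) t)
    (hw : AEStronglyMeasurable w (volume.restrict (Ioo 0 T)))
    (hK : ∀ᵐ s ∂(volume.restrict (Ioo 0 T)), ‖w s‖ ≤ K) {a b : ℝ} (ha : a ∈ Icc 0 T)
    (hb : b ∈ Icc 0 T) :
    γ b - γ a = ∫ s in a..b, w s := by
  have hi : ∀ {c e : ℝ}, c ∈ Icc 0 T → e ∈ Icc 0 T → IntervalIntegrable w volume c e :=
    fun hc he => intervalIntegrable_of_ae_norm_le hw hK hc he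
  have h00 : (0 : ℝ) ∈ Icc 0 T := left_mem_Icc.2 hT
  have hlip : LipschitzOnWith K.toNNReal (fun t => ∫ s in (0 : ℝ)..t, w s) (uIcc 0 T) := by
    rw [uIcc_of_le hT]
    refine LipschitzOnWith.of_dist_le_mul fun c hc e he => ?_
    rw [dist_eq_norm, Real.dist_eq,
      intervalIntegral.integral_interval_sub_left (hi h00 hc) (hi h00 he)]
    refine (intervalIntegral.norm_integral_le_of_norm_le_const_ae
      ((ae_restrict_iff' measurableSet_uIoc).1
        (ae_mono (restrict_uIoc_le_restrict_Ioo he hc) hK))).trans ?_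
    gcongr
    exact Real.le_coe_toNNReal K
  have h0 : AbsolutelyContinuousOnInterval (fun t => γ t - ∫ s in (0 : ℝ)..t, w s) 0 T :=
    hγ.sub hlip.absolutelyContinuousOnInterval
  have h1 : ∀ᵐ t, t ∈ uIcc 0 T → HasDerivAt (fun t => γ t - ∫ s in (0 : ℝ)..t, w s) 0 t := by
    rw [restrict_Ioo_eq_restrict_Icc, ae_restrict_iff' measurableSet_Icc] at hd
    filter_upwards [hd, (hi h00 (right_mem_Icc.2 hT)).ae_hasDerivAt_integral] with t ht1 ht2 ht
    have h2 := (ht1 (by rwa [uIcc_of_le hT] at ht)).sub (ht2 ht 0 (by simp))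
    rwa [sub_self] at h2
  obtain ⟨C, hC⟩ := h0.const_of_ae_hasDerivAt_zero h1
  rw [uIcc_of_le hT] at hC
  have h2 : γ a - ∫ s in (0 : ℝ)..a, w s = C := hC a ha
  have h3 : γ b - ∫ s in (0 : ℝ)..b, w s = C := hC b hb
  rw [← intervalIntegral.integral_interval_sub_left (hi h00 hb) (hi h00 ha)]
  rw [sub_eq_iff_eq_add] at h2 h3
  rw [h2, h3]
  abel

/-- The composition agrees almost everywhere with the derivative of γ, which is measurable; no joint
measurability of the field is needed. -/
theorem IsACSolution.aestronglyMeasurable (hγ : IsACSolution T v x γ) :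
    AEStronglyMeasurable (fun s => v s (γ s)) (volume.restrict (Ioo 0 T)) :=
  (stronglyMeasurable_deriv γ).aestronglyMeasurable.congr (hγ.2.2.mono fun _ h => h.deriv)

theorem IsBoundedField.ae_norm_comp_le (hv : IsBoundedField T K v)
    (γ : ℝ → EuclideanSpace ℝ (Fin d)) :
    ∀ᵐ s ∂(volume.restrict (Ioo 0 T)), ‖v s (γ s)‖ ≤ K :=
  hv.bound.mono fun s hs => hs (γ s)

theorem IsACSolution.sub_eq_intervalIntegral (hγ : IsACSolution T v x γ)
    (hv : IsBoundedField T K v) (hT : 0 ≤ T) {a b : ℝ} (ha : a ∈ Icc 0 T) (hb : b ∈ Icc 0 T) :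
    γ b - γ a = ∫ s in a..b, v s (γ s) :=
  sub_eq_intervalIntegral_of_absolutelyContinuous hT hγ.1 hγ.2.2 hγ.aestronglyMeasurable
    (hv.ae_norm_comp_le γ) ha hb

theorem IsACSolution.norm_sub_le (hγ : IsACSolution T v x γ)
    (hv : IsBoundedField T K v) (hT : 0 ≤ T) {a b : ℝ} (ha : a ∈ Icc 0 T) (hb : b ∈ Icc 0 T)
    (hab : a ≤ b) : ‖γ b - γ a‖ ≤ K * (b - a) := by
  rw [hγ.sub_eq_intervalIntegral hv hT ha hb]
  exact norm_intervalIntegral_le_of_ae_norm_le (hv.ae_norm_comp_le γ) ha hb hab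

theorem floor_div_eq_of_mem_Ico {h s : ℝ} (hh : 0 < h) {n : ℕ}
    (hs : s ∈ Ico ((n : ℝ) * h) (((n : ℝ) + 1) * h)) : ⌊s / h⌋₊ = n := by
  rw [Nat.floor_eq_iff (div_nonneg ((by positivity : (0 : ℝ) ≤ n * h).trans hs.1) hh.le)]
  exact ⟨(le_div_iff₀ hh).2 hs.1, (div_lt_iff₀ hh).2 hs.2⟩

/-- The hypothesis says 1 + r'/c ≤ (1 + r/c)(1 + J); take logarithms and use log(1 + J) ≤ J. -/
theorem ofReal_log_one_add_le {r r' c : ℝ} (hr : 0 ≤ r) (hr' : 0 ≤ r') (hc : 0 < c) {J : ℝ≥0∞}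
    (h : ENNReal.ofReal r' ≤ ENNReal.ofReal r + ENNReal.ofReal (r + c) * J) :
    ENNReal.ofReal (Real.log (1 + r' / c)) ≤ ENNReal.ofReal (Real.log (1 + r / c)) + J := by
  rcases eq_or_ne J ⊤ with rfl | hJ
  · simp
  lift J to ℝ≥0 using hJ
  rw [← ENNReal.ofReal_coe_nnreal, ← ENNReal.ofReal_mul (by positivity),
    ← ENNReal.ofReal_add hr (by positivity),
    ENNReal.ofReal_le_ofReal_iff (by positivity)] at h
  rw [← ENNReal.ofReal_coe_nnreal, ← ENNReal.ofReal_add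
    (Real.log_nonneg (by linarith [div_nonneg hr hc.le])) J.coe_nonneg]
  refine ENNReal.ofReal_le_ofReal ?_
  have h1 : 1 + r' / c ≤ (1 + r / c) * (1 + J) := by
    have : r' / c ≤ (r + (r + c) * J) / c := by gcongr
    refine (add_le_add_right this 1).trans_eq ?_
    field_simp
    ring
  have h2 : 0 < 1 + r / c := by positivity
  have hJ0 : (0 : ℝ) ≤ J := J.2
  calc Real.log (1 + r' / c) ≤ Real.log ((1 + r / c) * (1 + J)) :=
        Real.log_le_log (by positivity) h1
    _ = Real.log (1 + r / c) + Real.log (1 + J) := Real.log_mul h2.ne' (by positivity)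
    _ ≤ _ := by
        gcongr
        linarith [Real.log_le_sub_one_of_pos (show (0 : ℝ) < 1 + J by positivity)]

/-- Discrete logarithmic Gronwall estimate for the distance between a trajectory and the
Euler nodes, under a pointwise Lipschitz-type bound with weights `G` and `H`. -/
theorem IsACSolution.ofReal_log_le (hγ : IsACSolution T v x γ) (hv : IsBoundedField T K v)
    (hK : 0 < K) {h : ℝ} (hh : 0 < h) {G H : ℝ → EuclideanSpace ℝ (Fin d) → ℝ≥0∞}
    (hGH : ∀ᵐ s ∂(volume.restrict (Ioo 0 T)), ∀ a b, ‖a - x‖ ≤ K * T → ‖b - x‖ ≤ K * T →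
      ‖v s a - v s b‖ₑ ≤ ‖a - b‖ₑ * (G s a + H s b)) (n : ℕ) (hn : n * h ≤ T) :
    ENNReal.ofReal (Real.log (1 + ‖γ (n * h) - eulerNode v h n x‖ / (K * h))) ≤
      ∫⁻ s in Ico 0 (n * h), (G s (γ s) + H s (eulerNode v h ⌊s / h⌋₊ x)) := by
  induction n with
  | zero => simp [eulerNode, hγ.2.1]
  | succ n ih =>
    push_cast at hn ⊢
    obtain ⟨h1, h2⟩ := mul_mem_Icc_of_succ hh hn
    have hT : 0 ≤ T := h1.1.trans h1.2
    have hle : (n : ℝ) * h ≤ (n + 1) * h := by nlinarith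
    set y := eulerNode v h n x with hy
    have hstep : γ ((n + 1) * h) - eulerNode v h (n + 1) x = (γ (n * h) - y) +
        ∫ s in (n * h)..((n + 1) * h), (v s (γ s) - v s y) := by
      rw [eulerNode_succ v hh.ne', intervalIntegral.integral_sub
        (intervalIntegrable_of_ae_norm_le hγ.aestronglyMeasurable (hv.ae_norm_comp_le γ) h1 h2)
        (hv.intervalIntegrable y h1 h2), ← hγ.sub_eq_intervalIntegral hv hT h1 h2]
      abel
    -- During the step the trajectory moves by at most K h, so its distance to the frozen node is at
    -- most r_n + K h. This is why the logarithm is normalised at scale K h. Both points stay within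
    -- K T of x, so only local weights are needed.
    have hpt : ∀ᵐ s ∂(volume.restrict (Ioc (n * h) ((n + 1) * h))),
        ‖v s (γ s) - v s y‖ₑ ≤ ENNReal.ofReal (‖γ (n * h) - y‖ + K * h) * (G s (γ s) + H s y) := by
      have hsub := restrict_uIoc_le_restrict_Ioo h1 h2
      rw [uIoc_of_le hle] at hsub
      filter_upwards [ae_mono hsub hGH, ae_restrict_mem measurableSet_Ioc] with s hs hsm
      have hs0 : s ∈ Icc 0 T := ⟨h1.1.trans hsm.1.le, hsm.2.trans h2.2⟩
      have hd1 := hγ.norm_sub_le hv hT (left_mem_Icc.2 hT) hs0 hs0.1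
      rw [hγ.2.1, sub_zero] at hd1
      have hd2 := hv.norm_eulerNode_sub_le hh n h1.2 x
      refine (hs (γ s) y (hd1.trans ?_) (hd2.trans ?_)).trans ?_
      · exact mul_le_mul_of_nonneg_left hs0.2 hK.le
      · exact mul_le_mul_of_nonneg_left h1.2 hK.le
      · gcongr
        rw [← ofReal_norm]
        refine ENNReal.ofReal_le_ofReal ?_
        have hd3 := hγ.norm_sub_le hv hT h1 hs0 hsm.1.le
        calc ‖γ s - y‖ = ‖(γ (n * h) - y) + (γ s - γ (n * h))‖ := by congr 1; abel
          _ ≤ ‖γ (n * h) - y‖ + K * (s - n * h) := (norm_add_le _ _).trans (by gcongr)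
          _ ≤ _ := by
              gcongr
              linarith [hsm.2]
    set J := ∫⁻ s in Ico (n * h) ((n + 1) * h), (G s (γ s) + H s y) with hJ
    have hbound : ENNReal.ofReal ‖γ ((n + 1) * h) - eulerNode v h (n + 1) x‖ ≤
        ENNReal.ofReal ‖γ (n * h) - y‖ + ENNReal.ofReal (‖γ (n * h) - y‖ + K * h) * J := by
      rw [hstep, ofReal_norm, ofReal_norm]
      refine (enorm_add_le _ _).trans ?_
      gcongr
      rw [intervalIntegral.integral_of_le hle, hJ, restrict_Ico_eq_restrict_Ioc,
        ← lintegral_const_mul' _ _ ENNReal.ofReal_ne_top]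
      exact (enorm_integral_le_lintegral_enorm _).trans (lintegral_mono_ae hpt)
    refine (ofReal_log_one_add_le (norm_nonneg _) (norm_nonneg _) (by positivity) hbound).trans ?_
    have hunion : Ico 0 (((n : ℝ) + 1) * h) = Ico 0 (n * h) ∪ Ico (n * h) ((n + 1) * h) :=
      (Ico_union_Ico_eq_Ico h1.1 hle).symm
    rw [hunion, lintegral_union measurableSet_Ico (Ico_disjoint_Ico_same)]
    refine add_le_add (ih h1.2) (le_of_eq ?_)
    refine setLIntegral_congr_fun measurableSet_Ico fun s hs => ?_
    simp only [floor_div_eq_of_mem_Ico hh hs, ← hy]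

end Trajectories

end EulerFlow

namespace EulerFlow

/-! ### Bounded compression of the Euler nodes of the mollified field. -/

section Compressibility

variable {d : ℕ}

/-- For open U, a limit point in U forces the sequence to be eventually in U, so the bound passes to
the limit along an increasing union; outer regularity extends it to all measurable sets. -/
theorem measurable_and_map_le_of_tendsto {f : ℕ → EuclideanSpace ℝ (Fin d) → EuclideanSpace ℝ (Fin d)}
    {g : EuclideanSpace ℝ (Fin d) → EuclideanSpace ℝ (Fin d)} (hf : ∀ j, Measurable (f j))
    (hlim : ∀ x, Tendsto (fun j => f j x) atTop (𝓝 (g x))) {L : ℝ≥0∞} (hL : L ≠ ⊤)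
    (hmap : ∀ j, Measure.map (f j) volume ≤ L • volume) :
    Measurable g ∧ Measure.map g volume ≤ L • volume := by
  have hg : Measurable g := measurable_of_tendsto_metrizable hf (tendsto_pi_nhds.2 hlim)
  refine ⟨hg, ?_⟩
  have hopen : ∀ U : Set (EuclideanSpace ℝ (Fin d)), IsOpen U →
      volume (g ⁻¹' U) ≤ L * volume U := by
    intro U hU
    have hsub : g ⁻¹' U ⊆ ⋃ k, ⋂ j ≥ k, f j ⁻¹' U := by
      intro x hx
      obtain ⟨k, hk⟩ := eventually_atTop.1 ((hlim x).eventually (hU.mem_nhds hx))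
      exact mem_iUnion.2 ⟨k, mem_iInter₂.2 fun j hj => hk j hj⟩
    refine (measure_mono hsub).trans ?_
    have hmono : Monotone fun k => ⋂ j ≥ k, f j ⁻¹' U := by
      intro k l hkl
      exact biInter_subset_biInter_left fun j (hj : l ≤ j) => hkl.trans hj
    rw [hmono.measure_iUnion]
    refine iSup_le fun k => ?_
    have h1 : volume (f k ⁻¹' U) ≤ L * volume U := by
      have := hmap k U
      rwa [Measure.map_apply (hf k) hU.measurableSet] at this
    exact (measure_mono (biInter_subset_of_mem (le_refl k))).trans h1
  refine Measure.le_iff.2 fun s _ => ?_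
  have : (L • (volume : Measure (EuclideanSpace ℝ (Fin d)))).OuterRegular :=
    Measure.OuterRegular.smul _ hL
  rw [s.measure_eq_iInf_isOpen (L • volume)]
  refine le_iInf₂ fun U hsU => le_iInf fun hU => ?_
  refine (measure_mono hsU).trans ?_
  rw [Measure.map_apply hg hU.measurableSet]
  exact hopen U hU

variable {η : EuclideanSpace ℝ (Fin d) → ℝ} {T K : ℝ} {m : ℝ → ℝ}
  {u : ℝ → EuclideanSpace ℝ (Fin d) → EuclideanSpace ℝ (Fin d)}
  {Du : ℝ → EuclideanSpace ℝ (Fin d) →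
    EuclideanSpace ℝ (Fin d) →L[ℝ] EuclideanSpace ℝ (Fin d)}

theorem FieldBounds.isBoundedField_mollify (hu : FieldBounds T K m u Du) (hη : IsMollifier η)
    {δ : ℝ} (hδ : 0 < δ) : IsBoundedField T K (mollify η δ u) where
  measurable := hu.aestronglyMeasurable_mollify hη δ
  continuous := hu.weakGradient.mono fun _ hs =>
    (contDiff_rescale_convolution hη hδ hs.1).continuous
  bound := hu.bound.mono fun _ hs => norm_rescale_convolution_le hη hδ hs

theorem FieldBounds.hasFDerivAt_integral_mollify (hu : FieldBounds T K m u Du)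
    (hη : IsMollifier η) {δ : ℝ} (hδ : 0 < δ) {a b : ℝ} (ha : a ∈ Icc 0 T) (hb : b ∈ Icc 0 T)
    (x : EuclideanSpace ℝ (Fin d)) :
    HasFDerivAt (fun x => ∫ s in a..b, mollify η δ u s x)
      (∫ s in a..b, fderiv ℝ (mollify η δ u s) x) x := by
  have hle := restrict_uIoc_le_restrict_Ioo ha hb
  have hv := hu.isBoundedField_mollify hη hδ
  refine intervalIntegral.hasFDerivAt_integral_of_dominated_of_fderiv_le (𝕜 := ℝ) (s := univ)
    (F' := fun x s => fderiv ℝ (mollify η δ u s) x)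
    (bound := fun _ => (∫ y, ‖fderiv ℝ η y‖) * K / δ) univ_mem
    (Eventually.of_forall fun x => (hv.measurable x).mono_measure hle)
    (hv.intervalIntegrable x ha hb)
    ((hu.aestronglyMeasurable_fderiv_mollify hη hδ x).mono_measure hle) ?_ (by simp) ?_
  · rw [← ae_restrict_iff' measurableSet_uIoc]
    filter_upwards [ae_mono hle hu.bound, ae_mono hle hu.weakGradient] with s h1 h2 y _
    exact norm_fderiv_rescale_convolution_le hη hδ h2.1 h1 y
  · rw [← ae_restrict_iff' measurableSet_uIoc]
    filter_upwards [ae_mono hle hu.weakGradient] with s h2 y _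
    exact ((contDiff_rescale_convolution hη hδ h2.1).differentiable (by simp) y).hasFDerivAt

theorem FieldBounds.ae_norm_fderiv_mollify_le (hu : FieldBounds T K m u Du)
    (hη : IsMollifier η) {δ : ℝ} (hδ : 0 < δ) :
    ∀ᵐ s ∂(volume.restrict (Ioo 0 T)), ∀ x,
      ‖fderiv ℝ (mollify η δ u s) x‖ ≤ (∫ y, ‖fderiv ℝ η y‖) * K / δ := by
  filter_upwards [hu.bound, hu.weakGradient] with s h1 h2 x
  exact norm_fderiv_rescale_convolution_le hη hδ h2.1 h1 x

theorem FieldBounds.intervalIntegrable (hu : FieldBounds T K m u Du) {a b : ℝ}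
    (ha : a ∈ Icc 0 T) (hb : b ∈ Icc 0 T) : IntervalIntegrable m volume a b := by
  rw [intervalIntegrable_iff]
  exact Integrable.mono_measure hu.integrable (restrict_uIoc_le_restrict_Ioo ha hb)

theorem FieldBounds.neg_trace_integral_fderiv_mollify_le (hu : FieldBounds T K m u Du)
    (hη : IsMollifier η) {δ : ℝ} (hδ : 0 < δ) {a b : ℝ} (ha : a ∈ Icc 0 T) (hb : b ∈ Icc 0 T)
    (hab : a ≤ b) (x : EuclideanSpace ℝ (Fin d)) :
    -(∑ i, ((∫ s in a..b, fderiv ℝ (mollify η δ u s) x) (EuclideanSpace.single i 1)) i) ≤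
      ∫ s in a..b, m s := by
  have hle := restrict_uIoc_le_restrict_Ioo ha hb
  have hint : IntervalIntegrable (fun s => fderiv ℝ (mollify η δ u s) x) volume a b :=
    intervalIntegrable_of_ae_norm_le (hu.aestronglyMeasurable_fderiv_mollify hη hδ x)
      ((hu.ae_norm_fderiv_mollify_le hη hδ).mono fun s hs => hs x) ha hb
  set tr : (EuclideanSpace ℝ (Fin d) →L[ℝ] EuclideanSpace ℝ (Fin d)) →L[ℝ] ℝ :=
    ∑ i, (EuclideanSpace.proj (𝕜 := ℝ) i).comp
      (ContinuousLinearMap.apply ℝ (EuclideanSpace ℝ (Fin d)) (EuclideanSpace.single i 1)) with htr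
  have htr' : ∀ A, tr A = ∑ i, (A (EuclideanSpace.single i 1)) i := by
    intro A
    simp [htr]
  rw [← htr', ← tr.intervalIntegral_comp_comm hint, ← intervalIntegral.integral_neg]
  refine intervalIntegral.integral_mono_ae_restrict hab ?_ (hu.intervalIntegrable ha hb) ?_
  · exact (IntervalIntegrable.neg ⟨tr.integrable_comp hint.1, tr.integrable_comp hint.2⟩)
  · rw [← restrict_Ioc_eq_restrict_Icc, ← uIoc_of_le hab]
    filter_upwards [ae_mono hle hu.divergence, ae_mono hle hu.weakGradient] with s h1 h2
    rw [htr']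
    exact neg_trace_fderiv_rescale_convolution_le hη hδ h2 h1 x

theorem exp_neg_two_mul_le {a : ℝ} (ha0 : 0 ≤ a) (ha : a ≤ 1 / 2) :
    Real.exp (-(2 * a)) ≤ 1 - a := by
  rw [Real.exp_neg, inv_le_comm₀ (Real.exp_pos _) (by linarith)]
  refine le_trans ?_ (Real.add_one_le_exp _)
  rw [inv_le_iff_one_le_mul₀ (by linarith)]
  nlinarith

/-- The constant of the second order expansion of the determinant at the identity. -/
noncomputable def detConst (d : ℕ) : ℝ := (exists_le_det_one_add d).choose

theorem detConst_nonneg (d : ℕ) : 0 ≤ detConst d := (exists_le_det_one_add d).choose_spec.1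

theorem le_det_one_add (A : EuclideanSpace ℝ (Fin d) →L[ℝ] EuclideanSpace ℝ (Fin d))
    (hA : ‖A‖ ≤ 1) :
    1 + ∑ i, A (EuclideanSpace.single i 1) i - detConst d * ‖A‖ ^ 2 ≤ (1 + A).det :=
  (exists_le_det_one_add d).choose_spec.2 A hA

/-- With l a bound for the derivative of the increment, the Jacobian of one step is at least 1 - a
for a = ∫m + C l², hence at least e^(-2a) because a ≤ 1/2. The exponential form multiplies well over
the steps. -/
theorem FieldBounds.map_step_le (hu : FieldBounds T K m u Du)
    (hη : IsMollifier η) {δ : ℝ} (hδ : 0 < δ) {a b : ℝ} (ha : a ∈ Icc 0 T) (hb : b ∈ Icc 0 T)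
    (hab : a ≤ b) {l : ℝ} (hl : (∫ y, ‖fderiv ℝ η y‖) * K / δ * (b - a) ≤ l) (hl2 : l ≤ 1 / 2)
    (hsmall : (∫ s in a..b, m s) + detConst d * l ^ 2 ≤ 1 / 2) :
    Measure.map (fun x => x + ∫ s in a..b, mollify η δ u s x) volume ≤
      ENNReal.ofReal (Real.exp (2 * ((∫ s in a..b, m s) + detConst d * l ^ 2))) •
        (volume : Measure (EuclideanSpace ℝ (Fin d))) := by
  have hnorm : ∀ x, ‖∫ s in a..b, fderiv ℝ (mollify η δ u s) x‖ ≤ l := fun x =>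
    (norm_intervalIntegral_le_of_ae_norm_le
      ((hu.ae_norm_fderiv_mollify_le hη hδ).mono fun s hs => hs x) ha hb hab).trans hl
  have hm0 : 0 ≤ ∫ s in a..b, m s := intervalIntegral.integral_nonneg hab fun s _ => hu.nonneg s
  have hC := detConst_nonneg d
  refine map_id_add_le (hu.hasFDerivAt_integral_mollify hη hδ ha hb)
    (fun x => (hnorm x).trans hl2) (Real.exp_pos _) fun x => ?_
  rw [← Real.exp_neg]
  refine (exp_neg_two_mul_le (by positivity) hsmall).trans ?_
  refine le_trans ?_ (le_det_one_add _ ((hnorm x).trans (by linarith)))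
  have h1 := hu.neg_trace_integral_fderiv_mollify_le hη hδ ha hb hab x
  have h2 : detConst d * ‖∫ s in a..b, fderiv ℝ (mollify η δ u s) x‖ ^ 2 ≤ detConst d * l ^ 2 := by
    gcongr
    exact hnorm x
  linarith

theorem FieldBounds.map_eulerNode_le (hu : FieldBounds T K m u Du)
    (hη : IsMollifier η) {δ : ℝ} (hδ : 0 < δ) {h : ℝ} (hh : 0 < h) {l : ℝ}
    (hl : (∫ y, ‖fderiv ℝ η y‖) * K / δ * h ≤ l) (hl2 : l ≤ 1 / 2)
    (hsmall : ∀ a ∈ Icc 0 T, ∀ b ∈ Icc 0 T, a ≤ b → b - a ≤ h →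
      (∫ s in a..b, m s) + detConst d * l ^ 2 ≤ 1 / 2) (n : ℕ) (hn : n * h ≤ T) :
    Measure.map (eulerNode (mollify η δ u) h n) volume ≤
      ENNReal.ofReal (Real.exp (2 * ((∫ s in (0 : ℝ)..(n * h), m s) + n * (detConst d * l ^ 2)))) •
        (volume : Measure (EuclideanSpace ℝ (Fin d))) := by
  have hv := hu.isBoundedField_mollify hη hδ
  induction n with
  | zero =>
    have : eulerNode (mollify η δ u) h 0 = id := rfl
    rw [this, Measure.map_id]
    simp
  | succ n ih =>
    push_cast at hn ⊢
    obtain ⟨h1, h2⟩ := mul_mem_Icc_of_succ hh hn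
    have hle : (n : ℝ) * h ≤ (n + 1) * h := by nlinarith
    have hlen : ((n : ℝ) + 1) * h - n * h = h := by ring
    have hstep := hu.map_step_le hη hδ h1 h2 hle (l := l) (by rwa [hlen]) hl2
      (hsmall _ h1 _ h2 hle hlen.le)
    set S : EuclideanSpace ℝ (Fin d) → EuclideanSpace ℝ (Fin d) :=
      fun x => x + ∫ s in (n * h)..((n + 1) * h), mollify η δ u s x with hS
    have hSm : Measurable S :=
      (continuous_id.add (hv.continuous_integral h1 h2)).measurable
    have hcomp : eulerNode (mollify η δ u) h (n + 1) = S ∘ eulerNode (mollify η δ u) h n :=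
      funext fun x => eulerNode_succ _ hh.ne' n x
    rw [hcomp, ← Measure.map_map hSm (hv.continuous_eulerNode hh n h1.2).measurable]
    refine (Measure.map_mono (ih h1.2) hSm).trans ?_
    rw [Measure.map_smul]
    refine Measure.le_iff.2 fun s hs => ?_
    have h3 := hstep s
    rw [Measure.smul_apply, smul_eq_mul] at h3 ⊢
    rw [Measure.smul_apply, smul_eq_mul]
    refine (mul_le_mul_right h3 _).trans_eq ?_
    rw [← mul_assoc, ← ENNReal.ofReal_mul (Real.exp_pos _).le, ← Real.exp_add]
    have h00 : (0 : ℝ) ∈ Icc 0 T := ⟨le_rfl, h1.1.trans h1.2⟩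
    rw [← intervalIntegral.integral_add_adjacent_intervals (hu.intervalIntegrable h00 h1)
      (hu.intervalIntegrable h1 h2)]
    congr 3
    ring

/-- Uniform absolute continuity of the integral: `m` is merely integrable, so smallness on short
intervals is not proportional to their length. -/
theorem FieldBounds.exists_integral_le (hu : FieldBounds T K m u Du) (hT : 0 ≤ T) {ε : ℝ}
    (hε : 0 < ε) : ∃ h₀ > 0, ∀ a ∈ Icc 0 T, ∀ b ∈ Icc 0 T, a ≤ b → b - a ≤ h₀ →
      ∫ s in a..b, m s ≤ ε := by
  have h00 : (0 : ℝ) ∈ Icc 0 T := left_mem_Icc.2 hT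
  have hint := hu.intervalIntegrable h00 (right_mem_Icc.2 hT)
  have hc : ContinuousOn (fun t => ∫ s in (0 : ℝ)..t, m s) (Icc 0 T) := by
    have := intervalIntegral.continuousOn_primitive_interval' hint (left_mem_uIcc)
    rwa [uIcc_of_le hT] at this
  have huc := isCompact_Icc.uniformContinuousOn_of_continuous hc
  rw [Metric.uniformContinuousOn_iff_le] at huc
  obtain ⟨h₀, hh₀, hb⟩ := huc ε hε
  refine ⟨h₀, hh₀, fun a ha b hb' hab hle => ?_⟩
  have h1 := hb b hb' a ha (by rwa [Real.dist_eq, abs_of_nonneg (sub_nonneg.2 hab)])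
  rw [Real.dist_eq, intervalIntegral.integral_interval_sub_left (hu.intervalIntegrable h00 hb')
    (hu.intervalIntegrable h00 ha)] at h1
  exact (le_abs_self _).trans h1

/-- The Euler nodes of the mollified field are nearly incompressible, uniformly in `δ` and `h`,
as long as `h ≤ δ ^ 2` is small. -/
theorem FieldBounds.exists_map_eulerNode_le (hu : FieldBounds T K m u Du) (hT : 0 ≤ T)
    (hη : IsMollifier η) :
    ∃ h₀ > 0, ∃ L : ℝ≥0, ∀ δ h : ℝ, 0 < δ → 0 < h → h ≤ δ ^ 2 → h ≤ h₀ →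
      ∀ n : ℕ, n * h ≤ T → Measure.map (eulerNode (mollify η δ u) h n) volume ≤
        L • (volume : Measure (EuclideanSpace ℝ (Fin d))) := by
  obtain ⟨h₁, hh₁, hm⟩ := hu.exists_integral_le hT (show (0 : ℝ) < 1 / 4 by norm_num)
  set D : ℝ := |(∫ y, ‖fderiv ℝ η y‖) * K| with hD
  have hD0 : 0 ≤ D := abs_nonneg _
  have hC := detConst_nonneg d
  -- The derivative of one increment is at most l = D√h. The second entry of the minimum gives both
  -- l ≤ 1/2 and C l² ≤ 1/4, and `h₁` makes the integral of `m` at most 1/4, so the sum stays below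
  -- the required 1/2.
  refine ⟨min h₁ (1 / (4 * (detConst d + 1) * (D + 1) ^ 2)), by positivity,
    Real.toNNReal (Real.exp (2 * ((∫ s in (0 : ℝ)..T, m s) + T * (detConst d * D ^ 2)))),
    fun δ h hδ hh hhδ hh0 n hn => ?_⟩
  have hsq : √h ≤ δ := Real.sqrt_le_iff.2 ⟨hδ.le, hhδ⟩
  have hh2 : h * (4 * (detConst d + 1) * (D + 1) ^ 2) ≤ 1 := by
    rw [← le_div_iff₀ (by positivity)]
    exact hh0.trans (min_le_right _ _)
  have hl : (∫ y, ‖fderiv ℝ η y‖) * K / δ * h ≤ D * √h := by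
    calc _ ≤ D / δ * h := by
          gcongr
          exact le_abs_self _
      _ ≤ D / √h * h := by gcongr
      _ = D * √h := by
          rw [div_mul_eq_mul_div, mul_div_assoc, Real.div_sqrt]
  have hl2 : D * √h ≤ 1 / 2 := by
    refine abs_le_of_sq_le_sq' ?_ (by norm_num) |>.2
    rw [mul_pow, Real.sq_sqrt hh.le]
    nlinarith [mul_nonneg hh.le hC, mul_nonneg hh.le hD0, mul_nonneg (mul_nonneg hh.le hC) hD0,
      mul_nonneg (mul_nonneg hh.le hC) (sq_nonneg D), sq_nonneg D]
  have hl3 : detConst d * (D * √h) ^ 2 ≤ 1 / 4 := by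
    rw [mul_pow, Real.sq_sqrt hh.le]
    nlinarith [mul_nonneg hh.le hC, mul_nonneg hh.le hD0, mul_nonneg (mul_nonneg hh.le hC) hD0,
      mul_nonneg (mul_nonneg hh.le hC) (sq_nonneg D), mul_nonneg hh.le (sq_nonneg D)]
  have h1 := hu.map_eulerNode_le hη hδ hh hl hl2 (fun a ha b hb hab hle => by
    have := hm a ha b hb hab (hle.trans (hh0.trans (min_le_left _ _)))
    linarith) n hn
  refine h1.trans ?_
  have hnT : (n : ℝ) * h ∈ Icc 0 T := ⟨by positivity, hn⟩
  have h2 : (∫ s in (0 : ℝ)..(n * h), m s) ≤ ∫ s in (0 : ℝ)..T, m s := by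
    refine intervalIntegral.integral_mono_interval le_rfl hnT.1 hnT.2
      (Eventually.of_forall hu.nonneg) (hu.intervalIntegrable (left_mem_Icc.2 hT)
        (right_mem_Icc.2 hT))
  -- Here h ≤ δ² pays off: each step contributes a second order term C D² h, and the n steps
  -- together contribute at most T C D².
  have h3 : (n : ℝ) * (detConst d * (D * √h) ^ 2) ≤ T * (detConst d * D ^ 2) := by
    rw [mul_pow, Real.sq_sqrt hh.le]
    calc _ = (n * h) * (detConst d * D ^ 2) := by ring
      _ ≤ _ := by gcongr
  refine Measure.le_iff.2 fun s _ => ?_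
  rw [Measure.smul_apply, Measure.smul_apply, smul_eq_mul]
  change _ ≤ ENNReal.ofReal _ * volume s
  gcongr

end Compressibility

end EulerFlow

namespace EulerFlow

/-! ### Integrals of maximal functions along maps of bounded compression. -/

section MaximalAlongFlows

variable {d : ℕ}

/-- Jensen for the measure b ds applied to g/b. When b dominates the norms of the slices this yields
the Minkowski-type inequality below by Tonelli alone. -/
theorem lintegral_rpow_weight_le {α : Type*} [MeasurableSpace α] (ν : Measure α)
    {p : ℝ} (hp : 1 < p) {g b : α → ℝ≥0∞} (hg : AEMeasurable g ν) (hb : AEMeasurable b ν)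
    (hb0 : ∀ s, b s ≠ 0) (hbt : ∀ᵐ s ∂ν, b s ≠ ⊤) :
    (∫⁻ s, g s ∂ν) ^ p ≤ (∫⁻ s, b s ∂ν) ^ (p - 1) * ∫⁻ s, b s * (g s / b s) ^ p ∂ν := by
  have h := lintegral_rpow_le_of_one_lt (ν.withDensity b) hp (g := fun s => g s / b s)
    ((hg.div hb).mono_ac (withDensity_absolutelyContinuous _ _))
  rw [lintegral_withDensity_eq_lintegral_mul₀ hb (g := fun s => g s / b s) (hg.div hb),
    lintegral_withDensity_eq_lintegral_mul₀ hb (g := fun s => (g s / b s) ^ p)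
      ((hg.div hb).pow_const p), withDensity_apply _ MeasurableSet.univ, setLIntegral_univ] at h
  refine le_trans (le_of_eq ?_) h
  congr 1
  refine lintegral_congr_ae ?_
  filter_upwards [hbt] with s hs
  exact (ENNReal.mul_div_cancel (hb0 s) hs).symm

variable {T p q R : ℝ} {w : ℝ → EuclideanSpace ℝ (Fin d) → ℝ≥0∞}

/-- The local maximal function of order `q`. -/
noncomputable def maximalRpow (q R : ℝ) (w : ℝ → EuclideanSpace ℝ (Fin d) → ℝ≥0∞) (s : ℝ)
    (x : EuclideanSpace ℝ (Fin d)) : ℝ≥0∞ :=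
  ballMaximal volume R (fun z => w s z ^ q) x ^ (1 / q)

theorem measurable_maximalRpow (q R : ℝ) (hw : Measurable (Function.uncurry w)) :
    Measurable (Function.uncurry (maximalRpow q R w)) :=
  (measurable_ballMaximal volume R (h := fun s z => w s z ^ q) (hw.pow_const q)).pow_const _

theorem measurable_maximalRpow_comp {α : Type*} [MeasurableSpace α] (q R : ℝ)
    (hw : Measurable (Function.uncurry w)) {a : α → ℝ} {b : α → EuclideanSpace ℝ (Fin d)}
    (ha : Measurable a) (hb : Measurable b) :
    Measurable fun z => maximalRpow q R w (a z) (b z) := by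
  have h := measurable_maximalRpow q R hw
  generalize maximalRpow q R w = f at h ⊢
  exact h.comp (ha.prodMk hb)

/-- The compression bound removes ψ, and the maximal theorem is applied to w^q at exponent p/q. -/
theorem lintegral_maximalRpow_comp_rpow_le (hq0 : 0 < q) {C : ℝ≥0}
    (hC : ∀ (R : ℝ) (h : EuclideanSpace ℝ (Fin d) → ℝ≥0∞), Measurable h →
      ∫⁻ x, ballMaximal volume R h x ^ (p / q) ≤ C * ∫⁻ x, h x ^ (p / q))
    {L : ℝ≥0} (hw : Measurable (Function.uncurry w)) (s : ℝ)
    {ψ : EuclideanSpace ℝ (Fin d) → EuclideanSpace ℝ (Fin d)} (hψ : Measurable ψ)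
    (hmap : Measure.map ψ volume ≤ L • (volume : Measure (EuclideanSpace ℝ (Fin d)))) :
    ∫⁻ x, maximalRpow q R w s (ψ x) ^ p ≤ C * L * ∫⁻ z, w s z ^ p := by
  have hm : Measurable fun x => maximalRpow q R w s x ^ p :=
    ((measurable_maximalRpow q R hw).comp measurable_prodMk_left).pow_const p
  have hwm : Measurable fun z => w s z ^ q := (hw.comp measurable_prodMk_left).pow_const q
  calc ∫⁻ x, maximalRpow q R w s (ψ x) ^ p
      = ∫⁻ y, maximalRpow q R w s y ^ p ∂(Measure.map ψ volume) := (lintegral_map hm hψ).symm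
    _ ≤ ∫⁻ y, maximalRpow q R w s y ^ p ∂(L • volume) := lintegral_mono' hmap le_rfl
    _ = L * ∫⁻ y, ballMaximal volume R (fun z => w s z ^ q) y ^ (p / q) := by
        rw [lintegral_smul_measure]
        change (L : ℝ≥0∞) * _ = _
        congr 1
        refine lintegral_congr fun y => ?_
        rw [maximalRpow, ← ENNReal.rpow_mul, one_div_mul_eq_div]
    _ ≤ L * (C * ∫⁻ z, (w s z ^ q) ^ (p / q)) := by
        gcongr
        exact hC R _ hwm
    _ = C * L * ∫⁻ z, w s z ^ p := by
        rw [← mul_assoc, mul_comm (L : ℝ≥0∞)]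
        congr 1
        refine lintegral_congr fun z => ?_
        rw [← ENNReal.rpow_mul, mul_div_cancel₀ _ hq0.ne']

/-- Minkowski-type inequality: if each slice `G s` has `L^p` norm at most a multiple of `a s`,
then so has its integral in `s`. -/
theorem lintegral_rpow_lintegral_le {α : Type*} [MeasurableSpace α] {μ : Measure α} [SFinite μ]
    {ν : Measure ℝ} [SFinite ν] (hp : 1 < p) {G : ℝ × α → ℝ≥0∞} (hG : Measurable G)
    {b : ℝ → ℝ≥0∞} (hbm : Measurable b) (hb0 : ∀ s, b s ≠ 0) (hbt : ∀ᵐ s ∂ν, b s ≠ ⊤)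
    {A : ℝ≥0∞} (hslice : ∀ᵐ s ∂ν, ∫⁻ x, G (s, x) ^ p ∂μ ≤ A * b s ^ p) :
    ∫⁻ x, (∫⁻ s, G (s, x) ∂ν) ^ p ∂μ ≤ A * (∫⁻ s, b s ∂ν) ^ p := by
  have hp0 : 0 < p := by linarith
  have hm : Measurable fun z : ℝ × α => b z.1 * (G z / b z.1) ^ p :=
    (hbm.comp measurable_fst).mul ((hG.div (hbm.comp measurable_fst)).pow_const p)
  calc ∫⁻ x, (∫⁻ s, G (s, x) ∂ν) ^ p ∂μ
      ≤ ∫⁻ x, (∫⁻ s, b s ∂ν) ^ (p - 1) * (∫⁻ s, b s * (G (s, x) / b s) ^ p ∂ν) ∂μ :=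
        lintegral_mono fun x => lintegral_rpow_weight_le _ hp
          (hG.comp measurable_prodMk_right).aemeasurable hbm.aemeasurable hb0 hbt
    _ = (∫⁻ s, b s ∂ν) ^ (p - 1) * ∫⁻ s, (∫⁻ x, b s * (G (s, x) / b s) ^ p ∂μ) ∂ν := by
        have hm' : Measurable fun x => ∫⁻ s, b s * (G (s, x) / b s) ^ p ∂ν :=
          (hm.comp measurable_swap).lintegral_prod_right'
        rw [lintegral_const_mul _ hm', lintegral_lintegral_swap (f := fun s x =>
          b s * (G (s, x) / b s) ^ p) hm.aemeasurable]
    _ ≤ (∫⁻ s, b s ∂ν) ^ (p - 1) * ∫⁻ s, A * b s ∂ν := by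
        refine mul_le_mul_right (lintegral_mono_ae ?_) _
        filter_upwards [hslice, hbt] with s hs hst
        have hGs : Measurable fun x => G (s, x) := hG.comp measurable_prodMk_left
        simp_rw [div_eq_mul_inv]
        rw [lintegral_const_mul _ ((hGs.mul_const _).pow_const p)]
        simp_rw [ENNReal.mul_rpow_of_nonneg _ _ hp0.le]
        rw [lintegral_mul_const _ (hGs.pow_const p)]
        calc b s * ((∫⁻ x, G (s, x) ^ p ∂μ) * (b s)⁻¹ ^ p)
            ≤ b s * ((A * b s ^ p) * (b s)⁻¹ ^ p) := by gcongr
          _ = A * b s * (b s * (b s)⁻¹) ^ p := by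
              rw [ENNReal.mul_rpow_of_nonneg _ _ hp0.le]
              ring
          _ = A * b s := by
              rw [ENNReal.mul_inv_cancel (hb0 s) hst, ENNReal.one_rpow, mul_one]
    _ = A * ((∫⁻ s, b s ∂ν) ^ (p - 1) * (∫⁻ s, b s ∂ν) ^ (1 : ℝ)) := by
        rw [lintegral_const_mul _ hbm, ENNReal.rpow_one]
        ring
    _ = A * (∫⁻ s, b s ∂ν) ^ p := by
        rw [← ENNReal.rpow_add_of_nonneg (p - 1) 1 (by linarith) zero_le_one, sub_add_cancel]

theorem lintegral_maximalRpow_comp_le (hq0 : 0 < q) (hp : 1 < p) {C : ℝ≥0}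
    (hC : ∀ (R : ℝ) (h : EuclideanSpace ℝ (Fin d) → ℝ≥0∞), Measurable h →
      ∫⁻ x, ballMaximal volume R h x ^ (p / q) ≤ C * ∫⁻ x, h x ^ (p / q))
    {L : ℝ≥0} (hw : Measurable (Function.uncurry w))
    (hfin : ∫⁻ s in Ioo 0 T, (∫⁻ z, w s z ^ p) ^ (1 / p) < ⊤)
    {Ψ : ℝ × EuclideanSpace ℝ (Fin d) → EuclideanSpace ℝ (Fin d)} (hΨ : Measurable Ψ)
    (hmap : ∀ᵐ s ∂(volume.restrict (Ioo 0 T)), Measure.map (fun x => Ψ (s, x)) volume ≤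
        L • (volume : Measure (EuclideanSpace ℝ (Fin d)))) :
    ∫⁻ x, (∫⁻ s in Ioo 0 T, maximalRpow q R w s (Ψ (s, x))) ^ p ≤
        C * L * ((∫⁻ s in Ioo 0 T, (∫⁻ z, w s z ^ p) ^ (1 / p)) + ENNReal.ofReal T) ^ p := by
  have hp0 : 0 < p := by linarith
  have ham : Measurable fun s => (∫⁻ z, w s z ^ p) ^ (1 / p) :=
    (Measurable.lintegral_prod_right (f := fun s z => w s z ^ p) (hw.pow_const p)).pow_const _
  have hG : Measurable fun z : ℝ × EuclideanSpace ℝ (Fin d) => maximalRpow q R w z.1 (Ψ z) :=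
    measurable_maximalRpow_comp q R hw measurable_fst hΨ
  -- The weight is the slice norm plus 1, so that it never vanishes; the added 1 integrates to T.
  have hT : (∫⁻ s in Ioo 0 T, (∫⁻ z, w s z ^ p) ^ (1 / p)) + ENNReal.ofReal T =
      ∫⁻ s in Ioo 0 T, ((∫⁻ z, w s z ^ p) ^ (1 / p) + 1) := by
    rw [lintegral_add_left ham]
    simp
  rw [hT]
  refine lintegral_rpow_lintegral_le (A := C * L) hp hG (ham.add_const 1) (fun s => by simp) ?_ ?_
  · filter_upwards [ae_lt_top ham hfin.ne] with s hs
    exact (ENNReal.add_lt_top.2 ⟨hs, ENNReal.one_lt_top⟩).ne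
  · filter_upwards [hmap] with s hs
    refine (lintegral_maximalRpow_comp_rpow_le hq0 hC hw s
      (hΨ.comp measurable_prodMk_left) hs).trans ?_
    gcongr
    calc ∫⁻ z, w s z ^ p = ((∫⁻ z, w s z ^ p) ^ (1 / p)) ^ p := by
          rw [← ENNReal.rpow_mul, one_div_mul_cancel hp0.ne', ENNReal.rpow_one]
      _ ≤ _ := by
          gcongr
          exact le_self_add

/-- The maximal function of a composition need not be measurable for a merely a.e. measurable map. A
Borel version agrees with it for almost every time and almost every point, in either order of the
quantifiers. -/
theorem exists_measurable_ae_eq {ν : Measure ℝ} [SFinite ν]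
    {Ψ : ℝ → EuclideanSpace ℝ (Fin d) → EuclideanSpace ℝ (Fin d)}
    (hΨ : AEMeasurable (Function.uncurry Ψ) (ν.prod volume)) :
    ∃ Ψ' : ℝ × EuclideanSpace ℝ (Fin d) → EuclideanSpace ℝ (Fin d), Measurable Ψ' ∧
      (∀ᵐ s ∂ν, ∀ᵐ x, Ψ s x = Ψ' (s, x)) ∧ ∀ᵐ x, ∀ᵐ s ∂ν, Ψ s x = Ψ' (s, x) := by
  obtain ⟨Ψ', hm, he⟩ := hΨ
  refine ⟨Ψ', hm, Measure.ae_ae_of_ae_prod he, ?_⟩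
  have h : ∀ᵐ z ∂((volume : Measure (EuclideanSpace ℝ (Fin d))).prod ν),
      Function.uncurry Ψ (Prod.swap z) = Ψ' (Prod.swap z) :=
    Measure.measurePreserving_swap.quasiMeasurePreserving.ae he
  exact Measure.ae_ae_of_ae_prod h

theorem exists_lintegral_maximalRpow_comp_le (d : ℕ) (hq : 1 ≤ q) (hqp : q < p) :
    ∃ C : ℝ≥0, ∀ (T R : ℝ) (L : ℝ≥0) (w : ℝ → EuclideanSpace ℝ (Fin d) → ℝ≥0∞)
      (Ψ : ℝ → EuclideanSpace ℝ (Fin d) → EuclideanSpace ℝ (Fin d)),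
      Measurable (Function.uncurry w) →
      ∫⁻ s in Ioo 0 T, (∫⁻ z, w s z ^ p) ^ (1 / p) < ⊤ →
      AEMeasurable (Function.uncurry Ψ) ((volume.restrict (Ioo 0 T)).prod volume) →
      (∀ s ∈ Ioo 0 T, Measure.map (Ψ s) volume ≤
        L • (volume : Measure (EuclideanSpace ℝ (Fin d)))) →
      AEMeasurable (fun x => ∫⁻ s in Ioo 0 T, maximalRpow q R w s (Ψ s x)) ∧
      ∫⁻ x, (∫⁻ s in Ioo 0 T, maximalRpow q R w s (Ψ s x)) ^ p ≤
        C * L * ((∫⁻ s in Ioo 0 T, (∫⁻ z, w s z ^ p) ^ (1 / p)) + ENNReal.ofReal T) ^ p := by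
  have hq0 : 0 < q := by linarith
  obtain ⟨C, hC⟩ := exists_lintegral_ballMaximal_rpow_le
    (volume : Measure (EuclideanSpace ℝ (Fin d))) ((one_lt_div hq0).2 hqp)
  refine ⟨C, fun T R L w Ψ hw hfin hΨ hmap => ?_⟩
  obtain ⟨Ψ', hm, hae1, hae2⟩ := exists_measurable_ae_eq hΨ
  have heq : ∀ᵐ x, ∫⁻ s in Ioo 0 T, maximalRpow q R w s (Ψ s x) =
      ∫⁻ s in Ioo 0 T, maximalRpow q R w s (Ψ' (s, x)) := by
    filter_upwards [hae2] with x hx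
    refine lintegral_congr_ae ?_
    filter_upwards [hx] with s hs
    rw [hs]
  have hG : Measurable fun z : EuclideanSpace ℝ (Fin d) × ℝ =>
      maximalRpow q R w z.2 (Ψ' (z.2, z.1)) :=
    measurable_maximalRpow_comp q R hw measurable_snd (hm.comp measurable_swap)
  refine ⟨⟨_, hG.lintegral_prod_right', heq⟩, ?_⟩
  have h2 : ∀ᵐ s ∂(volume.restrict (Ioo 0 T)), Measure.map (fun x => Ψ' (s, x)) volume ≤
      L • (volume : Measure (EuclideanSpace ℝ (Fin d))) := by
    filter_upwards [hae1, ae_restrict_mem measurableSet_Ioo] with s hs hsm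
    rw [← Measure.map_congr hs]
    exact hmap s hsm
  refine le_trans (le_of_eq (lintegral_congr_ae ?_))
    (lintegral_maximalRpow_comp_le (R := R) hq0 (by linarith) hC hw hfin hm h2)
  filter_upwards [heq] with x hx
  rw [hx]

/-- Discretise time: the map frozen at the grid time ⌊t(n+1)⌋/(n+1) is jointly measurable after
choosing versions at countably many times, and it converges by continuity in time. -/
theorem aemeasurable_uncurry_of_continuousOn {Φ : ℝ → EuclideanSpace ℝ (Fin d) →
    EuclideanSpace ℝ (Fin d)} (hm : ∀ t ∈ Icc 0 T, AEMeasurable (Φ t))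
    (hc : ∀ᵐ x, ContinuousOn (fun t => Φ t x) (Icc 0 T)) :
    AEMeasurable (Function.uncurry Φ) ((volume.restrict (Ioo 0 T)).prod volume) := by
  classical
  set Ψ : ℕ → ℕ → EuclideanSpace ℝ (Fin d) → EuclideanSpace ℝ (Fin d) := fun n k =>
    if h : (k : ℝ) / (n + 1) ∈ Icc 0 T then (hm _ h).mk _ else 0 with hΨ
  have hΨm : ∀ n k, Measurable (Ψ n k) := by
    intro n k
    simp only [hΨ]
    split_ifs with h
    · exact (hm _ h).measurable_mk
    · exact measurable_const
  have hΨe : ∀ᵐ x, ∀ n k : ℕ, (k : ℝ) / (n + 1) ∈ Icc 0 T → Φ (k / (n + 1)) x = Ψ n k x := by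
    rw [ae_all_iff]
    intro n
    rw [ae_all_iff]
    intro k
    by_cases h : (k : ℝ) / (n + 1) ∈ Icc 0 T
    · filter_upwards [(hm _ h).ae_eq_mk] with x hx _
      simp only [hΨ, dif_pos h, hx]
    · exact Eventually.of_forall fun x hx => absurd hx h
  have hF : ∀ n, Measurable fun z : ℝ × EuclideanSpace ℝ (Fin d) =>
      Ψ n ⌊z.1 * (n + 1)⌋₊ z.2 := by
    intro n
    have h1 : Measurable fun z : ℕ × EuclideanSpace ℝ (Fin d) => Ψ n z.1 z.2 :=
      measurable_from_prod_countable_right (hΨm n)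
    exact h1.comp (((Nat.measurable_floor.comp
      (measurable_fst.mul_const _))).prodMk measurable_snd)
  refine aemeasurable_of_tendsto_metrizable_ae atTop (fun n => (hF n).aemeasurable) ?_
  have hx := (Measure.quasiMeasurePreserving_snd (μ := volume.restrict (Ioo 0 T))
    (ν := (volume : Measure (EuclideanSpace ℝ (Fin d))))).ae (hΨe.and hc)
  have hs := (Measure.quasiMeasurePreserving_fst (μ := volume.restrict (Ioo 0 T))
    (ν := (volume : Measure (EuclideanSpace ℝ (Fin d))))).ae (ae_restrict_mem measurableSet_Ioo)
  filter_upwards [hx, hs] with z hz hzs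
  have hmem : ∀ n : ℕ, (⌊z.1 * (n + 1)⌋₊ : ℝ) / (n + 1) ∈ Icc 0 T := by
    intro n
    refine ⟨by positivity, ?_⟩
    rw [div_le_iff₀ (by positivity)]
    refine (Nat.floor_le (mul_nonneg hzs.1.le (by positivity))).trans ?_
    gcongr
    exact hzs.2.le
  have heq : ∀ n : ℕ, Ψ n ⌊z.1 * (n + 1)⌋₊ z.2 = Φ (⌊z.1 * (n + 1)⌋₊ / (n + 1)) z.2 :=
    fun n => (hz.1 n _ (hmem n)).symm
  simp_rw [heq]
  have hlim : Tendsto (fun n : ℕ => (⌊z.1 * ((n : ℝ) + 1)⌋₊ : ℝ) / ((n : ℝ) + 1)) atTop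
      (𝓝 z.1) := by
    have h1 := tendsto_nat_floor_mul_div_atTop (R := ℝ) hzs.1.le
    have h2 : Tendsto (fun n : ℕ => (n : ℝ) + 1) atTop atTop :=
      tendsto_atTop_add_const_right _ _ tendsto_natCast_atTop_atTop
    exact h1.comp h2
  have h3 := hz.2 z.1 ⟨hzs.1.le, hzs.2.le⟩
  exact h3.tendsto.comp (tendsto_nhdsWithin_iff.2 ⟨hlim, Eventually.of_forall hmem⟩)

end MaximalAlongFlows

end EulerFlow

namespace EulerFlow

/-! ### The flow of the mollified field as a limit of Euler nodes. -/

section ClassicalFlow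

variable {d : ℕ} {T K : ℝ} {v : ℝ → EuclideanSpace ℝ (Fin d) → EuclideanSpace ℝ (Fin d)}

theorem floor_div_mul_le {h t : ℝ} (hh : 0 < h) (ht : 0 ≤ t) : (⌊t / h⌋₊ : ℝ) * h ≤ t := by
  rw [← le_div_iff₀ hh]
  exact Nat.floor_le (div_nonneg ht hh.le)

theorem sub_floor_div_mul_le {h t : ℝ} (hh : 0 < h) : t - (⌊t / h⌋₊ : ℝ) * h ≤ h := by
  have h1 : t / h * h < (⌊t / h⌋₊ + 1 : ℝ) * h :=
    mul_lt_mul_of_pos_right (Nat.lt_floor_add_one (t / h)) hh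
  rw [div_mul_cancel₀ _ hh.ne'] at h1
  linarith

/-- The logarithmic estimate with the constant weight Λ gives log(1 + r/(Kh)) ≤ ΛT, which is the
usual first order Gronwall bound. The exponential is harmless because it is used with δ, hence Λ,
fixed. -/
theorem IsACSolution.norm_sub_eulerNode_le_of_lipschitz {x : EuclideanSpace ℝ (Fin d)}
    {γ : ℝ → EuclideanSpace ℝ (Fin d)} (hγ : IsACSolution T v x γ)
    (hv : IsBoundedField T K v) (hK : 0 < K) {Λ : ℝ} (hΛ : 0 ≤ Λ)
    (hlip : ∀ᵐ s ∂(volume.restrict (Ioo 0 T)), ∀ a b, ‖v s a - v s b‖ ≤ Λ * ‖a - b‖)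
    {h : ℝ} (hh : 0 < h) {t : ℝ} (ht : t ∈ Icc 0 T) :
    ‖eulerNode v h ⌊t / h⌋₊ x - γ t‖ ≤ K * Real.exp (Λ * T) * h := by
  have hnt := floor_div_mul_le hh ht.1
  have hnt' := sub_floor_div_mul_le (t := t) hh
  set n := ⌊t / h⌋₊
  have hn : (n : ℝ) * h ∈ Icc 0 T := ⟨by positivity, hnt.trans ht.2⟩
  have hT : 0 ≤ T := ht.1.trans ht.2
  have h1 := hγ.ofReal_log_le hv hK hh (G := fun _ _ => ENNReal.ofReal Λ) (H := fun _ _ => 0) (by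
    filter_upwards [hlip] with s hs a b _ _
    rw [add_zero, ← ofReal_norm, ← ofReal_norm, ← ENNReal.ofReal_mul (norm_nonneg _)]
    exact ENNReal.ofReal_le_ofReal ((hs a b).trans_eq (mul_comm _ _))) n hn.2
  simp only [add_zero, lintegral_const, Measure.restrict_apply_univ, Real.volume_Ico,
    sub_zero] at h1
  rw [← ENNReal.ofReal_mul hΛ, ENNReal.ofReal_le_ofReal_iff (mul_nonneg hΛ hn.1)] at h1
  have hpos : 0 < 1 + ‖γ (n * h) - eulerNode v h n x‖ / (K * h) := by positivity
  have h2 : 1 + ‖γ (n * h) - eulerNode v h n x‖ / (K * h) ≤ Real.exp (Λ * T) :=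
    (Real.log_le_iff_le_exp hpos).1 (h1.trans (mul_le_mul_of_nonneg_left hn.2 hΛ))
  have h3 : ‖γ (n * h) - eulerNode v h n x‖ ≤ (Real.exp (Λ * T) - 1) * (K * h) := by
    rw [← div_le_iff₀ (by positivity)]
    linarith
  have h4 := hγ.norm_sub_le hv hT hn ht hnt
  have h5 : K * (t - n * h) ≤ K * h := by gcongr
  calc ‖eulerNode v h n x - γ t‖
      = ‖(γ (n * h) - eulerNode v h n x) + (γ t - γ (n * h))‖ := by
        rw [← norm_neg]
        congr 1
        abel
    _ ≤ (Real.exp (Λ * T) - 1) * (K * h) + K * h :=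
        (norm_add_le _ _).trans (add_le_add h3 (h4.trans h5))
    _ = _ := by ring

variable {η : EuclideanSpace ℝ (Fin d) → ℝ} {m : ℝ → ℝ}
  {u : ℝ → EuclideanSpace ℝ (Fin d) → EuclideanSpace ℝ (Fin d)}
  {Du : ℝ → EuclideanSpace ℝ (Fin d) →
    EuclideanSpace ℝ (Fin d) →L[ℝ] EuclideanSpace ℝ (Fin d)}

theorem FieldBounds.ae_norm_mollify_sub_le (hu : FieldBounds T K m u Du) (hη : IsMollifier η)
    {δ : ℝ} (hδ : 0 < δ) :
    ∀ᵐ s ∂(volume.restrict (Ioo 0 T)), ∀ a b, ‖mollify η δ u s a - mollify η δ u s b‖ ≤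
      (∫ y, ‖fderiv ℝ η y‖) * K / δ * ‖a - b‖ := by
  filter_upwards [hu.ae_norm_fderiv_mollify_le hη hδ, hu.weakGradient] with s hs hw a b
  exact convex_univ.norm_image_sub_le_of_norm_fderiv_le (𝕜 := ℝ)
    (fun y _ => (contDiff_rescale_convolution hη hδ hw.1).differentiable (by simp) y)
    (fun y _ => hs y) (mem_univ b) (mem_univ a)

/-- The classical flow of the mollified field is nearly incompressible, with the same constant
as its Euler nodes. -/
theorem FieldBounds.measurable_and_map_classicalFlow_le (hu : FieldBounds T K m u Du)
    (hK : 0 < K) (hη : IsMollifier η) {δ h₀ : ℝ} (hδ : 0 < δ) (hh₀ : 0 < h₀) {L : ℝ≥0}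
    (hL : ∀ h : ℝ, 0 < h → h ≤ δ ^ 2 → h ≤ h₀ →
      ∀ n : ℕ, n * h ≤ T → Measure.map (eulerNode (mollify η δ u) h n) volume ≤
        L • (volume : Measure (EuclideanSpace ℝ (Fin d))))
    {Φ : ℝ → EuclideanSpace ℝ (Fin d) → EuclideanSpace ℝ (Fin d)}
    (hΦ : IsClassicalFlow T (mollify η δ u) Φ) {t : ℝ} (ht : t ∈ Icc 0 T) :
    Measurable (Φ t) ∧ Measure.map (Φ t) volume ≤
      L • (volume : Measure (EuclideanSpace ℝ (Fin d))) := by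
  have hv := hu.isBoundedField_mollify hη hδ
  -- The steps c/(j+1) tend to 0 and all satisfy the two smallness conditions, so the constant `L`
  -- applies to every approximation.
  set c : ℝ := min (δ ^ 2) h₀ with hc
  have hc0 : 0 < c := lt_min (by positivity) hh₀
  set h : ℕ → ℝ := fun j => c / (j + 1) with hh
  have hh0 : ∀ j, 0 < h j := fun j => by positivity
  have hhc : ∀ j, h j ≤ c := fun j =>
    div_le_self hc0.le (by linarith [(Nat.cast_nonneg j : (0 : ℝ) ≤ j)])
  have hn : ∀ j, (⌊t / h j⌋₊ : ℝ) * h j ≤ T := fun j => (floor_div_mul_le (hh0 j) ht.1).trans ht.2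
  refine measurable_and_map_le_of_tendsto (L := L)
    (f := fun j => eulerNode (mollify η δ u) (h j) ⌊t / h j⌋₊)
    (fun j => (hv.continuous_eulerNode (hh0 j) _ (hn j)).measurable) (fun x => ?_)
    ENNReal.coe_ne_top
    (fun j => hL (h j) (hh0 j) ((hhc j).trans (min_le_left _ _)) ((hhc j).trans (min_le_right _ _))
      _ (hn j))
  rw [tendsto_iff_norm_sub_tendsto_zero]
  have hlim : Tendsto (fun j => K * Real.exp ((∫ y, ‖fderiv ℝ η y‖) * K / δ * T) * h j) atTop
      (𝓝 (K * Real.exp ((∫ y, ‖fderiv ℝ η y‖) * K / δ * T) * 0)) :=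
    (tendsto_const_div_atTop_nhds_zero_nat c |>.comp (tendsto_add_atTop_nat 1)).congr
      (fun j => by simp [hh]) |>.const_mul _
  rw [mul_zero] at hlim
  refine squeeze_zero (fun _ => norm_nonneg _) (fun j => ?_) hlim
  exact (hΦ x).norm_sub_eulerNode_le_of_lipschitz hv hK
    (div_nonneg (mul_nonneg (integral_nonneg fun _ => norm_nonneg _) hK.le) hδ.le)
    (hu.ae_norm_mollify_sub_le hη hδ) (hh0 j) ht

end ClassicalFlow

end EulerFlow

namespace EulerFlow

/-! ### Passage between the fundamental cell and ℝᵈ. -/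

section Torus

variable {d : ℕ}

/-- The lattice point of `ℝᵈ` with integer coordinates `k`. -/
def latticePoint (k : Fin d → ℤ) : EuclideanSpace ℝ (Fin d) :=
  WithLp.toLp 2 (fun i => (k i : ℝ))

/-- The representative of a point of the torus in the fundamental cell. -/
noncomputable def cellFract (x : EuclideanSpace ℝ (Fin d)) : EuclideanSpace ℝ (Fin d) :=
  WithLp.toLp 2 (fun i => Int.fract (x i))

theorem cellFract_mem (x : EuclideanSpace ℝ (Fin d)) : cellFract x ∈ unitCell d :=
  fun i => ⟨Int.fract_nonneg (x i), Int.fract_lt_one (x i)⟩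

theorem cellFract_add_floor (x : EuclideanSpace ℝ (Fin d)) :
    cellFract x + latticePoint (fun i => ⌊x i⌋) = x := by
  ext i
  simp [cellFract, latticePoint, Int.fract_add_floor]

theorem measurable_cellFract : Measurable (cellFract (d := d)) := by
  refine (PiLp.continuous_toLp 2 _).measurable.comp (measurable_pi_lambda _ fun i => ?_)
  exact (by fun_prop : Continuous fun x : EuclideanSpace ℝ (Fin d) => x i).measurable.fract

theorem measurableSet_unitCell : MeasurableSet (unitCell d) := by
  have : unitCell d = ⋂ i, (fun x : EuclideanSpace ℝ (Fin d) => x i) ⁻¹' Ico 0 1 := by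
    ext x
    simp [unitCell]
  rw [this]
  exact MeasurableSet.iInter fun i =>
    (by fun_prop : Continuous fun x : EuclideanSpace ℝ (Fin d) => x i).measurable measurableSet_Ico

theorem norm_le_of_mem_unitCell {x : EuclideanSpace ℝ (Fin d)} (hx : x ∈ unitCell d) :
    ‖x‖ ≤ d := by
  rw [EuclideanSpace.norm_eq]
  refine Real.sqrt_le_iff.2 ⟨Nat.cast_nonneg d, ?_⟩
  calc ∑ i, ‖x i‖ ^ 2 ≤ ∑ _i : Fin d, (1 : ℝ) := by
        refine Finset.sum_le_sum fun i _ => ?_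
        rw [Real.norm_of_nonneg (hx i).1]
        exact pow_le_one₀ (hx i).1 (hx i).2.le
    _ = d := by simp
    _ ≤ (d : ℝ) ^ 2 := by
        exact_mod_cast Nat.le_self_pow two_ne_zero d

theorem volume_unitCell_lt_top : volume (unitCell d) < ⊤ := by
  refine (measure_mono (t := Metric.closedBall 0 d) fun x hx => ?_).trans_lt
    measure_closedBall_lt_top
  rw [mem_closedBall_zero_iff]
  exact norm_le_of_mem_unitCell hx

instance : IsFiniteMeasure (torusMeasure d) :=
  ⟨by
    rw [torusMeasure, Measure.restrict_apply_univ]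
    exact volume_unitCell_lt_top⟩

/-- The preimage of a null set lies in countably many integer translates of its part in the cell.
Almost-everywhere statements and measurability on the torus therefore lift to periodic ones on ℝᵈ.
-/
theorem quasiMeasurePreserving_cellFract :
    Measure.QuasiMeasurePreserving (cellFract (d := d)) volume (torusMeasure d) := by
  refine ⟨measurable_cellFract, Measure.AbsolutelyContinuous.mk fun s hs h0 => ?_⟩
  rw [Measure.map_apply measurable_cellFract hs]
  rw [torusMeasure, Measure.restrict_apply hs] at h0
  have hsub : cellFract ⁻¹' s ⊆ ⋃ k : Fin d → ℤ,
      (fun x : EuclideanSpace ℝ (Fin d) => x - latticePoint k) ⁻¹' (s ∩ unitCell d) := by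
    intro x hx
    refine mem_iUnion.2 ⟨fun i => ⌊x i⌋, ?_⟩
    have h : x - latticePoint (fun i => ⌊x i⌋) = cellFract x :=
      sub_eq_of_eq_add (cellFract_add_floor x).symm
    rw [mem_preimage, h]
    exact ⟨hx, cellFract_mem x⟩
  refine measure_mono_null hsub (measure_iUnion_null fun k => ?_)
  rw [(measurePreserving_sub_right volume (latticePoint k)).measure_preimage
    (hs.inter measurableSet_unitCell).nullMeasurableSet]
  exact h0

theorem IsPeriodic.comp_cellFract {F : Type*} {f : EuclideanSpace ℝ (Fin d) → F}
    (hf : IsPeriodic f) (x : EuclideanSpace ℝ (Fin d)) : f (cellFract x) = f x := by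
  conv_rhs => rw [← cellFract_add_floor x]
  exact (hf _ _).symm

theorem ae_of_ae_torusMeasure {P : EuclideanSpace ℝ (Fin d) → Prop} (hP : IsPeriodic P)
    (h : ∀ᵐ x ∂(torusMeasure d), P x) : ∀ᵐ x, P x := by
  filter_upwards [quasiMeasurePreserving_cellFract.ae h] with x hx
  rwa [hP.comp_cellFract] at hx

theorem aestronglyMeasurable_of_periodic {F : Type*} [TopologicalSpace F] {ν : Measure ℝ} [SFinite ν]
    {f : ℝ → EuclideanSpace ℝ (Fin d) → F} (hf : ∀ t, IsPeriodic (f t))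
    (hm : AEStronglyMeasurable (fun z : ℝ × EuclideanSpace ℝ (Fin d) => f z.1 z.2)
      (ν.prod (torusMeasure d))) :
    AEStronglyMeasurable (fun z : ℝ × EuclideanSpace ℝ (Fin d) => f z.1 z.2)
      (ν.prod volume) := by
  have hq : Measure.QuasiMeasurePreserving
      (Prod.map id (cellFract (d := d)) : ℝ × EuclideanSpace ℝ (Fin d) → _)
      (ν.prod volume) (ν.prod (torusMeasure d)) :=
    MeasureTheory.QuasiMeasurePreserving.prodMap (Measure.QuasiMeasurePreserving.id ν)
      quasiMeasurePreserving_cellFract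
  refine (hm.comp_quasiMeasurePreserving hq).congr (Eventually.of_forall fun z => ?_)
  exact (hf z.1).comp_cellFract z.2

/-- Integrals of periodic functions over balls are controlled by the integral over the cell. -/
theorem exists_setLIntegral_ball_le (d : ℕ) (R : ℝ) :
    ∃ N : ℕ, ∀ F : EuclideanSpace ℝ (Fin d) → ℝ≥0∞, IsPeriodic F →
      ∫⁻ x in Metric.ball 0 R, F x ≤ N * ∫⁻ x, F x ∂(torusMeasure d) := by
  -- Integer parts of the points of the ball; the margin of 1 absorbs the rounding by the floor.
  set S : Finset (Fin d → ℤ) := Fintype.piFinset fun _ => Finset.Icc (-(⌈R⌉ + 1)) (⌈R⌉ + 1) with hS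
  refine ⟨S.card, fun F hF => ?_⟩
  have hsub : Metric.ball (0 : EuclideanSpace ℝ (Fin d)) R ⊆ ⋃ k : S,
      (fun x : EuclideanSpace ℝ (Fin d) => x - latticePoint k.1) ⁻¹' unitCell d := by
    intro x hx
    rw [mem_ball_zero_iff] at hx
    have hmem : (fun i => ⌊x i⌋) ∈ S := by
      rw [hS, Fintype.mem_piFinset]
      intro i
      have h1 : |x i| < R := (PiLp.norm_apply_le x i).trans_lt hx
      have h2 := abs_lt.1 h1
      have h3 : R ≤ ⌈R⌉ := Int.le_ceil R
      rw [Finset.mem_Icc]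
      constructor
      · rw [Int.le_floor]
        push_cast
        linarith
      · rw [← Int.cast_le (R := ℝ)]
        push_cast
        linarith [Int.floor_le (x i)]
    refine mem_iUnion.2 ⟨⟨_, hmem⟩, ?_⟩
    have h : x - latticePoint (fun i => ⌊x i⌋) = cellFract x :=
      sub_eq_of_eq_add (cellFract_add_floor x).symm
    rw [mem_preimage, h]
    exact cellFract_mem x
  have hcell : ∀ k : Fin d → ℤ, ∫⁻ x in
      (fun x : EuclideanSpace ℝ (Fin d) => x - latticePoint k) ⁻¹' unitCell d, F x =
      ∫⁻ x, F x ∂(torusMeasure d) := by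
    intro k
    have h := (measurePreserving_sub_right volume (latticePoint k)).setLIntegral_comp_preimage_emb
      (MeasurableEquiv.subRight (latticePoint k)).measurableEmbedding F (unitCell d)
    rw [torusMeasure, ← h]
    refine lintegral_congr fun x => ?_
    conv_lhs => rw [← sub_add_cancel x (latticePoint k)]
    exact hF k _
  calc ∫⁻ x in Metric.ball 0 R, F x ≤ ∫⁻ x in ⋃ k : S,
      (fun x : EuclideanSpace ℝ (Fin d) => x - latticePoint k.1) ⁻¹' unitCell d, F x :=
        lintegral_mono_set hsub
    _ ≤ ∑' k : S, ∫⁻ x in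
      (fun x : EuclideanSpace ℝ (Fin d) => x - latticePoint k.1) ⁻¹' unitCell d, F x :=
        lintegral_iUnion_le _ _
    _ = S.card * ∫⁻ x, F x ∂(torusMeasure d) := by
        simp_rw [hcell]
        rw [tsum_fintype]
        simp

end Torus

end EulerFlow

namespace EulerFlow

/-! ### From the hypotheses on the torus to bounds on ℝᵈ. -/

section TorusFields

variable {d : ℕ} {T p : ℝ} {u : ℝ → EuclideanSpace ℝ (Fin d) → EuclideanSpace ℝ (Fin d)}
  {Du : ℝ → EuclideanSpace ℝ (Fin d) →
    EuclideanSpace ℝ (Fin d) →L[ℝ] EuclideanSpace ℝ (Fin d)}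

/-- The essential supremum is at most c exactly when the slice of {f > c} is null, and the measure
of slices is measurable. -/
theorem measurable_essSup_prodMk {α β : Type*} [MeasurableSpace α] [MeasurableSpace β]
    {μ : Measure β} [SFinite μ] {f : α × β → ℝ≥0∞} (hf : Measurable f) :
    Measurable fun s => essSup (fun x => f (s, x)) μ := by
  refine measurable_of_Iic fun c => ?_
  have h : (fun s => essSup (fun x => f (s, x)) μ) ⁻¹' Iic c =
      (fun s => μ (Prod.mk s ⁻¹' {z | c < f z})) ⁻¹' {0} := by
    ext s
    rw [mem_preimage, mem_preimage, mem_Iic, mem_singleton_iff]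
    have h2 : μ (Prod.mk s ⁻¹' {z | c < f z}) = 0 ↔ ∀ᵐ x ∂μ, f (s, x) ≤ c := by
      rw [ae_iff]
      simp [preimage]
    rw [h2]
    refine ⟨fun h => ?_, fun h => essSup_le_of_ae_le _ h⟩
    filter_upwards [ENNReal.ae_le_essSup (μ := μ) fun x => f (s, x)] with x hx
    exact hx.trans h
  rw [h]
  exact measurable_measure_prodMk_left (measurableSet_lt measurable_const hf)
    (measurableSet_singleton 0)

theorem ae_norm_le_toReal_eLpNorm_top {α F : Type*} [MeasurableSpace α] {μ : Measure α}
    [NormedAddCommGroup F] {f : α → F} (hf : eLpNorm f ⊤ μ < ⊤) :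
    ∀ᵐ x ∂μ, ‖f x‖ ≤ (eLpNorm f ⊤ μ).toReal := by
  have h := ae_le_eLpNormEssSup (f := f) (μ := μ)
  rw [← eLpNorm_exponent_top] at h
  filter_upwards [h] with x hx
  rw [← toReal_enorm]
  exact ENNReal.toReal_mono hf.ne hx

theorem IsL1SobolevField.aestronglyMeasurable_divNeg (hu : IsL1SobolevField T p u Du) :
    AEStronglyMeasurable (fun z : ℝ × EuclideanSpace ℝ (Fin d) => divNeg Du z.1 z.2)
      (spaceTimeMeasure d T) := by
  have hc : Continuous fun A : EuclideanSpace ℝ (Fin d) →L[ℝ] EuclideanSpace ℝ (Fin d) =>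
      max (-(∑ i, (A (EuclideanSpace.single i 1)) i)) 0 := by
    fun_prop
  exact hc.comp_aestronglyMeasurable hu.measurable_grad

theorem exists_divergence_bound_of_eLpNorm_top_lt_top
    (h : eLpNorm (fun z : ℝ × EuclideanSpace ℝ (Fin d) => divNeg Du z.1 z.2) ⊤
        (spaceTimeMeasure d T) < ⊤) :
    ∃ m : ℝ → ℝ, IntegrableOn m (Ioo 0 T) ∧ (∀ s, 0 ≤ m s) ∧
      ∀ᵐ s ∂(volume.restrict (Ioo 0 T)), ∀ᵐ x ∂(torusMeasure d), divNeg Du s x ≤ m s := by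
  refine ⟨fun _ => (eLpNorm (fun z : ℝ × EuclideanSpace ℝ (Fin d) => divNeg Du z.1 z.2) ⊤
    (spaceTimeMeasure d T)).toReal, integrableOn_const (by simp), fun _ => ENNReal.toReal_nonneg, ?_⟩
  have h1 := Measure.ae_ae_of_ae_prod (ae_norm_le_toReal_eLpNorm_top h)
  filter_upwards [h1] with s hs
  filter_upwards [hs] with x hx
  exact (Real.le_norm_self _).trans hx

/-- The bound at time s is the essential supremum of a Borel version of the divergence, which is
measurable in s and agrees with the L^∞ norm for almost every s. -/
theorem IsL1SobolevField.exists_divergence_bound (hu : IsL1SobolevField T p u Du)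
    (h : ∫⁻ t in Ioo 0 T, eLpNorm (divNeg Du t) ⊤ (torusMeasure d) < ⊤) :
    ∃ m : ℝ → ℝ, IntegrableOn m (Ioo 0 T) ∧ (∀ s, 0 ≤ m s) ∧
      ∀ᵐ s ∂(volume.restrict (Ioo 0 T)), ∀ᵐ x ∂(torusMeasure d), divNeg Du s x ≤ m s := by
  obtain ⟨f, hf, hfe⟩ := hu.aestronglyMeasurable_divNeg.enorm
  have hfs : ∀ᵐ s ∂(volume.restrict (Ioo 0 T)), ∀ᵐ x ∂(torusMeasure d),
      ‖divNeg Du s x‖ₑ = f (s, x) := Measure.ae_ae_of_ae_prod hfe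
  have hm := measurable_essSup_prodMk (μ := torusMeasure d) hf
  have heq : ∀ᵐ s ∂(volume.restrict (Ioo 0 T)), essSup (fun x => f (s, x)) (torusMeasure d) =
      eLpNorm (divNeg Du s) ⊤ (torusMeasure d) := by
    filter_upwards [hfs] with s hs
    rw [eLpNorm_exponent_top, eLpNormEssSup]
    exact (essSup_congr_ae hs).symm
  rw [← lintegral_congr_ae heq] at h
  refine ⟨fun s => (essSup (fun x => f (s, x)) (torusMeasure d)).toReal,
    integrable_toReal_of_lintegral_ne_top hm.aemeasurable h.ne, fun _ => ENNReal.toReal_nonneg, ?_⟩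
  filter_upwards [heq, ae_lt_top hm h.ne] with s hs hs2
  rw [hs] at hs2 ⊢
  filter_upwards [ae_norm_le_toReal_eLpNorm_top hs2] with x hx
  exact (Real.le_norm_self _).trans hx

/-- The bound is raised to at least 1 so that K is positive and log K is nonnegative in the later
estimates. -/
theorem IsL1SobolevField.exists_fieldBounds (hu : IsL1SobolevField T p u Du)
    (hbdd : eLpNorm (fun z : ℝ × EuclideanSpace ℝ (Fin d) => u z.1 z.2) ⊤
      (spaceTimeMeasure d T) < ⊤)
    (hdiv : ∃ m : ℝ → ℝ, IntegrableOn m (Ioo 0 T) ∧ (∀ s, 0 ≤ m s) ∧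
      ∀ᵐ s ∂(volume.restrict (Ioo 0 T)), ∀ᵐ x ∂(torusMeasure d), divNeg Du s x ≤ m s) :
    ∃ K m, 1 ≤ K ∧ FieldBounds T K m u Du := by
  obtain ⟨m, hmi, hm0, hm⟩ := hdiv
  refine ⟨max 1 (eLpNorm (fun z : ℝ × EuclideanSpace ℝ (Fin d) => u z.1 z.2) ⊤
      (spaceTimeMeasure d T)).toReal, m, le_max_left _ _,
    aestronglyMeasurable_of_periodic hu.periodic hu.measurable,
    aestronglyMeasurable_of_periodic hu.periodic_grad hu.measurable_grad, ?_, hu.weakGradient,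
    hmi, hm0, ?_⟩
  · filter_upwards [Measure.ae_ae_of_ae_prod (ae_norm_le_toReal_eLpNorm_top hbdd)] with s hs
    refine ae_of_ae_torusMeasure (fun k x => ?_) (hs.mono fun x hx => hx.trans (le_max_right _ _))
    simp only [hu.periodic s k x]
  · filter_upwards [hm] with s hs
    refine ae_of_ae_torusMeasure (fun k x => ?_) (hs.mono fun x hx => (le_max_left _ _).trans hx)
    simp only [hu.periodic_grad s k x]

/-- A measurable weight that equals the norm of the gradient on a ball. -/
theorem IsL1SobolevField.exists_weight (hu : IsL1SobolevField T p u Du) (hp : 1 < p) (R : ℝ) :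
    ∃ w : ℝ → EuclideanSpace ℝ (Fin d) → ℝ≥0∞, Measurable (Function.uncurry w) ∧
      ∫⁻ s in Ioo 0 T, (∫⁻ z, w s z ^ p) ^ (1 / p) < ⊤ ∧
      ∀ᵐ s ∂(volume.restrict (Ioo 0 T)), ∀ᵐ z, z ∈ Metric.ball 0 R → w s z = ‖Du s z‖ₑ := by
  have hp0 : 0 < p := by linarith
  obtain ⟨g, hg, hge⟩ := (aestronglyMeasurable_of_periodic hu.periodic_grad
    hu.measurable_grad).enorm
  have hgs : ∀ᵐ s ∂(volume.restrict (Ioo 0 T)), ∀ᵐ z, ‖Du s z‖ₑ = g (s, z) :=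
    Measure.ae_ae_of_ae_prod hge
  obtain ⟨N, hN⟩ := exists_setLIntegral_ball_le d R
  -- A periodic gradient is in general not in L^p(ℝᵈ), where the maximal theorem is applied;
  -- trajectories from the cell stay bounded, so cutting off outside a large ball loses nothing.
  refine ⟨fun s z => (Metric.ball 0 R).indicator (fun z => g (s, z)) z, ?_, ?_, ?_⟩
  · have h : (Function.uncurry fun (s : ℝ) (z : EuclideanSpace ℝ (Fin d)) =>
        (Metric.ball 0 R).indicator (fun z => g (s, z)) z) =
        (Prod.snd ⁻¹' Metric.ball 0 R).indicator g := by
      ext ⟨s, z⟩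
      by_cases hz : z ∈ Metric.ball 0 R <;> simp [Function.uncurry, indicator, hz]
    rw [h]
    exact hg.indicator (measurable_snd Metric.isOpen_ball.measurableSet)
  · have hle : ∀ᵐ s ∂(volume.restrict (Ioo 0 T)),
        (∫⁻ z, (Metric.ball 0 R).indicator (fun z => g (s, z)) z ^ p) ^ (1 / p) ≤
        (N : ℝ≥0∞) ^ (1 / p) * (eLpNorm (u s) (ENNReal.ofReal p) (torusMeasure d)
          + eLpNorm (Du s) (ENNReal.ofReal p) (torusMeasure d)) := by
      filter_upwards [hgs] with s hs
      have h1 : ∫⁻ z, (Metric.ball 0 R).indicator (fun z => g (s, z)) z ^ p =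
          ∫⁻ z in Metric.ball 0 R, ‖Du s z‖ₑ ^ p := by
        rw [← lintegral_indicator Metric.isOpen_ball.measurableSet]
        refine lintegral_congr_ae ?_
        filter_upwards [hs] with z hz
        by_cases hzR : z ∈ Metric.ball 0 R <;> simp [indicator, hzR, hz, hp0]
      have h2 : IsPeriodic fun z => ‖Du s z‖ₑ ^ p := fun k z => by
        simp only [hu.periodic_grad s k z]
      rw [h1]
      calc (∫⁻ z in Metric.ball 0 R, ‖Du s z‖ₑ ^ p) ^ (1 / p)
          ≤ (N * ∫⁻ z, ‖Du s z‖ₑ ^ p ∂(torusMeasure d)) ^ (1 / p) := by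
            gcongr
            exact hN _ h2
        _ = (N : ℝ≥0∞) ^ (1 / p) * eLpNorm (Du s) (ENNReal.ofReal p) (torusMeasure d) := by
            rw [ENNReal.mul_rpow_of_nonneg _ _ (by positivity),
              eLpNorm_eq_lintegral_rpow_enorm_toReal (by simpa using hp0) ENNReal.ofReal_ne_top,
              ENNReal.toReal_ofReal hp0.le]
        _ ≤ _ := by
            gcongr
            exact le_add_self
    refine (lintegral_mono_ae hle).trans_lt ?_
    have hNt : (N : ℝ≥0∞) ^ (1 / p) ≠ ⊤ :=
      ENNReal.rpow_ne_top_of_nonneg (by positivity) (ENNReal.natCast_ne_top N)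
    rw [lintegral_const_mul' _ _ hNt]
    exact ENNReal.mul_lt_top hNt.lt_top hu.norm_lt_top
  · filter_upwards [hgs] with s hs
    filter_upwards [hs] with z hz hzR
    rw [indicator_of_mem hzR, hz]

end TorusFields

end EulerFlow

namespace EulerFlow

/-! ### From the logarithmic estimate to the rate 1/|log h| along one path. -/

section LogarithmicRate

/-- With y = h^(1/4), the two bounds on ρ give ρ ≤ y √b, and |log h| = 4 log(1/y) with y log(1/y) ≤
1. Interpolating keeps the factor √b, which makes the constant vanish as t → 0. -/
theorem mul_abs_log_le_of_le_sqrt {ρ h b : ℝ} (hρ0 : 0 ≤ ρ) (hh : 0 < h) (hh1 : h < 1)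
    (hb : ρ ≤ b) (hρ : ρ ≤ √h) : ρ * |Real.log h| ≤ 4 * √b := by
  have hb0 : 0 ≤ b := hρ0.trans hb
  set y := √(√h) with hy
  have hy0 : 0 < y := by positivity
  have h1 : ρ ≤ y * √b := by
    rw [hy, ← Real.sqrt_mul (Real.sqrt_nonneg h)]
    refine Real.le_sqrt_of_sq_le ?_
    rw [sq]
    exact mul_le_mul hρ hb hρ0 (Real.sqrt_nonneg h)
  have hyh : y ^ 4 = h := by
    rw [show y ^ 4 = (y ^ 2) ^ 2 by ring, hy, Real.sq_sqrt (Real.sqrt_nonneg h),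
      Real.sq_sqrt hh.le]
  have hlog : |Real.log h| = 4 * Real.log y⁻¹ := by
    rw [abs_of_neg (Real.log_neg hh hh1), ← hyh, Real.log_pow, Real.log_inv]
    push_cast
    ring
  have hy1 : y * Real.log y⁻¹ ≤ 1 := by
    have h2 := Real.log_le_sub_one_of_pos (inv_pos.2 hy0)
    calc y * Real.log y⁻¹ ≤ y * (y⁻¹ - 1) := by gcongr
      _ = 1 - y := by rw [mul_sub, mul_inv_cancel₀ hy0.ne', mul_one]
      _ ≤ 1 := by linarith
  calc ρ * |Real.log h| ≤ y * √b * |Real.log h| := by gcongr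
    _ = 4 * √b * (y * Real.log y⁻¹) := by rw [hlog]; ring
    _ ≤ 4 * √b * 1 := by gcongr
    _ = 4 * √b := mul_one _

/-- From √h < r + 2Kh one gets √h/(Kh) ≤ 3(1 + r/(Kh)), so |log h|/2 ≤ log 3 + log K + J, and log 3
≤ 2. -/
theorem abs_log_le_of_sqrt_lt {ρ h K r J : ℝ} (hh : 0 < h) (hh1 : h < 1) (hK : 1 ≤ K)
    (hr : 0 ≤ r) (hρr : ρ ≤ r + 2 * (K * h)) (hρ : √h < ρ)
    (hJ : Real.log (1 + r / (K * h)) ≤ J) : |Real.log h| ≤ 2 * (2 + Real.log K + J) := by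
  have hK0 : 0 < K := by linarith
  have hKh : 0 < K * h := by positivity
  have hs : 0 < √h := by positivity
  have h1 : √h / (K * h) ≤ 3 * (1 + r / (K * h)) := by
    calc √h / (K * h) ≤ (r + 2 * (K * h)) / (K * h) := by
          gcongr
          exact hρ.le.trans hρr
      _ = r / (K * h) + 2 := by field_simp
      _ ≤ _ := by linarith [div_nonneg hr hKh.le]
  have h2 := Real.log_le_log (by positivity) h1
  rw [Real.log_mul (by norm_num) (by positivity), Real.log_div hs.ne' hKh.ne',
    Real.log_mul hK0.ne' hh.ne', Real.log_sqrt hh.le] at h2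
  have h3 : Real.log 3 ≤ 2 := by
    have := Real.log_le_sub_one_of_pos (show (0 : ℝ) < 3 by norm_num)
    linarith
  rw [abs_of_neg (Real.log_neg hh hh1)]
  linarith

/-- Split at ρ = √h: small errors are good in themselves, and a large error forces J to be of size
|log h|, where the a priori bound ρ ≤ 2Kt suffices. -/
theorem ofReal_mul_abs_log_le {ρ h K r t : ℝ} {J : ℝ≥0∞} (hρ0 : 0 ≤ ρ) (hh : 0 < h) (hh1 : h < 1)
    (hK : 1 ≤ K) (hr : 0 ≤ r) (ht : 0 ≤ t) (hρt : ρ ≤ 2 * K * t) (hρr : ρ ≤ r + 2 * (K * h))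
    (hJ : ENNReal.ofReal (Real.log (1 + r / (K * h))) ≤ J) :
    ENNReal.ofReal (ρ * |Real.log h|) ≤
      ENNReal.ofReal (4 * √(2 * K * t) + 4 * K * t * (2 + Real.log K)) +
        ENNReal.ofReal (4 * K * t) * J := by
  have hlogK : 0 ≤ Real.log K := Real.log_nonneg hK
  have hK0 : 0 < K := by linarith
  -- At t = 0 the coefficient of J is zero, and so would be its product with J = ⊤; the error
  -- vanishes there anyway.
  rcases ht.eq_or_lt with rfl | ht0
  · have : ρ = 0 := le_antisymm (by simpa using hρt) hρ0
    simp [this]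
  rcases eq_or_ne J ⊤ with rfl | hJt
  · rw [ENNReal.mul_top (by simp only [ne_eq, ENNReal.ofReal_eq_zero, not_le]; positivity)]
    simp
  lift J to ℝ≥0 using hJt
  rw [← ENNReal.ofReal_coe_nnreal] at hJ ⊢
  rw [← ENNReal.ofReal_mul (by positivity), ← ENNReal.ofReal_add (by positivity) (by positivity)]
  rw [ENNReal.ofReal_le_ofReal_iff J.coe_nonneg] at hJ
  refine ENNReal.ofReal_le_ofReal ?_
  have hJ0 : (0 : ℝ) ≤ J := J.coe_nonneg
  rcases le_or_gt ρ (√h) with hρ | hρ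
  · have h1 := mul_abs_log_le_of_le_sqrt hρ0 hh hh1 hρt hρ
    have h2 : 0 ≤ 4 * K * t * (2 + Real.log K) + 4 * K * t * J := by positivity
    linarith
  · have h1 := abs_log_le_of_sqrt_lt hh hh1 hK hr hρr hρ hJ
    have h2 : 0 ≤ 4 * √(2 * K * t) := by positivity
    calc ρ * |Real.log h| ≤ 2 * K * t * (2 * (2 + Real.log K + J)) := by gcongr
      _ ≤ _ := by linarith

variable {d : ℕ} {T K : ℝ} {v : ℝ → EuclideanSpace ℝ (Fin d) → EuclideanSpace ℝ (Fin d)}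
  {x : EuclideanSpace ℝ (Fin d)} {γ : ℝ → EuclideanSpace ℝ (Fin d)}

theorem IsACSolution.norm_sub_eulerFlow_le (hγ : IsACSolution T v x γ)
    (hv : IsBoundedField T K v) {N : ℕ} {h : ℝ} (hh : 0 < h) (hN : N * h = T)
    {t : ℝ} (ht : t ∈ Icc 0 T) : ‖γ t - eulerFlow v h t x‖ ≤ 2 * K * t := by
  have hnt := floor_div_mul_le hh ht.1
  have h1 := hγ.norm_sub_le hv (ht.1.trans ht.2) (left_mem_Icc.2 (ht.1.trans ht.2)) ht ht.1
  have h2 := hv.norm_eulerNode_sub_le hh ⌊t / h⌋₊ (hnt.trans ht.2) x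
  have h3 := hv.norm_eulerFlow_sub_eulerNode_le hh hN ht x
  rw [hγ.2.1] at h1
  calc ‖γ t - eulerFlow v h t x‖ = ‖(γ t - x) - (eulerNode v h ⌊t / h⌋₊ x - x) -
        (eulerFlow v h t x - eulerNode v h ⌊t / h⌋₊ x)‖ := by congr 1; abel
    _ ≤ ‖γ t - x‖ + ‖eulerNode v h ⌊t / h⌋₊ x - x‖ +
        ‖eulerFlow v h t x - eulerNode v h ⌊t / h⌋₊ x‖ :=
      (_root_.norm_sub_le _ _).trans (add_le_add_left (_root_.norm_sub_le _ _) _)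
    _ ≤ 2 * K * t := by linarith

theorem IsACSolution.norm_sub_eulerFlow_le_add (hγ : IsACSolution T v x γ)
    (hv : IsBoundedField T K v) (hK : 0 ≤ K) {N : ℕ} {h : ℝ} (hh : 0 < h) (hN : N * h = T)
    {t : ℝ} (ht : t ∈ Icc 0 T) : ‖γ t - eulerFlow v h t x‖ ≤
      ‖γ (⌊t / h⌋₊ * h) - eulerNode v h ⌊t / h⌋₊ x‖ + 2 * (K * h) := by
  have hnt := floor_div_mul_le hh ht.1
  have hnt' := sub_floor_div_mul_le (t := t) hh
  have h1 := hγ.norm_sub_le hv (ht.1.trans ht.2)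
    ⟨by positivity, hnt.trans ht.2⟩ ht hnt
  have h3 := hv.norm_eulerFlow_sub_eulerNode_le hh hN ht x
  have h4 : K * (t - ⌊t / h⌋₊ * h) ≤ K * h := by gcongr
  calc ‖γ t - eulerFlow v h t x‖ = ‖(γ (⌊t / h⌋₊ * h) - eulerNode v h ⌊t / h⌋₊ x) +
        (γ t - γ (⌊t / h⌋₊ * h)) - (eulerFlow v h t x - eulerNode v h ⌊t / h⌋₊ x)‖ := by
          congr 1; abel
    _ ≤ ‖γ (⌊t / h⌋₊ * h) - eulerNode v h ⌊t / h⌋₊ x‖ + ‖γ t - γ (⌊t / h⌋₊ * h)‖ +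
        ‖eulerFlow v h t x - eulerNode v h ⌊t / h⌋₊ x‖ :=
      (_root_.norm_sub_le _ _).trans (add_le_add_left (norm_add_le _ _) _)
    _ ≤ _ := by linarith

/-- Pathwise error estimate for the Euler approximation. -/
theorem IsACSolution.enorm_sub_eulerFlow_mul_abs_log_le (hγ : IsACSolution T v x γ)
    (hv : IsBoundedField T K v) (hK : 1 ≤ K) {N : ℕ} {h : ℝ} (hh : 0 < h) (hh1 : h < 1)
    (hN : N * h = T) {G H : ℝ → EuclideanSpace ℝ (Fin d) → ℝ≥0∞}
    (hGH : ∀ᵐ s ∂(volume.restrict (Ioo 0 T)), ∀ a b, ‖a - x‖ ≤ K * T → ‖b - x‖ ≤ K * T →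
      ‖v s a - v s b‖ₑ ≤ ‖a - b‖ₑ * (G s a + H s b)) {t : ℝ} (ht : t ∈ Icc 0 T) :
    ‖γ t - eulerFlow v h t x‖ₑ * ENNReal.ofReal |Real.log h| ≤
      ENNReal.ofReal (4 * √(2 * K * t) + 4 * K * t * (2 + Real.log K)) +
        ENNReal.ofReal (4 * K * t) *
          ∫⁻ s in Ioo 0 T, (G s (γ s) + H s (eulerNode v h ⌊s / h⌋₊ x)) := by
  have hnt := (floor_div_mul_le hh ht.1).trans ht.2
  rw [← ofReal_norm, ← ENNReal.ofReal_mul (norm_nonneg _)]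
  refine ofReal_mul_abs_log_le (norm_nonneg _) hh hh1 hK (norm_nonneg _) ht.1
    (hγ.norm_sub_eulerFlow_le hv hh hN ht)
    (hγ.norm_sub_eulerFlow_le_add hv (by linarith) hh hN ht)
    ((hγ.ofReal_log_le hv (by linarith) hh hGH _ hnt).trans ?_)
  rw [restrict_Ioo_eq_restrict_Ico]
  exact lintegral_mono_set (Ico_subset_Ico_right hnt)

end LogarithmicRate

end EulerFlow

namespace EulerFlow

/-! ### The L^p bound and the constant C_t. -/

section ErrorConstant

variable {d : ℕ} {p : ℝ}

theorem volume_unitCell : volume (unitCell d) = 1 := by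
  have h : unitCell d = WithLp.ofLp ⁻¹' (univ.pi fun _ : Fin d => Ico (0 : ℝ) 1) := by
    ext x
    simp [unitCell]
  rw [h, (PiLp.volume_preserving_ofLp (Fin d)).measure_preimage
    (MeasurableSet.univ_pi fun _ => measurableSet_Ico).nullMeasurableSet]
  simp [volume_pi_pi]

theorem torusMeasure_univ : torusMeasure d univ = 1 := by
  rw [torusMeasure, Measure.restrict_apply_univ, volume_unitCell]

/-- Minkowski in L^p of the torus, whose total mass 1 leaves the constant `a` unchanged. -/
theorem eLpNorm_le_of_enorm_mul_le (hp : 1 < p)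
    {f : EuclideanSpace ℝ (Fin d) → EuclideanSpace ℝ (Fin d)}
    {J : EuclideanSpace ℝ (Fin d) → ℝ≥0∞} (hJm : AEMeasurable J (torusMeasure d)) {ℓ a b B : ℝ}
    (hJ : ∫⁻ x, J x ^ p ∂(torusMeasure d) ≤ ENNReal.ofReal B ^ p)
    (hℓ : 0 < ℓ) (ha : 0 ≤ a) (hb : 0 ≤ b) (hB : 0 ≤ B)
    (h : ∀ᵐ x ∂(torusMeasure d), ‖f x‖ₑ * ENNReal.ofReal ℓ ≤
      ENNReal.ofReal a + ENNReal.ofReal b * J x) :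
    eLpNorm f (ENNReal.ofReal p) (torusMeasure d) ≤ ENNReal.ofReal ((a + b * B) * ℓ⁻¹) := by
  have hp0 : 0 < p := by linarith
  have hroot : ∀ y : ℝ≥0∞, (y ^ p) ^ (1 / p) = y := fun y => by
    rw [← ENNReal.rpow_mul, mul_one_div_cancel hp0.ne', ENNReal.rpow_one]
  have h1 : eLpNorm f (ENNReal.ofReal p) (torusMeasure d) * ENNReal.ofReal ℓ =
      (∫⁻ x, (‖f x‖ₑ * ENNReal.ofReal ℓ) ^ p ∂(torusMeasure d)) ^ (1 / p) := by
    simp_rw [ENNReal.mul_rpow_of_nonneg _ _ hp0.le]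
    rw [lintegral_mul_const' _ _ (ENNReal.rpow_ne_top_of_nonneg hp0.le ENNReal.ofReal_ne_top),
      ENNReal.mul_rpow_of_nonneg _ _ (by positivity), hroot,
      eLpNorm_eq_lintegral_rpow_enorm_toReal (by simpa using hp0) ENNReal.ofReal_ne_top,
      ENNReal.toReal_ofReal hp0.le]
  have h2 : (∫⁻ x, (‖f x‖ₑ * ENNReal.ofReal ℓ) ^ p ∂(torusMeasure d)) ^ (1 / p) ≤
      ENNReal.ofReal a + ENNReal.ofReal b * ENNReal.ofReal B := by
    calc _ ≤ (∫⁻ x, ((fun _ => ENNReal.ofReal a) + fun x => ENNReal.ofReal b * J x :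
          EuclideanSpace ℝ (Fin d) → ℝ≥0∞) x ^ p ∂(torusMeasure d)) ^ (1 / p) := by
          refine ENNReal.rpow_le_rpow (lintegral_mono_ae ?_) (by positivity)
          filter_upwards [h] with x hx
          exact ENNReal.rpow_le_rpow hx hp0.le
      _ ≤ _ := ENNReal.lintegral_Lp_add_le aemeasurable_const (hJm.const_mul _) hp.le
      _ ≤ _ := by
          simp_rw [ENNReal.mul_rpow_of_nonneg _ _ hp0.le]
          rw [lintegral_const, torusMeasure_univ, mul_one, hroot, lintegral_const_mul' _ _
            (ENNReal.rpow_ne_top_of_nonneg hp0.le ENNReal.ofReal_ne_top)]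
          gcongr
          calc _ ≤ (ENNReal.ofReal b ^ p * ENNReal.ofReal B ^ p) ^ (1 / p) := by gcongr
            _ = _ := by rw [← ENNReal.mul_rpow_of_nonneg _ _ hp0.le, hroot]
  rw [← h1, ← ENNReal.ofReal_mul hb, ← ENNReal.ofReal_add ha (by positivity)] at h2
  rw [← div_eq_mul_inv, ENNReal.ofReal_div_of_pos hℓ, ENNReal.le_div_iff_mul_le
    (Or.inl (by simpa using hℓ)) (Or.inl ENNReal.ofReal_ne_top)]
  exact h2

/-- The constant `C_t` of the error estimates. -/
noncomputable def errorConstant (K B D t : ℝ) : ℝ :=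
  4 * √(2 * K * t) + 4 * K * t * (2 + Real.log K) + 4 * K * t * B + 2 * K * t * D

theorem isVanishingConstant_errorConstant (T K B D : ℝ) :
    IsVanishingConstant T (errorConstant K B D) := by
  have hc : Continuous (errorConstant K B D) := by
    unfold errorConstant
    fun_prop
  refine ⟨(isCompact_Icc.image hc).bddAbove, ?_⟩
  have h := hc.tendsto 0
  rw [show errorConstant K B D 0 = 0 by simp [errorConstant]] at h
  exact h.mono_left nhdsWithin_le_nhds

variable {T K B h h₀ : ℝ}

/-- Reduction of the error estimate to small time steps and to a pathwise logarithmic bound. -/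
theorem eLpNorm_le_errorConstant (hp : 1 < p) (hK : 1 ≤ K) (hB : 0 ≤ B) (hh₀ : 0 < h₀)
    (hh : 0 < h) (hhT : h ≤ T) (hh1 : h ≠ 1) {t : ℝ} (ht : 0 ≤ t)
    {f : EuclideanSpace ℝ (Fin d) → EuclideanSpace ℝ (Fin d)}
    (hf : ∀ᵐ x ∂(torusMeasure d), ‖f x‖ ≤ 2 * K * t)
    (hmain : h ≤ h₀ → h < 1 → ∃ J : EuclideanSpace ℝ (Fin d) → ℝ≥0∞,
      AEMeasurable J (torusMeasure d) ∧
      ∫⁻ x, J x ^ p ∂(torusMeasure d) ≤ ENNReal.ofReal B ^ p ∧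
      ∀ᵐ x ∂(torusMeasure d), ‖f x‖ₑ * ENNReal.ofReal |Real.log h| ≤
        ENNReal.ofReal (4 * √(2 * K * t) + 4 * K * t * (2 + Real.log K)) +
          ENNReal.ofReal (4 * K * t) * J x) :
    eLpNorm f (ENNReal.ofReal p) (torusMeasure d) ≤ ENNReal.ofReal
      (errorConstant K B (|Real.log (min h₀ 1)| + |Real.log T|) t * |Real.log h|⁻¹) := by
  have hlogK : 0 ≤ Real.log K := Real.log_nonneg hK
  have hK0 : 0 < K := by linarith
  have hp0 : 0 < p := by linarith
  have hℓ : 0 < |Real.log h| :=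
    abs_pos.2 (Real.log_ne_zero_of_pos_of_ne_one hh hh1)
  set D := |Real.log (min h₀ 1)| + |Real.log T| with hD
  have hD0 : 0 ≤ D := by positivity
  by_cases hs : h ≤ h₀ ∧ h < 1
  · obtain ⟨J, hJm, hJ, hle⟩ := hmain hs.1 hs.2
    refine (eLpNorm_le_of_enorm_mul_le hp hJm hJ hℓ (by positivity) (by positivity) hB hle).trans
      (ENNReal.ofReal_le_ofReal (mul_le_mul_of_nonneg_right ?_ (by positivity)))
    have : 0 ≤ 2 * K * t * D := by positivity
    simp only [errorConstant]
    linarith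
  -- For steps that are not small, h lies between min h₀ 1 and T, so |log h| ≤ D and the a priori
  -- bound 2Kt is enough. This is the last term of `errorConstant`.
  · have hlarge : min h₀ 1 ≤ h := by
      by_contra hcon
      rw [not_le, lt_min_iff] at hcon
      exact hs ⟨hcon.1.le, hcon.2⟩
    have hlog : |Real.log h| ≤ D := by
      have hm : 0 < min h₀ 1 := lt_min hh₀ one_pos
      have h1 := Real.log_le_log hm hlarge
      have h2 := Real.log_le_log hh hhT
      rw [abs_le]
      have h3 := neg_abs_le (Real.log (min h₀ 1))
      have h4 := le_abs_self (Real.log T)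
      constructor <;> linarith [abs_nonneg (Real.log (min h₀ 1)), abs_nonneg (Real.log T)]
    refine (eLpNorm_le_of_enorm_mul_le (J := fun _ => 0) (a := 2 * K * t * D) (b := 0) (B := 0)
      hp aemeasurable_const (by simp [hp0]) hℓ (by positivity) le_rfl le_rfl ?_).trans
      (ENNReal.ofReal_le_ofReal (mul_le_mul_of_nonneg_right ?_ (by positivity)))
    · filter_upwards [hf] with x hx
      rw [mul_zero, add_zero, ← ofReal_norm, ← ENNReal.ofReal_mul (norm_nonneg _)]
      exact ENNReal.ofReal_le_ofReal (by gcongr)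
    · have : 0 ≤ 4 * √(2 * K * t) + 4 * K * t * (2 + Real.log K) + 4 * K * t * B := by positivity
      simp only [errorConstant]
      linarith

end ErrorConstant

/-! ### Maximal bounds from the localised weight, and measurability of the Euler nodes. -/

section Weights

variable {d : ℕ} {T : ℝ}

/-- The ball of radius ρ ≤ R about a stays inside the ball of radius R₁, on which the weight is the
norm of g. -/
theorem setLIntegral_ball_le_of_weight {F : Type*} [NormedAddCommGroup F]
    {g : EuclideanSpace ℝ (Fin d) → F} {w : EuclideanSpace ℝ (Fin d) → ℝ≥0∞} {R R₁ q ρ : ℝ}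
    (hw : ∀ᵐ z, z ∈ Metric.ball 0 R₁ → w z = ‖g z‖ₑ) {a : EuclideanSpace ℝ (Fin d)}
    (ha : ‖a‖ + R ≤ R₁) (hρ : 0 < ρ) (hρR : ρ ≤ R) :
    ∫⁻ z in Metric.ball a ρ, ‖g z‖ₑ ^ q ≤
      2 ^ d * ballMaximal volume R (fun z => w z ^ q) a *
        volume (Metric.ball (0 : EuclideanSpace ℝ (Fin d)) ρ) := by
  have h := setLIntegral_ball_le_ballMaximal volume hρ hρR (fun z => w z ^ q) a
  rw [finrank_euclideanSpace_fin] at h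
  refine le_trans (le_of_eq ?_) h
  refine setLIntegral_congr_fun_ae Metric.isOpen_ball.measurableSet ?_
  filter_upwards [hw] with z hz hza
  rw [hz]
  rw [mem_ball_zero_iff]
  rw [mem_ball_iff_norm] at hza
  calc ‖z‖ = ‖(z - a) + a‖ := by rw [sub_add_cancel]
    _ ≤ ‖z - a‖ + ‖a‖ := norm_add_le _ _
    _ < R₁ := by linarith

theorem aemeasurable_uncurry_eulerNode {K : ℝ}
    {v : ℝ → EuclideanSpace ℝ (Fin d) → EuclideanSpace ℝ (Fin d)} (hv : IsBoundedField T K v)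
    {h : ℝ} (hh : 0 < h) :
    AEMeasurable (Function.uncurry fun s x => eulerNode v h ⌊s / h⌋₊ x)
      ((volume.restrict (Ioo 0 T)).prod volume) := by
  classical
  -- Nodes beyond T are replaced by 0, since their continuity is known only up to time T; on (0,T)
  -- they are never reached.
  set N : ℕ → EuclideanSpace ℝ (Fin d) → EuclideanSpace ℝ (Fin d) := fun n =>
    if n * h ≤ T then eulerNode v h n else 0 with hN
  have hNm : ∀ n, Measurable (N n) := by
    intro n
    simp only [hN]
    split_ifs with hn
    · exact (hv.continuous_eulerNode hh n hn).measurable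
    · exact measurable_const
  have h1 : Measurable fun z : ℕ × EuclideanSpace ℝ (Fin d) => N z.1 z.2 :=
    measurable_from_prod_countable_right hNm
  have h2 : Measurable fun z : ℝ × EuclideanSpace ℝ (Fin d) => N ⌊z.1 / h⌋₊ z.2 :=
    h1.comp ((Nat.measurable_floor.comp (measurable_fst.div_const _)).prodMk measurable_snd)
  refine ⟨_, h2, ?_⟩
  filter_upwards [(Measure.quasiMeasurePreserving_fst (μ := volume.restrict (Ioo 0 T))
    (ν := (volume : Measure (EuclideanSpace ℝ (Fin d))))).ae (ae_restrict_mem measurableSet_Ioo)]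
    with z hz
  have hz2 : (⌊z.1 / h⌋₊ : ℝ) * h ≤ T := (floor_div_mul_le hh hz.1.le).trans hz.2.le
  simp only [hN, if_pos hz2, Function.uncurry]

end Weights

end EulerFlow

namespace EulerFlow

/-! ### The two error estimates. -/

section MainEstimates

variable {d : ℕ} {T p K : ℝ} {m : ℝ → ℝ} {η : EuclideanSpace ℝ (Fin d) → ℝ}
  {u : ℝ → EuclideanSpace ℝ (Fin d) → EuclideanSpace ℝ (Fin d)}
  {Du : ℝ → EuclideanSpace ℝ (Fin d) →
    EuclideanSpace ℝ (Fin d) →L[ℝ] EuclideanSpace ℝ (Fin d)}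

theorem ofReal_toReal_rpow_one_div_rpow {p : ℝ} (hp : 0 < p) {y : ℝ≥0∞} (hy : y ≠ ⊤) :
    ENNReal.ofReal (y ^ (1 / p)).toReal ^ p = y := by
  rw [ENNReal.ofReal_toReal (ENNReal.rpow_ne_top_of_nonneg (by positivity) hy), ← ENNReal.rpow_mul,
    one_div_mul_cancel hp.ne', ENNReal.rpow_one]

theorem aemeasurable_uncurry_of_isACSolution
    {v Φ : ℝ → EuclideanSpace ℝ (Fin d) → EuclideanSpace ℝ (Fin d)} (hT : 0 ≤ T)
    (hΦ : ∀ᵐ x, IsACSolution T v x (fun t => Φ t x)) (hm : ∀ t ∈ Icc 0 T, AEMeasurable (Φ t)) :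
    AEMeasurable (Function.uncurry Φ) ((volume.restrict (Ioo 0 T)).prod volume) := by
  refine aemeasurable_uncurry_of_continuousOn hm (hΦ.mono fun x hx => ?_)
  have h := hx.1.continuousOn
  rwa [uIcc_of_le hT] at h

/-- Lipschitz-type bound for the mollified field in terms of the maximal function. -/
theorem exists_enorm_mollify_sub_le (hη : IsMollifier η) :
    ∃ C : ℝ≥0, ∀ (T K R R₁ δ : ℝ)
      (u : ℝ → EuclideanSpace ℝ (Fin d) → EuclideanSpace ℝ (Fin d))
      (Du : ℝ → EuclideanSpace ℝ (Fin d) →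
        EuclideanSpace ℝ (Fin d) →L[ℝ] EuclideanSpace ℝ (Fin d))
      (w : ℝ → EuclideanSpace ℝ (Fin d) → ℝ≥0∞), 0 < δ → 2 * (K * T) + 2 * δ ≤ R →
      d + K * T + R ≤ R₁ →
      (∀ᵐ s ∂(volume.restrict (Ioo 0 T)), HasWeakGradient (u s) (Du s)) →
      (∀ᵐ s ∂(volume.restrict (Ioo 0 T)), ∀ᵐ z, z ∈ Metric.ball 0 R₁ → w s z = ‖Du s z‖ₑ) →
      ∀ x ∈ unitCell d, ∀ᵐ s ∂(volume.restrict (Ioo 0 T)), ∀ a b,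
        ‖a - x‖ ≤ K * T → ‖b - x‖ ≤ K * T →
        ‖mollify η δ u s a - mollify η δ u s b‖ₑ ≤
          ‖a - b‖ₑ * (C * maximalRpow 1 R w s a + C * maximalRpow 1 R w s b) := by
  obtain ⟨C, hC⟩ := exists_enorm_rescale_convolution_sub_le hη
  refine ⟨C * 2 ^ d, fun T K R R₁ δ u Du w hδ hR hR₁ hu hw x hx => ?_⟩
  have hxn := norm_le_of_mem_unitCell hx
  filter_upwards [hu, hw] with s hs hws a b ha hb
  have key : ∀ y, ‖y - x‖ ≤ K * T → ∀ ρ, 0 < ρ → ρ ≤ dist a b + 2 * δ →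
      ∫⁻ z in Metric.ball y ρ, ‖Du s z‖ₑ ≤ 2 ^ d * maximalRpow 1 R w s y *
        volume (Metric.ball (0 : EuclideanSpace ℝ (Fin d)) ρ) := by
    intro y hy ρ hρ hρ2
    have hab : dist a b ≤ 2 * (K * T) := by
      have := dist_triangle_right a b x
      rw [dist_eq_norm a x, dist_eq_norm b x] at this
      linarith
    have hyn : ‖y‖ ≤ K * T + d := by
      calc ‖y‖ = ‖(y - x) + x‖ := by rw [sub_add_cancel]
        _ ≤ _ := (norm_add_le _ _).trans (add_le_add hy hxn)
    have h := setLIntegral_ball_le_of_weight (q := 1) (R := R) hws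
      (by linarith : ‖y‖ + R ≤ R₁) hρ (by linarith)
    simp only [ENNReal.rpow_one] at h
    simpa only [maximalRpow, ENNReal.rpow_one, div_one] using h
  refine (hC (u s) (Du s) hs δ hδ a b _ _ (key a ha) (key b hb)).trans (le_of_eq ?_)
  push_cast
  ring

/-- The logarithmic estimate is fed with maximal functions at both endpoints; the L^p norms of their
time integrals are bounded through the compression of the flow and of the Euler nodes. All constants
are fixed before M and the flow are chosen. -/
theorem FieldBounds.exists_classicalFlow_error (hT : 0 < T) (hp : 1 < p) (hη : IsMollifier η)
    (hu : IsL1SobolevField T p u Du) (hK : 1 ≤ K) (hf : FieldBounds T K m u Du) :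
    ∃ C : ℝ → ℝ, IsVanishingConstant T C ∧
      ∀ M : ℕ, 1 ≤ M → T / M ≠ 1 →
        ∀ Φδ : ℝ → EuclideanSpace ℝ (Fin d) → EuclideanSpace ℝ (Fin d),
          IsClassicalFlow T (mollify η (Real.sqrt (T / M)) u) Φδ →
          ∀ t ∈ Icc 0 T,
            eLpNorm (fun x => Φδ t x - eulerFlow (mollify η (Real.sqrt (T / M)) u) (T / M) t x)
              (ENNReal.ofReal p) (torusMeasure d)
              ≤ ENNReal.ofReal (C t * |Real.log (T / M)|⁻¹) := by
  have hp0 : 0 < p := by linarith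
  have hK0 : 0 < K := by linarith
  obtain ⟨c, hc⟩ := exists_enorm_mollify_sub_le hη
  obtain ⟨h₀, hh₀, L, hL⟩ := hf.exists_map_eulerNode_le hT.le hη
  obtain ⟨C₁, hC₁⟩ := exists_lintegral_maximalRpow_comp_le (p := p) d (le_refl (1 : ℝ)) hp
  -- Points reached from x are at most 2KT apart and δ = √h ≤ √T, so this radius covers every scale
  -- dist + 2δ, for all M at once.
  set R : ℝ := 2 * (K * T) + 2 * √T with hR
  set R₁ : ℝ := d + K * T + R with hR₁
  obtain ⟨w, hwm, hwfin, hw⟩ := hu.exists_weight hp R₁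
  set D : ℝ≥0∞ := C₁ * L *
    ((∫⁻ s in Ioo 0 T, (∫⁻ z, w s z ^ p) ^ (1 / p)) + ENNReal.ofReal T) ^ p with hD
  have hDt : D ≠ ⊤ := ENNReal.mul_ne_top (ENNReal.mul_ne_top ENNReal.coe_ne_top ENNReal.coe_ne_top)
    (ENNReal.rpow_ne_top_of_nonneg hp0.le (ENNReal.add_ne_top.2 ⟨hwfin.ne, ENNReal.ofReal_ne_top⟩))
  have hcp : (c : ℝ≥0∞) ^ p ≠ ⊤ := ENNReal.rpow_ne_top_of_nonneg hp0.le ENNReal.coe_ne_top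
  have h2p : (2 : ℝ≥0∞) ^ (p - 1) ≠ ⊤ :=
    ENNReal.rpow_ne_top_of_nonneg (by linarith) ENNReal.ofNat_ne_top
  -- D bounds the p-th power integral of each of the two maximal terms; c is the pointwise constant,
  -- and 2 ^ (p - 1) comes from (x + y)^p ≤ 2^(p-1)(x^p + y^p).
  set D' : ℝ≥0∞ := c ^ p * (2 ^ (p - 1) * (D + D)) with hD'
  have hD't : D' ≠ ⊤ := ENNReal.mul_ne_top hcp
    (ENNReal.mul_ne_top h2p (ENNReal.add_ne_top.2 ⟨hDt, hDt⟩))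
  refine ⟨_, isVanishingConstant_errorConstant T K (D' ^ (1 / p)).toReal
    (|Real.log (min h₀ 1)| + |Real.log T|), fun M hM hM1 Φ hΦ t ht => ?_⟩
  have hM0 : (1 : ℝ) ≤ M := by exact_mod_cast hM
  set h : ℝ := T / M with hh
  have hpos : 0 < h := by positivity
  have hhT : h ≤ T := div_le_self hT.le hM0
  have hMh : (M : ℝ) * h = T := mul_div_cancel₀ T (by positivity)
  have hδ : 0 < √h := Real.sqrt_pos.2 hpos
  have hδ2 : √h ^ 2 = h := Real.sq_sqrt hpos.le
  have hv := hf.isBoundedField_mollify hη hδ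
  refine eLpNorm_le_errorConstant hp hK ENNReal.toReal_nonneg hh₀ hpos hhT hM1 ht.1
    (Eventually.of_forall fun x => (hΦ x).norm_sub_eulerFlow_le hv hpos hMh ht)
    fun hle hlt => ?_
  have hmapΦ : ∀ s ∈ Icc 0 T, Measurable (Φ s) ∧ Measure.map (Φ s) volume ≤
      L • (volume : Measure (EuclideanSpace ℝ (Fin d))) := fun s hs =>
    hf.measurable_and_map_classicalFlow_le hK0 hη hδ hh₀
      (fun h' h1 h2 h3 n hn => hL _ h' hδ h1 h2 h3 n hn) hΦ hs
  obtain ⟨hm1, hI1⟩ := hC₁ T R L w Φ hwm hwfin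
    (aemeasurable_uncurry_of_isACSolution hT.le (Eventually.of_forall hΦ)
      fun s hs => (hmapΦ s hs).1.aemeasurable)
    (fun s hs => (hmapΦ s (Ioo_subset_Icc_self hs)).2)
  obtain ⟨hm2, hI2⟩ := hC₁ T R L w
    (fun s x => eulerNode (mollify η (√h) u) h ⌊s / h⌋₊ x) hwm hwfin
    (aemeasurable_uncurry_eulerNode hv hpos)
    (fun s hs => hL _ h hδ hpos hδ2.ge hle _ ((floor_div_mul_le hpos hs.1.le).trans hs.2.le))
  set J₁ := fun x => ∫⁻ s in Ioo 0 T, maximalRpow 1 R w s (Φ s x) with hJ₁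
  set J₂ := fun x => ∫⁻ s in Ioo 0 T,
    maximalRpow 1 R w s (eulerNode (mollify η (√h) u) h ⌊s / h⌋₊ x) with hJ₂
  have hle' : torusMeasure d ≤ volume := Measure.restrict_le_self
  refine ⟨fun x => c * (J₁ x + J₂ x),
    ((hm1.mono_measure hle').add (hm2.mono_measure hle')).const_mul _, ?_, ?_⟩
  · rw [ofReal_toReal_rpow_one_div_rpow hp0 hD't]
    simp_rw [ENNReal.mul_rpow_of_nonneg _ _ hp0.le]
    rw [lintegral_const_mul' _ _ hcp, hD']
    gcongr
    calc ∫⁻ x, (J₁ x + J₂ x) ^ p ∂(torusMeasure d) ≤ ∫⁻ x, (J₁ x + J₂ x) ^ p :=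
          lintegral_mono' hle' le_rfl
      _ ≤ ∫⁻ x, 2 ^ (p - 1) * (J₁ x ^ p + J₂ x ^ p) :=
          lintegral_mono fun x => ENNReal.rpow_add_le_mul_rpow_add_rpow _ _ hp.le
      _ = 2 ^ (p - 1) * ((∫⁻ x, J₁ x ^ p) + ∫⁻ x, J₂ x ^ p) := by
          rw [lintegral_const_mul' _ _ h2p, lintegral_add_left' (hm1.pow_const p)]
      _ ≤ _ := by gcongr
  · rw [torusMeasure]
    filter_upwards [ae_restrict_mem measurableSet_unitCell] with x hx
    have hGH := hc T K R R₁ (√h) u Du w hδ (by rw [hR]; gcongr) le_rfl hf.weakGradient hw x hx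
    refine ((hΦ x).enorm_sub_eulerFlow_mul_abs_log_le hv hK hpos hlt hMh hGH ht).trans
      (le_of_eq ?_)
    have hnode : Measurable fun s : ℝ => eulerNode (mollify η (√h) u) h ⌊s / h⌋₊ x :=
      (measurable_from_nat (f := fun n => eulerNode (mollify η (√h) u) h n x)).comp
        (Nat.measurable_floor.comp (measurable_id.div_const h))
    have hmax : Measurable fun s =>
        c * maximalRpow 1 R w s (eulerNode (mollify η (√h) u) h ⌊s / h⌋₊ x) :=
      (measurable_maximalRpow_comp 1 R hwm measurable_id hnode).const_mul _
    rw [lintegral_add_right _ hmax, lintegral_const_mul' _ _ ENNReal.coe_ne_top,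
      lintegral_const_mul' _ _ ENNReal.coe_ne_top, ← mul_add]

/-- A bounded Sobolev field that is continuous in space is bounded everywhere and measurable
in time at every point. -/
theorem FieldBounds.isBoundedField (hf : FieldBounds T K m u Du) (hη : IsMollifier η)
    (hc : ∀ᵐ t ∂(volume.restrict (Ioo 0 T)), Continuous (u t)) : IsBoundedField T K u := by
  have hδ : Tendsto (fun n : ℕ => 1 / ((n : ℝ) + 1)) atTop (𝓝[>] 0) :=
    tendsto_nhdsWithin_iff.2 ⟨tendsto_one_div_add_atTop_nhds_zero_nat,
      Eventually.of_forall fun n => mem_Ioi.2 (by positivity)⟩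
  refine ⟨fun x => ?_, hc, ?_⟩
  · refine aestronglyMeasurable_of_tendsto_ae atTop
      (fun n : ℕ => hf.aestronglyMeasurable_mollify hη (1 / ((n : ℝ) + 1)) x) ?_
    filter_upwards [hc] with s hs
    exact (tendsto_rescale_convolution hη hs x).comp hδ
  · filter_upwards [hc, hf.bound] with s hs hb x
    refine le_of_tendsto (tendsto_rescale_convolution hη hs x).norm ?_
    filter_upwards [self_mem_nhdsWithin] with δ hδ
    exact norm_rescale_convolution_le hη hδ hb x

/-- Lipschitz-type bound for a continuous Sobolev field with `p > d` in terms of the maximal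
function. -/
theorem exists_enorm_sub_le_maximalRpow (hη : IsMollifier η) {q : ℝ} (hq : 1 < q) (hdq : d < q) :
    ∃ C : ℝ≥0, ∀ (T K R R₁ : ℝ)
      (u : ℝ → EuclideanSpace ℝ (Fin d) → EuclideanSpace ℝ (Fin d))
      (Du : ℝ → EuclideanSpace ℝ (Fin d) →
        EuclideanSpace ℝ (Fin d) →L[ℝ] EuclideanSpace ℝ (Fin d))
      (w : ℝ → EuclideanSpace ℝ (Fin d) → ℝ≥0∞), 6 * (K * T) ≤ R →
      d + K * T + R ≤ R₁ →
      (∀ᵐ s ∂(volume.restrict (Ioo 0 T)), HasWeakGradient (u s) (Du s)) →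
      (∀ᵐ s ∂(volume.restrict (Ioo 0 T)), Continuous (u s)) →
      (∀ᵐ s ∂(volume.restrict (Ioo 0 T)), ∀ᵐ z, z ∈ Metric.ball 0 R₁ → w s z = ‖Du s z‖ₑ) →
      ∀ x ∈ unitCell d, ∀ᵐ s ∂(volume.restrict (Ioo 0 T)), ∀ a b,
        ‖a - x‖ ≤ K * T → ‖b - x‖ ≤ K * T →
        ‖u s a - u s b‖ₑ ≤ ‖a - b‖ₑ * (C * maximalRpow q R w s a + 0) := by
  have hq0 : 0 < q := by linarith
  obtain ⟨C, hC⟩ := exists_enorm_sub_le_of_finrank_lt hη hq hdq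
  refine ⟨C * (2 ^ d) ^ (1 / q), fun T K R R₁ u Du w hR hR₁ hu hcont hw x hx => ?_⟩
  have hxn := norm_le_of_mem_unitCell hx
  filter_upwards [hu, hcont, hw] with s hs hcs hws a b ha hb
  rcases eq_or_ne a b with rfl | hne
  · simp
  have hdist : 0 < dist a b := dist_pos.2 hne
  -- The Morrey estimate uses a ball of radius 3 dist a b ≤ 6KT, hence the requirement on R.
  have hab : dist a b ≤ 2 * (K * T) := by
    have := dist_triangle_right a b x
    rw [dist_eq_norm a x, dist_eq_norm b x] at this
    linarith
  have hyn : ‖a‖ ≤ K * T + d := by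
    calc ‖a‖ = ‖(a - x) + x‖ := by rw [sub_add_cancel]
      _ ≤ _ := (norm_add_le _ _).trans (add_le_add ha hxn)
  have h := setLIntegral_ball_le_of_weight (q := q) (R := R) (ρ := 3 * dist a b) hws
    (by linarith : ‖a‖ + R ≤ R₁) (by positivity) (by linarith)
  refine (hC (u s) (Du s) hs hcs a b ((2 ^ d) ^ (1 / q) * maximalRpow q R w s a)
    (h.trans_eq ?_)).trans (le_of_eq ?_)
  · rw [ENNReal.mul_rpow_of_nonneg _ _ hq0.le, maximalRpow, ← ENNReal.rpow_mul, ← ENNReal.rpow_mul,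
      one_div_mul_cancel hq0.ne', ENNReal.rpow_one, ENNReal.rpow_one]
  · rw [add_zero, ENNReal.coe_mul, ENNReal.coe_rpow_of_nonneg _ (by positivity)]
    push_cast
    ring

/-- Same scheme with H = 0: the one-sided Morrey bound puts the whole weight on the Lagrangian
trajectory, so its compressibility suffices and the Euler map needs none. -/
theorem FieldBounds.exists_lagrangianFlow_error (hT : 0 < T) (hp : 1 < p) (hη : IsMollifier η)
    (hu : IsL1SobolevField T p u Du) (hK : 1 ≤ K) (hf : FieldBounds T K m u Du)
    (hdp : (d : ℝ) < p) (hcont : ∀ᵐ t ∂(volume.restrict (Ioo 0 T)), Continuous (u t))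
    {Φ : ℝ → EuclideanSpace ℝ (Fin d) → EuclideanSpace ℝ (Fin d)}
    (hΦ : IsRegularLagrangianFlow T u Φ) :
    ∃ C : ℝ → ℝ, IsVanishingConstant T C ∧
      ∀ M : ℕ, 1 ≤ M → T / M ≠ 1 → ∀ t ∈ Icc 0 T,
        eLpNorm (fun x => Φ t x - eulerFlow u (T / M) t x)
          (ENNReal.ofReal p) (torusMeasure d)
          ≤ ENNReal.ofReal (C t * |Real.log (T / M)|⁻¹) := by
  have hp0 : 0 < p := by linarith
  -- q > d makes the Morrey integral converge, while q < p leaves exponent p/q > 1 for the maximal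
  -- theorem.
  obtain ⟨q, hq, hqp⟩ := exists_between (max_lt hp hdp)
  have hq1 : 1 < q := (le_max_left _ _).trans_lt hq
  obtain ⟨c, hc⟩ := exists_enorm_sub_le_maximalRpow hη hq1 ((le_max_right _ _).trans_lt hq)
  obtain ⟨C₁, hC₁⟩ := exists_lintegral_maximalRpow_comp_le (p := p) d hq1.le hqp
  obtain ⟨L, hL⟩ := hΦ.compressibility
  set R : ℝ := 6 * (K * T) with hR
  set R₁ : ℝ := d + K * T + R with hR₁
  obtain ⟨w, hwm, hwfin, hw⟩ := hu.exists_weight hp R₁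
  set D : ℝ≥0∞ := C₁ * L *
    ((∫⁻ s in Ioo 0 T, (∫⁻ z, w s z ^ p) ^ (1 / p)) + ENNReal.ofReal T) ^ p with hD
  have hDt : D ≠ ⊤ := ENNReal.mul_ne_top (ENNReal.mul_ne_top ENNReal.coe_ne_top ENNReal.coe_ne_top)
    (ENNReal.rpow_ne_top_of_nonneg hp0.le (ENNReal.add_ne_top.2 ⟨hwfin.ne, ENNReal.ofReal_ne_top⟩))
  have hcp : (c : ℝ≥0∞) ^ p ≠ ⊤ := ENNReal.rpow_ne_top_of_nonneg hp0.le ENNReal.coe_ne_top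
  obtain ⟨hm1, hI1⟩ := hC₁ T R L w Φ hwm hwfin
    (aemeasurable_uncurry_of_isACSolution hT.le hΦ.solution hΦ.measurable)
    (fun s hs => hL s (Ioo_subset_Icc_self hs))
  have hle' : torusMeasure d ≤ volume := Measure.restrict_le_self
  have hv := hf.isBoundedField hη hcont
  -- The threshold h₀ is 1: no Jacobian expansion is involved, so no smallness beyond h < 1 is
  -- needed.
  refine ⟨_, isVanishingConstant_errorConstant T K ((c ^ p * D) ^ (1 / p)).toReal
    (|Real.log (min 1 1)| + |Real.log T|), fun M hM hM1 t ht => ?_⟩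
  have hM0 : (1 : ℝ) ≤ M := by exact_mod_cast hM
  have hpos : 0 < T / M := by positivity
  have hMh : (M : ℝ) * (T / M) = T := mul_div_cancel₀ T (by positivity)
  have hsol : ∀ᵐ x ∂(torusMeasure d), IsACSolution T u x (fun t => Φ t x) :=
    ae_mono hle' hΦ.solution
  refine eLpNorm_le_errorConstant hp hK ENNReal.toReal_nonneg one_pos hpos
    (div_le_self hT.le hM0) hM1 ht.1
    (hsol.mono fun x hx => hx.norm_sub_eulerFlow_le hv hpos hMh ht) fun _ hlt => ?_
  refine ⟨fun x => c * ∫⁻ s in Ioo 0 T, maximalRpow q R w s (Φ s x),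
    (hm1.mono_measure hle').const_mul _, ?_, ?_⟩
  · rw [ofReal_toReal_rpow_one_div_rpow hp0 (ENNReal.mul_ne_top hcp hDt)]
    simp_rw [ENNReal.mul_rpow_of_nonneg _ _ hp0.le]
    rw [lintegral_const_mul' _ _ hcp]
    gcongr
    exact (lintegral_mono' hle' le_rfl).trans hI1
  · have hcell : ∀ᵐ x ∂(torusMeasure d), x ∈ unitCell d := ae_restrict_mem measurableSet_unitCell
    filter_upwards [hcell, hsol] with x hx hsx
    have hGH := hc T K R R₁ u Du w le_rfl le_rfl hf.weakGradient hcont hw x hx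
    refine (hsx.enorm_sub_eulerFlow_mul_abs_log_le hv hK hpos hlt hMh
      (H := fun _ _ => 0) hGH ht).trans (le_of_eq ?_)
    simp only [add_zero]
    rw [lintegral_const_mul' _ _ ENNReal.coe_ne_top]

end MainEstimates

end EulerFlow

/-! ### The theorem. -/

theorem mainTheorem7 (d : ℕ) (T p : ℝ) (hT : 0 < T) (hp : 1 < p)
    (η : EuclideanSpace ℝ (Fin d) → ℝ) (hη : EulerFlow.IsMollifier η)
    (u : ℝ → EuclideanSpace ℝ (Fin d) → EuclideanSpace ℝ (Fin d))
    (Du : ℝ → EuclideanSpace ℝ (Fin d) →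
      EuclideanSpace ℝ (Fin d) →L[ℝ] EuclideanSpace ℝ (Fin d))
    (hu : EulerFlow.IsL1SobolevField T p u Du)
    (hbdd : eLpNorm (fun z : ℝ × EuclideanSpace ℝ (Fin d) => u z.1 z.2) ⊤
      (EulerFlow.spaceTimeMeasure d T) < ⊤)
    (hdiv_le : p ≤ d →
      eLpNorm (fun z : ℝ × EuclideanSpace ℝ (Fin d) => EulerFlow.divNeg Du z.1 z.2) ⊤
        (EulerFlow.spaceTimeMeasure d T) < ⊤)
    (hdiv_gt : (d : ℝ) < p →
      ∫⁻ t in Ioo 0 T, eLpNorm (EulerFlow.divNeg Du t) ⊤ (EulerFlow.torusMeasure d) < ⊤) :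
    (∃ C : ℝ → ℝ, EulerFlow.IsVanishingConstant T C ∧
      ∀ M : ℕ, 1 ≤ M → T / M ≠ 1 →
        ∀ Φδ : ℝ → EuclideanSpace ℝ (Fin d) → EuclideanSpace ℝ (Fin d),
          EulerFlow.IsClassicalFlow T (EulerFlow.mollify η (Real.sqrt (T / M)) u) Φδ →
          ∀ t ∈ Icc 0 T,
            eLpNorm (fun x => Φδ t x -
                EulerFlow.eulerFlow (EulerFlow.mollify η (Real.sqrt (T / M)) u) (T / M) t x)
              (ENNReal.ofReal p) (EulerFlow.torusMeasure d)
              ≤ ENNReal.ofReal (C t * |Real.log (T / M)|⁻¹)) ∧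
    ((d : ℝ) < p → (∀ᵐ t ∂(volume.restrict (Ioo 0 T)), Continuous (u t)) →
      ∀ Φ : ℝ → EuclideanSpace ℝ (Fin d) → EuclideanSpace ℝ (Fin d),
        EulerFlow.IsRegularLagrangianFlow T u Φ →
        ∃ C : ℝ → ℝ, EulerFlow.IsVanishingConstant T C ∧
          ∀ M : ℕ, 1 ≤ M → T / M ≠ 1 → ∀ t ∈ Icc 0 T,
            eLpNorm (fun x => Φ t x - EulerFlow.eulerFlow u (T / M) t x)
              (ENNReal.ofReal p) (EulerFlow.torusMeasure d)
              ≤ ENNReal.ofReal (C t * |Real.log (T / M)|⁻¹)) := by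
  have hdiv : ∃ m : ℝ → ℝ, IntegrableOn m (Ioo 0 T) ∧ (∀ s, 0 ≤ m s) ∧
      ∀ᵐ s ∂(volume.restrict (Ioo 0 T)), ∀ᵐ x ∂(EulerFlow.torusMeasure d),
        EulerFlow.divNeg Du s x ≤ m s := by
    -- Both divergence hypotheses reduce to a bound integrable in time; in the first case it is
    -- constant.
    rcases le_or_gt p d with h | h
    · exact EulerFlow.exists_divergence_bound_of_eLpNorm_top_lt_top (hdiv_le h)
    · exact hu.exists_divergence_bound (hdiv_gt h)
  obtain ⟨K, m, hK, hf⟩ := hu.exists_fieldBounds hbdd hdiv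
  exact ⟨hf.exists_classicalFlow_error hT hp hη hu hK,
    fun hdp hcont Φ hΦ => hf.exists_lagrangianFlow_error hT hp hη hu hK hdp hcont hΦ⟩
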